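/- Let $k$ be a field and let $R=\bigoplus_{i\ge 0}R_i$ be a (possibly noncommutative) standard graded $k$-algebra, i.e. $R_0=k$, $|R_i|:=\dim_k R_i<\infty$ for all $i$, and $R$ is generated by $R_1$ as a $k$-algebra. Assume $R_3=0$. Write $R_+=\bigoplus_{i>0}R_i$, let $\operatorname{Tor}^R_{n,j}(k,k)$ and $\operatorname{Ext}_R^{n,j}(k,k)$ be bigraded by the (co)homological degree $n$ and the internal degree $j$ (computed by the bar construction $T(R_+)$ and its graded dual), let $R^!=\bigoplus_n \operatorname{Ext}_R^{n,n}(k,k)$ be the Koszul dual, and put $$P_R(x,y)=\sum_{n,j}|\operatorname{Tor}^R_{n,j}(k,k)|\,x^ny^j,\qquad H_{R^!}(z)=\sum_n|R^!_n|\,z^n .$$ Let $\varphi:R_1\otimes R_1\to R_2$ be the multiplication, $K_0=k$, $K_1=R_1$, and for $n\ge2$ $$K_n=\bigcap_{i=0}^{n-2}R_1^{\otimes i}\otimes\ker\varphi\otimes R_1^{\otimes(n-2-i)}\subseteq R_1^{\otimes n}$$ (this is the dual of $R^!_n$). The generalized Koszul complex is $GK_R=\bigoplus_n R\otimes K_n$,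 where $R_i\otimes K_n$ has homological degree $n$ and internal degree $i+n$, with the differential $r\otimes v_1\otimes\cdots\otimes v_n\mapsto rv_1\otimes v_2\otimes\cdots\otimes v_n$. Let $(GK_R)_+=\bigoplus_{n>0}R\otimes K_n$ and $C=sH_+(GK_R)$, i.e. $C_{n,j}=H_{n-1,j}(GK_R)$ for $n\ge2$ and $C_0=C_1=0$; write $C_n=\bigoplus_j C_{n,j}$. (1) There are $k$-linear maps $\alpha_n:C_n\to R_2\otimes K_{n-1}$ $(n\ge2)$ that send each class to a cycle representing it. (2) For every choice of such sections $\alpha_n$, the left $R$-module $Y=GK_R\otimes T(C)$ (with the bigrading induced from $GK_R$ and $C$) with the $R$-linear map $d$ given by $$d(x\otimes y)=dx\otimes y\quad (x\in (GK_R)_+,\ y\in T(C)),\qquad d(x\otimes y\otimes z)=x\,\alpha_n(y)\otimes z\quad (x\in R,\ y\in C_n,\ z\in T(C)),$$ and $d(x\otimes 1)=0$ for $x\in R$, is a minimal bigraded free resolution of the left $R$-module $k=R/R_+$: $d^2=0$, $Y$ is free over $R$ on bihomogeneous elements, $d$ lowers the homological degree by one and preserves the internal degree, the complex is exact in positive homological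 degrees, $Y_1\to Y_0\to k\to0$ is exact, and $d(Y)\subseteq R_+Y$. (3) In $\mathbb Z[[x,y]]$ the power series $1+x-H_{R^!}(xy)\,(1-|R_1|xy+|R_2|x^2y^2)$ is non-zero, and $$P_R(x,y)=\frac{x\,H_{R^!}(xy)}{1+x-H_{R^!}(xy)\,(1-|R_1|xy+|R_2|x^2y^2)} ,$$ i.e. $P_R(x,y)$ times the denominator equals the numerator. -/

import Mathlib

open scoped TensorProduct DirectSum

noncomputable section

/-! ## Linear algebra preliminaries -/

section Prelim

variable {k : Type*} [Field k]

/-- The homology of `d`, `ker d / im d`, in the part `S`: cycles lying in `S` modulo boundaries lying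
in `S`.  If `M` is a direct sum of (bi)degrees, `d` is homogeneous and `S` is a (bi)degree, or a sum
of (bi)degrees, this is the corresponding part of the homology of `(M, d)`. -/
abbrev HomologyAt {M : Type*} [AddCommGroup M] [Module k M] (d : M →ₗ[k] M) (S : Submodule k M) :
    Type _ :=
  ↥(LinearMap.ker d ⊓ S) ⧸ (LinearMap.range d).comap (LinearMap.ker d ⊓ S).subtype

variable {V : Type*} [AddCommGroup V] [Module k V]

/-- Auxiliary: left multiplication by `v` on pairs `(t, w)`, namely `(v t, v ⊗ t)`. -/
def headSplitAux :
    V →ₗ[k] Module.End k (TensorAlgebra k V × (V ⊗[k] TensorAlgebra k V)) where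
  toFun v :=
    (LinearMap.prod (LinearMap.mulLeft k (TensorAlgebra.ι k v)) (TensorProduct.mk k V _ v)) ∘ₗ
      LinearMap.fst k _ _
  map_add' v w := by
    ext <;> simp [add_mul]
  map_smul' a v := by
    ext <;> simp [TensorProduct.smul_tmul']

/-- The map `T(V) → V ⊗ T(V)` splitting off the first tensor factor: it sends `1` to `0`
and `v · t` to `v ⊗ t`. -/
def headSplit : TensorAlgebra k V →ₗ[k] V ⊗[k] TensorAlgebra k V :=
  LinearMap.snd k _ _ ∘ₗ
    (LinearMap.applyₗ ((1, 0) : TensorAlgebra k V × (V ⊗[k] TensorAlgebra k V))) ∘ₗ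
      (TensorAlgebra.lift k (headSplitAux (k := k) (V := V))).toLinearMap

theorem headSplit_fst (t : TensorAlgebra k V) :
    (TensorAlgebra.lift k (headSplitAux (k := k) (V := V)) t (1, 0)).1 = t := by
  suffices h : ∀ p : TensorAlgebra k V × (V ⊗[k] TensorAlgebra k V),
      (TensorAlgebra.lift k (headSplitAux (k := k) (V := V)) t p).1 = t * p.1 by
    simpa using h (1, 0)
  induction t using TensorAlgebra.induction with
  | algebraMap r => intro p; simp [Algebra.smul_def]
  | ι x => intro p; simp [headSplitAux]
  | mul a b ha hb => intro p; simp [ha, hb, mul_assoc]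
  | add a b ha hb => intro p; simp [ha, hb, add_mul]

@[simp] theorem headSplit_one : headSplit (1 : TensorAlgebra k V) = 0 := by
  simp [headSplit]

@[simp] theorem headSplit_ι_mul (v : V) (t : TensorAlgebra k V) :
    headSplit (TensorAlgebra.ι k v * t) = v ⊗ₜ[k] t := by
  have h := headSplit_fst t
  simp [headSplit, headSplitAux] at h ⊢
  rw [h]

/-- Given a bigrading `𝒞` on `C`, the part of bidegree `p` of the tensor algebra `T(C)`:
it is spanned by the products `c₁ ⋯ cₘ` of homogeneous elements whose bidegrees add up to `p`. -/
def tensorPiece {C : Type*} [AddCommGroup C] [Module k C] (𝒞 : ℕ × ℕ → Submodule k C)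
    (p : ℕ × ℕ) : Submodule k (TensorAlgebra k C) :=
  Submodule.span k {t | ∃ l : List (C × (ℕ × ℕ)), (∀ x ∈ l, x.1 ∈ 𝒞 x.2) ∧
    (l.map Prod.snd).sum = p ∧ (l.map fun x => TensorAlgebra.ι k x.1).prod = t}

open Classical in
/-- Intersections commute with `V ⊗ -` over a field. -/
theorem mem_range_lTensor_iInf {M : Type*} [AddCommGroup M] [Module k M] {ι : Sort*}
    (S : ι → Submodule k M) (w : V ⊗[k] M)
    (h : ∀ i, w ∈ LinearMap.range (LinearMap.lTensor V (S i).subtype)) :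
    w ∈ LinearMap.range (LinearMap.lTensor V (⨅ i, S i).subtype) := by
  let b := Module.Basis.ofVectorSpace k V
  let e := TensorProduct.equivFinsuppOfBasisLeft (R := k) (N := M) b
  have key : ∀ (N : Submodule k M), w ∈ LinearMap.range (LinearMap.lTensor V N.subtype) ↔
      ∀ j, e w j ∈ N := by
    intro N
    constructor
    · rintro ⟨z, hz⟩ j
      rw [← hz]
      clear hz
      induction z using TensorProduct.induction_on with
      | zero => simp
      | tmul v n =>
        simp only [LinearMap.lTensor_tmul, e, TensorProduct.equivFinsuppOfBasisLeft_apply_tmul_apply]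
        exact N.smul_mem _ n.2
      | add x y hx hy =>
        rw [map_add, map_add, Finsupp.add_apply]
        exact N.add_mem hx hy
    · intro hj
      have hw : w = e.symm (e w) := by simp
      rw [hw]
      simp only [e, TensorProduct.equivFinsuppOfBasisLeft_symm_apply]
      refine Submodule.sum_mem _ fun j _ => ?_
      exact ⟨b j ⊗ₜ ⟨e w j, hj j⟩, by simp [e]⟩
  rw [key]
  intro j
  rw [Submodule.mem_iInf]
  exact fun i => (key _).1 (h i) j

end Prelim

/-! ## Standard graded algebras and minimal free resolutions of the field -/

section Graded

variable {k R : Type*} [Field k] [Ring R] [Algebra k R]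

/-- `R = ⨁ R_i` is a standard graded `k`-algebra (not necessarily commutative): `R_0 = k`, every
`R_i` is finite dimensional and `R` is generated by `R_1` as an algebra. -/
structure IsStandardGraded (𝓡 : ℕ → Submodule k R) [GradedAlgebra 𝓡] : Prop where
  nontrivial : Nontrivial R
  connected : 𝓡 0 = 1
  finite : ∀ i, Module.Finite k (𝓡 i)
  generated : Algebra.adjoin k (𝓡 1 : Set R) = ⊤

/-- The augmentation ideal `R_+ = ⨁_{i > 0} R_i`. -/
abbrev augIdeal (𝓡 : ℕ → Submodule k R) [GradedAlgebra 𝓡] : Ideal R :=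
  (HomogeneousIdeal.irrelevant 𝓡).toIdeal

/-- `(Y, d)`, where `Y` is a left `R`-module bigraded by `𝒴` (the first degree is homological, the
second one internal), is a minimal graded free resolution of the left `R`-module `k = R / R_+`
(which sits in bidegree `(0, 0)`). -/
structure IsMinimalFreeResolution (𝓡 : ℕ → Submodule k R) [GradedAlgebra 𝓡]
    {Y : Type*} [AddCommMonoid Y] [Module k Y] [Module R Y]
    (𝒴 : ℕ → ℕ → Submodule k Y) (d : Y →ₗ[R] Y) : Prop where
  /-- `Y` is the direct sum of its bihomogeneous parts -/
  isInternal : DirectSum.IsInternal fun p : ℕ × ℕ => 𝒴 p.1 p.2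
  /-- `Y` is a graded `R`-module in each homological degree -/
  smul_mem : ∀ i n j, ∀ r ∈ 𝓡 i, ∀ y ∈ 𝒴 n j, r • y ∈ 𝒴 n (i + j)
  /-- `Y` is free over `R` with a basis of bihomogeneous elements -/
  free : ∃ b : Set Y, LinearIndependent R (Subtype.val : b → Y) ∧ Submodule.span R b = ⊤ ∧
    ∀ y ∈ b, ∃ n j, y ∈ 𝒴 n j
  /-- `d` has homological degree `-1` and internal degree `0` -/
  d_mem : ∀ n j, ∀ y ∈ 𝒴 (n + 1) j, d y ∈ 𝒴 n j
  d_zero : ∀ j, ∀ y ∈ 𝒴 0 j, d y = 0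
  d_comp_d : ∀ y, d (d y) = 0
  /-- exactness in positive homological degrees -/
  exact : ∀ n, ∀ y ∈ ⨆ j, 𝒴 (n + 1) j, d y = 0 → ∃ z ∈ ⨆ j, 𝒴 (n + 2) j, d z = y
  /-- exactness of `Y_1 → Y_0 → k → 0` for some homogeneous augmentation -/
  augmentation : ∃ ε : Y →ₗ[R] (R ⧸ augIdeal 𝓡), Function.Surjective ε ∧
    (∀ n j, (n, j) ≠ (0, 0) → ∀ y ∈ 𝒴 n j, ε y = 0) ∧
    ∀ y ∈ ⨆ j, 𝒴 0 j, ε y = 0 ↔ ∃ z ∈ ⨆ j, 𝒴 1 j, d z = y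
  /-- minimality: `d Y ⊆ R_+ Y` -/
  minimal : ∀ y, d y ∈ Submodule.span R {z : Y | ∃ a ∈ augIdeal 𝓡, ∃ w : Y, z = a • w}

end Graded

/-! ## The bar construction, `Tor` and `Ext`, the Koszul dual -/

section Bar

variable {k R : Type*} [Field k] [Ring R] [Algebra k R] (𝓡 : ℕ → Submodule k R) [GradedAlgebra 𝓡]

/-- The augmentation ideal `R_+`, as a vector space over `k`. -/
def augPart : Submodule k R := (augIdeal 𝓡).restrictScalars k

/-- The tensor algebra `T(R_+) = k ⊗_R B`, where `B = R ⊗ T(R_+)` is the (normalized) bar resolution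
of `k` over `R`. -/
abbrev BarSpace : Type _ := TensorAlgebra k (augPart 𝓡)

/-- The multiplication `R_+ × R_+ → R_+`. -/
def augMul : augPart 𝓡 →ₗ[k] augPart 𝓡 →ₗ[k] augPart 𝓡 :=
  LinearMap.mk₂ k (fun a b => ⟨a.1 * b.1, (augIdeal 𝓡).mul_mem_left a.1 b.2⟩)
    (fun a b c => by ext; simp [add_mul])
    (fun r a b => by ext; simp)
    (fun a b c => by ext; simp [mul_add])
    (fun r a b => by ext; simp)

/-- For `a ∈ R_+`, the map `R_+ ⊗ T(R_+) → T(R_+)`, `b ⊗ t ↦ (ab) · t`. -/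
def barMulHead : augPart 𝓡 →ₗ[k] (augPart 𝓡 ⊗[k] BarSpace 𝓡) →ₗ[k] BarSpace 𝓡 where
  toFun a := TensorProduct.lift (LinearMap.mul k (BarSpace 𝓡) ∘ₗ TensorAlgebra.ι k ∘ₗ augMul 𝓡 a)
  map_add' a b := by refine TensorProduct.ext' fun b t => ?_; simp
  map_smul' r a := by refine TensorProduct.ext' fun b t => ?_; simp

/-- Auxiliary: for `a ∈ R_+` the endomorphism of triples
`(t, h, w) ↦ (a t, a ⊗ t, μ_a(h) - a w)`, where `μ_a(b ⊗ s) = (ab) · s`. -/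
def barAux : augPart 𝓡 →ₗ[k]
    Module.End k (BarSpace 𝓡 × (augPart 𝓡 ⊗[k] BarSpace 𝓡) × BarSpace 𝓡) where
  toFun a :=
    LinearMap.prod (LinearMap.mulLeft k (TensorAlgebra.ι k a) ∘ₗ LinearMap.fst k _ _)
      (LinearMap.prod (TensorProduct.mk k _ _ a ∘ₗ LinearMap.fst k _ _)
        (barMulHead 𝓡 a ∘ₗ LinearMap.fst k _ _ ∘ₗ LinearMap.snd k _ _ -
          LinearMap.mulLeft k (TensorAlgebra.ι k a) ∘ₗ LinearMap.snd k _ _ ∘ₗ LinearMap.snd k _ _))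
  map_add' a b := by
    ext <;> (simp [add_mul]; try abel)
  map_smul' r a := by
    ext <;> simp [TensorProduct.smul_tmul']

/-- The differential of the bar construction `k ⊗_R B = T(R_+)`: it sends `a₁ ⋯ aₙ` to
`∑_{i < n} (-1)^(i-1) a₁ ⋯ (a_i a_{i+1}) ⋯ aₙ`.  Equivalently, it vanishes on tensors of length at
most one, and sends `a b t` to `(ab) t - a d(b t)`. -/
def barD : BarSpace 𝓡 →ₗ[k] BarSpace 𝓡 :=
  LinearMap.snd k _ _ ∘ₗ LinearMap.snd k _ _ ∘ₗ
    (LinearMap.applyₗ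
      ((1, 0, 0) : BarSpace 𝓡 × (augPart 𝓡 ⊗[k] BarSpace 𝓡) × BarSpace 𝓡)) ∘ₗ
      (TensorAlgebra.lift k (barAux 𝓡)).toLinearMap

theorem barD_aux (t : BarSpace 𝓡) :
    TensorAlgebra.lift k (barAux 𝓡) t (1, 0, 0) = (t, headSplit t, barD 𝓡 t) := by
  have h : ∀ (t : BarSpace 𝓡) (p : BarSpace 𝓡 × (augPart 𝓡 ⊗[k] BarSpace 𝓡) × BarSpace 𝓡)
      (q : BarSpace 𝓡 × (augPart 𝓡 ⊗[k] BarSpace 𝓡)), p.1 = q.1 → p.2.1 = q.2 →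
      (TensorAlgebra.lift k (barAux 𝓡) t p).1 = (TensorAlgebra.lift k headSplitAux t q).1 ∧
      (TensorAlgebra.lift k (barAux 𝓡) t p).2.1 = (TensorAlgebra.lift k headSplitAux t q).2 := by
    intro t
    induction t using TensorAlgebra.induction with
    | algebraMap r => intro p q h1 h2; simp [h1, h2, Module.algebraMap_end_apply]
    | ι x => intro p q h1 h2; simp [barAux, headSplitAux, h1]
    | mul a b ha hb =>
      intro p q h1 h2
      simp only [map_mul, Module.End.mul_apply]
      exact ha _ _ (hb p q h1 h2).1 (hb p q h1 h2).2
    | add a b ha hb =>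
      intro p q h1 h2
      simp [ha p q h1 h2, hb p q h1 h2]
  obtain ⟨h1, h2⟩ := h t (1, 0, 0) (1, 0) rfl rfl
  refine Prod.ext (h1.trans (headSplit_fst t)) (Prod.ext (h2.trans rfl) rfl)

@[simp] theorem barD_one : barD 𝓡 1 = 0 := by simp [barD]

@[simp] theorem barD_ι (a : augPart 𝓡) : barD 𝓡 (TensorAlgebra.ι k a) = 0 := by
  simp [barD, barAux]

theorem barD_ι_mul_ι_mul (a b : augPart 𝓡) (t : BarSpace 𝓡) :
    barD 𝓡 (TensorAlgebra.ι k a * (TensorAlgebra.ι k b * t)) =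
      TensorAlgebra.ι k (augMul 𝓡 a b) * t -
        TensorAlgebra.ι k a * barD 𝓡 (TensorAlgebra.ι k b * t) := by
  have h := barD_aux 𝓡 (TensorAlgebra.ι k b * t)
  have h' := barD_aux 𝓡 (TensorAlgebra.ι k a * (TensorAlgebra.ι k b * t))
  rw [map_mul, Module.End.mul_apply, h] at h'
  have h3 := congrArg (fun p => p.2.2) h'
  refine h3.symm.trans ?_
  simp [barAux, barMulHead]

/-- The bidegrees on `R_+`, seen as the space of generators of `T(R_+)`: homological degree `1`, and
the internal degree is the degree in `R`. -/
def augBideg (p : ℕ × ℕ) : Submodule k (augPart 𝓡) :=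
  if p.1 = 1 then (𝓡 p.2).comap (augPart 𝓡).subtype else ⊥

/-- The part of `T(R_+)` of bidegree `(n, j)`: tensors of length `n` and internal degree `j`. -/
def barPiece (n j : ℕ) : Submodule k (BarSpace 𝓡) := tensorPiece (augBideg 𝓡) (n, j)

/-- `Tor^R_{n,j}(k, k)`, where `n` is the homological and `j` the internal degree. -/
abbrev TorBideg (n j : ℕ) : Type _ := HomologyAt (barD 𝓡) (barPiece 𝓡 n j)

/-- The functionals on `T(R_+)` of bidegree `(n, j)`, i.e. those that vanish on all other
bidegrees. -/
def cobarPiece (n j : ℕ) : Submodule k (Module.Dual k (BarSpace 𝓡)) :=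
  ⨅ p : {p : ℕ × ℕ // p ≠ (n, j)}, (barPiece 𝓡 p.1.1 p.1.2).dualAnnihilator

/-- `Ext_R^{n,j}(k, k)`, the cohomology of the dual of the bar construction. -/
abbrev ExtBideg (n j : ℕ) : Type _ := HomologyAt (barD 𝓡).dualMap (cobarPiece 𝓡 n j)

/-- The degree `n` part of the Koszul dual `R^! = ⨁_n Ext_R^{n,n}(k, k)`. -/
abbrev KoszulDual (n : ℕ) : Type _ := ExtBideg 𝓡 n n

/-- The Hilbert series `H_{R^!}(z) = ∑_n |R^!_n| z^n`. -/
def koszulDualHilbert : PowerSeries ℤ :=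
  PowerSeries.mk fun n => (Module.finrank k (KoszulDual 𝓡 n) : ℤ)

/-- The Poincaré series `P_R(x, y) = ∑ |Tor^R_{n,j}(k, k)| x^n y^j`, where `x`, `y` are the variables
number `0` and `1`. -/
def poincareSeries : MvPowerSeries (Fin 2) ℤ :=
  fun m => (Module.finrank k (TorBideg 𝓡 (m 0) (m 1)) : ℤ)

end Bar

/-! ## The generalized Koszul complex -/

section Koszul

variable {k R : Type*} [Field k] [Ring R] [Algebra k R] (𝓡 : ℕ → Submodule k R)

/-- `R_1 = R_1^{⊗ 1}` inside the tensor algebra `T(R_1)`. -/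
abbrev tensorGen : Submodule k (TensorAlgebra k (𝓡 1)) := LinearMap.range (TensorAlgebra.ι k)

/-- The kernel of the multiplication `φ : R_1 ⊗ R_1 → R_2`, as a subspace of
`R_1 ⊗ R_1 = T(R_1)_2`. -/
def quadRel : Submodule k (TensorAlgebra k (𝓡 1)) :=
  tensorGen 𝓡 ^ 2 ⊓ LinearMap.ker (TensorAlgebra.lift k (𝓡 1).subtype).toLinearMap

/-- `K_n`, the dual of `R^!` in degree `n`, as a subspace of `R_1^{⊗ n} = T(R_1)_n`: `K_0 = k`,
`K_1 = R_1`, and `K_n = ⋂_{i = 0}^{n - 2} R_1^{⊗ i} ⊗ ker φ ⊗ R_1^{⊗ (n - i - 2)}` for `n ≥ 2`. -/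
def koszulK : ℕ → Submodule k (TensorAlgebra k (𝓡 1))
  | 0 => 1
  | 1 => tensorGen 𝓡
  | n + 2 => ⨅ i : Fin (n + 1),
      tensorGen 𝓡 ^ (i : ℕ) * quadRel 𝓡 * tensorGen 𝓡 ^ (n - (i : ℕ))

/-- `K = (R^!)^* = ⨁_n K_n`. -/
def koszulTotal : Submodule k (TensorAlgebra k (𝓡 1)) := ⨆ n, koszulK 𝓡 n

theorem headSplit_tensorGen_mul (S : Submodule k (TensorAlgebra k (𝓡 1)))
    (x : TensorAlgebra k (𝓡 1)) (hx : x ∈ tensorGen 𝓡 * S) :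
    headSplit x ∈ LinearMap.range (LinearMap.lTensor (𝓡 1) S.subtype) := by
  induction hx using Submodule.mul_induction_on' with
  | mem_mul_mem m hm n hn =>
    obtain ⟨v, rfl⟩ := hm
    exact ⟨v ⊗ₜ ⟨n, hn⟩, by simp⟩
  | add a _ b _ ha hb => rw [map_add]; exact add_mem ha hb

theorem headSplit_koszulK (n : ℕ) (x : TensorAlgebra k (𝓡 1)) (hx : x ∈ koszulK 𝓡 (n + 1)) :
    headSplit x ∈ LinearMap.range (LinearMap.lTensor (𝓡 1) (koszulK 𝓡 n).subtype) := by
  match n with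
  | 0 => exact headSplit_tensorGen_mul 𝓡 _ x (by simpa [koszulK] using hx)
  | 1 =>
    refine headSplit_tensorGen_mul 𝓡 _ x ?_
    have h : x ∈ quadRel 𝓡 := by simpa [koszulK] using hx
    simpa [koszulK, pow_two] using h.1
  | n + 2 =>
    refine mem_range_lTensor_iInf _ _ fun i => headSplit_tensorGen_mul 𝓡 _ x ?_
    have h := (Submodule.mem_iInf _).1 hx i.succ
    simpa [pow_succ', mul_assoc] using h

theorem koszulK_le (n : ℕ) : koszulK 𝓡 n ≤ koszulTotal 𝓡 := le_iSup (koszulK 𝓡) n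

theorem headSplit_koszulTotal (x : TensorAlgebra k (𝓡 1)) (hx : x ∈ koszulTotal 𝓡) :
    headSplit x ∈ LinearMap.range (LinearMap.lTensor (𝓡 1) (koszulTotal 𝓡).subtype) := by
  have hle : koszulTotal 𝓡 ≤
      (LinearMap.range (LinearMap.lTensor (𝓡 1) (koszulTotal 𝓡).subtype)).comap headSplit := by
    refine iSup_le fun n => ?_
    intro y hy
    rw [Submodule.mem_comap]
    match n with
    | 0 =>
      obtain ⟨c, rfl⟩ := Submodule.mem_one.1 hy
      rw [Algebra.algebraMap_eq_smul_one, map_smul, headSplit_one, smul_zero]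
      exact zero_mem _
    | n + 1 =>
      obtain ⟨z, hz⟩ := headSplit_koszulK 𝓡 n y hy
      refine ⟨LinearMap.lTensor (𝓡 1) (Submodule.inclusion (koszulK_le 𝓡 n)) z, ?_⟩
      rw [← hz, ← LinearMap.comp_apply, ← LinearMap.lTensor_comp]
      rfl
  exact hle hx

/-- The inclusion `K_{n+1} ⊆ R_1 ⊗ K_n`, as a map `K → R_1 ⊗ K` (zero on `K_0`). -/
def koszulSplit : koszulTotal 𝓡 →ₗ[k] (𝓡 1) ⊗[k] koszulTotal 𝓡 :=
  (LinearEquiv.ofInjective (LinearMap.lTensor (𝓡 1) (koszulTotal 𝓡).subtype)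
      (Module.Flat.lTensor_preserves_injective_linearMap _
        (koszulTotal 𝓡).injective_subtype)).symm.toLinearMap ∘ₗ
    (headSplit.restrict (headSplit_koszulTotal 𝓡))

theorem koszulSplit_spec (x : koszulTotal 𝓡) :
    LinearMap.lTensor (𝓡 1) (koszulTotal 𝓡).subtype (koszulSplit 𝓡 x) = headSplit x.1 := by
  simp [koszulSplit, ← LinearEquiv.ofInjective_apply (LinearMap.lTensor (𝓡 1)
    (koszulTotal 𝓡).subtype) (h := Module.Flat.lTensor_preserves_injective_linearMap _
        (koszulTotal 𝓡).injective_subtype)]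

/-- The generalized Koszul complex `GK_R = R ⊗ (R^!)^*`, as a left `R`-module. -/
abbrev GKoszul : Type _ := R ⊗[k] koszulTotal 𝓡

/-- The differential of `GK_R`, the restriction of
`r ⊗ (v₁ ⊗ ⋯ ⊗ vₙ) ↦ r v₁ ⊗ (v₂ ⊗ ⋯ ⊗ vₙ)` (and zero in homological degree zero). -/
def gkD : GKoszul 𝓡 →ₗ[R] GKoszul 𝓡 :=
  TensorProduct.AlgebraTensorModule.lift
    (LinearMap.toSpanSingleton R (koszulTotal 𝓡 →ₗ[k] GKoszul 𝓡)
      (LinearMap.rTensor (koszulTotal 𝓡) (𝓡 1).subtype ∘ₗ koszulSplit 𝓡))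

/-- `R_i ⊗ K_n ⊆ GK_R`: homological degree `n` and internal degree `i + n`. -/
def gkPiece (i n : ℕ) : Submodule k (GKoszul 𝓡) :=
  Submodule.map₂ (TensorProduct.mk k R (koszulTotal 𝓡)) (𝓡 i)
    ((koszulK 𝓡 n).comap (koszulTotal 𝓡).subtype)

/-- The part of `GK_R` of bidegree `p` (homological degree, internal degree). -/
def gkBideg (p : ℕ × ℕ) : Submodule k (GKoszul 𝓡) :=
  ⨆ (i : ℕ) (_ : i + p.1 = p.2), gkPiece 𝓡 i p.1

/-- `(GK_R)_+`, the part of positive homological degree. -/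
def gkPos : Submodule k (GKoszul 𝓡) := ⨆ (i : ℕ) (n : ℕ), gkPiece 𝓡 i (n + 1)

/-- The cycles of positive homological degree. -/
abbrev gkCycles : Submodule k (GKoszul 𝓡) := LinearMap.ker ((gkD 𝓡).restrictScalars k) ⊓ gkPos 𝓡

/-- `C = s H_+(GK_R)`; the shift `s` is taken into account in the bigrading `koszulCPiece`. -/
abbrev KoszulC : Type _ := HomologyAt ((gkD 𝓡).restrictScalars k) (gkPos 𝓡)

/-- The class in `C` of a cycle of positive homological degree. -/
abbrev koszulCMk : gkCycles 𝓡 →ₗ[k] KoszulC 𝓡 := Submodule.mkQ _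

/-- The bigrading of `C`: `C_{0,j} = 0` and `C_{n+1,j} = H_{n,j}(GK_R)` for `n > 0`
(`C_{1,j} = 0`, since there is no non-zero cycle of degree `0` in `(GK_R)_+`). -/
def koszulCPiece : ℕ × ℕ → Submodule k (KoszulC 𝓡)
  | (0, _) => ⊥
  | (n + 1, j) => ((gkBideg 𝓡 (n, j)).comap (gkCycles 𝓡).subtype).map (koszulCMk 𝓡)

/-- `α : C → (GK_R)_+` is given by sections `α_n : C_n → R_2 ⊗ K_{n-1}`: it sends every class to
a cycle representing it, and `C_n` is sent to `R_2 ⊗ K_{n-1}`. -/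
structure IsKoszulSection (α : KoszulC 𝓡 →ₗ[k] gkCycles 𝓡) : Prop where
  mk_apply : ∀ c, koszulCMk 𝓡 (α c) = c
  mem : ∀ n j, ∀ c ∈ koszulCPiece 𝓡 (n + 1, j), (α c : GKoszul 𝓡) ∈ gkPiece 𝓡 2 n

/-- `Y = GK_R ⊗ T(C)`, as a left `R`-module. -/
abbrev KoszulY : Type _ := GKoszul 𝓡 ⊗[k] TensorAlgebra k (KoszulC 𝓡)

/-- The bigrading of `Y = GK_R ⊗ T(C)`. -/
def koszulYPiece (n j : ℕ) : Submodule k (KoszulY 𝓡) :=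
  ⨆ (p : ℕ × ℕ) (q : ℕ × ℕ) (_ : p + q = (n, j)),
    Submodule.map₂ (TensorProduct.mk k (GKoszul 𝓡) (TensorAlgebra k (KoszulC 𝓡)))
      (gkBideg 𝓡 p) (tensorPiece (koszulCPiece 𝓡) q)

/-- The second part of the differential of `Y`: it sends `r ⊗ (c ⊗ z)` with `r ∈ R = (GK_R)_0`, `c ∈ C`
and `z ∈ T(C)` to `r α(c) ⊗ z`, and it vanishes on `(GK_R)_+ ⊗ T(C)` and on `R ⊗ 1`. -/
def koszulTwist (α : KoszulC 𝓡 →ₗ[k] gkCycles 𝓡) : KoszulY 𝓡 →ₗ[R] KoszulY 𝓡 :=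
  TensorProduct.AlgebraTensorModule.lift (TensorProduct.AlgebraTensorModule.lift
    (LinearMap.toSpanSingleton R
      (koszulTotal 𝓡 →ₗ[k] TensorAlgebra k (KoszulC 𝓡) →ₗ[k] KoszulY 𝓡)
      (LinearMap.smulRight
        (TensorAlgebra.algebraMapInv.toLinearMap ∘ₗ (koszulTotal 𝓡).subtype)
        (LinearMap.rTensor (TensorAlgebra k (KoszulC 𝓡)) ((gkCycles 𝓡).subtype ∘ₗ α) ∘ₗ
          headSplit))))

/-- The differential of `Y = GK_R ⊗ T(C)` defined by `α`. -/
def koszulYD (α : KoszulC 𝓡 →ₗ[k] gkCycles 𝓡) : KoszulY 𝓡 →ₗ[R] KoszulY 𝓡 :=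
  TensorProduct.AlgebraTensorModule.rTensor k (TensorAlgebra k (KoszulC 𝓡)) (gkD 𝓡) +
    koszulTwist 𝓡 α

end Koszul

/-!
The differential of `GK_R` removes the first letter of an element of `K_n ⊆ R_1^{⊗ n}` and
multiplies it into `R`. By definition `K_{n+1}` consists of the elements of `R_1 ⊗ K_n` that are
mapped to zero in `R_2 ⊗ K_{n-1}`. Since `R_i = 0` for `i ≥ 3`, the complex `GK_R` therefore splits
into the strands `0 → K_{n+1} → R_1 ⊗ K_n → R_2 ⊗ K_{n-1} → 0`, which in positive homological
degrees are exact except at the right end. So all homology in positive degrees is a quotient of the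
spaces `R_2 ⊗ K_n`, every element of which is a cycle, and it has sections `α` with values there
(`exists_isKoszulSection`).

The differential of `Y = GK_R ⊗ T(C)` is that of `GK_R` on the first factor, plus a term that lets
the generators `1 ⊗ c ⊗ t` bound the classes of `α(c) ⊗ t`. Because `C` is exactly the homology of
`GK_R` in positive degrees, shifted by one, only the class of `1` survives
(`exists_of_twistD_eq_zero`). The values of `α` lie in `R_2 ⊗ K`, so the resulting resolution is
minimal (`IsKoszulSection.isMinimalFreeResolution`). The proofs use of `α` only the properties
collected in `IsKoszulLift`.

By minimality `Tor` has the dimensions of `k ⊗_R Y = K ⊗ T(C)`. As `Tor` is computed by the bar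
construction `T(R_+)`, this needs a comparison. There is an explicit chain map `κ ⊗ t ↦ κ γ(t)`
from `K ⊗ T(C)`, with zero differential, to `T(R_+)` (`koszulToBar`): here `γ` is multiplicative,
and `γ(c)` is obtained from `α(c) ∈ R_2 ⊗ K_n` by reading the factor in `R_2` as one letter and an
element of `K_n` as a word in letters from `R_1`. All these elements are cycles, as products of
`R_1` or `R_2` with `R_2` vanish and the differential of the bar construction kills `K_n`. After
tensoring with `R` this becomes a chain map from `Y` to the bar resolution, whose mapping cone is
an exact complex of free modules. Such a complex remains exact modulo `R_+`: an element that is a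
cycle modulo `R_+` can be corrected in `R_1 ⊗ V` and then in `R_2 ⊗ V` to a true cycle, and no
further obstruction arises because `R_3 = 0` (`IsFreeComplex.exact`, `exists_of_comparison`). Hence
the elements `κ γ(t)` represent the homology of the bar construction
(`eq_zero_and_exists_of_barD_eq`). `Ext` is the graded dual of `Tor`
(`finrank_homologyAt_dualMap`), and in the bidegrees `(n, n)` only `K_n` contributes to `K ⊗ T(C)`,
so that `|R^!_n| = |K_n|`.

What remains is counting. Write `c(z) = ∑ |C_{n,n+1}| z^n`. Since `C_{n,j} = 0` unless `j = n + 1`,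
the series of `C` is `y c(xy)`, and the words in a basis of `C` give `P_R (1 - y c(xy)) =
H_{R^!}(xy)` (`fiberSeries_wordDeg`, `IsKoszulLift.poincareSeries_mul`). The Euler characteristics
of the strands of `GK_R` give `H_{R^!}(z) (1 - |R_1| z + |R_2| z^2) = 1 + z c(z)`
(`IsKoszulLift.koszulDualHilbert_mul`). Eliminating `c` yields the formula. The denominator does
not vanish, since its product with `P_R` is `x H_{R^!}(xy)`, which is not zero.
-/


/-! ### Gradings given by homogeneous bases -/

section HomogeneousBasis

variable {k : Type*} [Field k] {M : Type*} [AddCommGroup M] [Module k M]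
  {N : Type*} [AddCommGroup N] [Module k N]

/-- The basis `b` of `M`, with degrees `deg`, is adapted to the family of subspaces `𝒜`: the part
`𝒜 g` is spanned by the basis vectors of degree `g`.  In particular `M = ⨁ 𝒜 g`. -/
structure IsHomogeneousBasis {ι G : Type*} (b : Module.Basis ι k M) (deg : ι → G)
    (𝒜 : G → Submodule k M) : Prop where
  eq_span : ∀ g, 𝒜 g = Submodule.span k (b '' {i | deg i = g})

theorem DirectSum.IsInternal.exists_isHomogeneousBasis.{u, v} {G : Type u} [DecidableEq G]
    {M : Type v} [AddCommGroup M] [Module k M] {𝒜 : G → Submodule k M}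
    (h : DirectSum.IsInternal 𝒜) :
    ∃ (ι : Type (max u v)) (b : Module.Basis ι k M) (deg : ι → G), IsHomogeneousBasis b deg 𝒜 := by
  refine ⟨_, h.collectedBasis fun g => Module.Basis.ofVectorSpace k (𝒜 g), Sigma.fst, ⟨fun g => ?_⟩⟩
  have h1 : (𝒜 g) = (⊤ : Submodule k (𝒜 g)).map (𝒜 g).subtype := by simp
  conv_lhs => rw [h1, ← (Module.Basis.ofVectorSpace k (𝒜 g)).span_eq, Submodule.map_span]
  congr 1
  ext x
  constructor
  · rintro ⟨_, ⟨i, rfl⟩, rfl⟩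
    exact ⟨⟨g, i⟩, rfl, by simp [DirectSum.IsInternal.collectedBasis_coe]⟩
  · rintro ⟨⟨g', i⟩, hg, rfl⟩
    obtain rfl : g' = g := hg
    exact ⟨_, ⟨i, rfl⟩, by simp [DirectSum.IsInternal.collectedBasis_coe]⟩

namespace IsHomogeneousBasis

variable {ι G : Type*} {b : Module.Basis ι k M} {deg : ι → G} {𝒜 : G → Submodule k M}

theorem mem (h : IsHomogeneousBasis b deg 𝒜) (i : ι) : b i ∈ 𝒜 (deg i) := by
  rw [h.eq_span]
  exact Submodule.subset_span ⟨i, rfl, rfl⟩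

theorem iSup_eq_top (h : IsHomogeneousBasis b deg 𝒜) : ⨆ g, 𝒜 g = ⊤ := by
  rw [eq_top_iff, ← b.span_eq, Submodule.span_le]
  rintro _ ⟨i, rfl⟩
  exact Submodule.mem_iSup_of_mem (deg i) (h.mem i)

theorem isInternal [DecidableEq G] (h : IsHomogeneousBasis b deg 𝒜) : DirectSum.IsInternal 𝒜 := by
  rw [DirectSum.isInternal_submodule_iff_iSupIndep_and_iSup_eq_top]
  refine ⟨fun g => ?_, h.iSup_eq_top⟩
  refine Disjoint.mono_right (c := Submodule.span k (b '' {i | deg i ≠ g})) ?_ ?_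
  · refine iSup₂_le fun g' hg => ?_
    rw [h.eq_span]
    refine Submodule.span_mono (Set.image_mono fun i (hi : deg i = g') => ?_)
    exact fun h' => hg (hi.symm.trans h')
  · rw [h.eq_span]
    refine b.linearIndependent.disjoint_span_image ?_
    rw [Set.disjoint_left]
    exact fun i hi hi' => hi' hi

theorem finrank_eq (h : IsHomogeneousBasis b deg 𝒜) (g : G) :
    Module.finrank k (𝒜 g) = Nat.card {i // deg i = g} := by
  have hli : LinearIndependent k fun i : {i // deg i = g} => b i :=
    b.linearIndependent.comp _ Subtype.val_injective
  rw [h.eq_span g]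
  have : b '' {i | deg i = g} = Set.range fun i : {i // deg i = g} => b i := by
    ext x; simp
  rw [this]
  exact Module.finrank_eq_nat_card_basis (Module.Basis.span hli)

theorem finite_fiber (h : IsHomogeneousBasis b deg 𝒜) (g : G) [Module.Finite k (𝒜 g)] :
    {i | deg i = g}.Finite := by
  have hli : LinearIndependent k fun i : {i // deg i = g} =>
      (⟨b i, by have := h.mem (i : ι); rwa [i.2] at this⟩ : 𝒜 g) := by
    refine LinearIndependent.of_comp (𝒜 g).subtype ?_
    exact b.linearIndependent.comp _ Subtype.val_injective
  exact Set.finite_coe_iff.1 hli.finite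

/-- Coarsening a grading along a map of the index sets. -/
theorem coarsen {L : Type*} (h : IsHomogeneousBasis b deg 𝒜) (φ : G → L) :
    IsHomogeneousBasis b (φ ∘ deg) fun l => ⨆ (g : G) (_ : φ g = l), 𝒜 g := by
  refine ⟨fun l => le_antisymm (iSup₂_le fun g hg => ?_) (Submodule.span_le.2 ?_)⟩
  · rw [h.eq_span]
    refine Submodule.span_mono (Set.image_mono fun i (hi : deg i = g) => ?_)
    simp [hi, hg]
  · rintro _ ⟨i, hi, rfl⟩
    exact Submodule.mem_iSup_of_mem (deg i) (Submodule.mem_iSup_of_mem hi (h.mem i))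

theorem congr {𝒜' : G → Submodule k M} (h : IsHomogeneousBasis b deg 𝒜) (h' : ∀ g, 𝒜' g = 𝒜 g) :
    IsHomogeneousBasis b deg 𝒜' :=
  ⟨fun g => (h' g).trans (h.eq_span g)⟩

theorem tensorProduct {κ H : Type*} {c : Module.Basis κ k N} {deg' : κ → H}
    {ℬ : H → Submodule k N} (h : IsHomogeneousBasis b deg 𝒜) (h' : IsHomogeneousBasis c deg' ℬ) :
    IsHomogeneousBasis (b.tensorProduct c) (Prod.map deg deg') fun p : G × H =>
      Submodule.map₂ (TensorProduct.mk k M N) (𝒜 p.1) (ℬ p.2) := by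
  refine ⟨fun p => ?_⟩
  rw [h.eq_span, h'.eq_span, Submodule.map₂_span_span]
  congr 1
  ext x
  constructor
  · rintro ⟨_, ⟨i, hi, rfl⟩, _, ⟨j, hj, rfl⟩, rfl⟩
    exact ⟨(i, j), Prod.ext hi hj, by simp⟩
  · rintro ⟨⟨i, j⟩, hij, rfl⟩
    exact ⟨_, ⟨i, congrArg Prod.fst hij, rfl⟩, _, ⟨j, congrArg Prod.snd hij, rfl⟩, by simp⟩

theorem prod {κ : Type*} {c : Module.Basis κ k N} {deg' : κ → G}
    {ℬ : G → Submodule k N} (h : IsHomogeneousBasis b deg 𝒜) (h' : IsHomogeneousBasis c deg' ℬ) :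
    IsHomogeneousBasis (b.prod c) (Sum.elim deg deg') fun g => (𝒜 g).prod (ℬ g) := by
  refine ⟨fun g => le_antisymm ?_ (Submodule.span_le.2 ?_)⟩
  · rintro ⟨x, y⟩ ⟨hx, hy⟩
    have hx' : (x, (0 : N)) ∈ Submodule.span k (b.prod c '' {i | Sum.elim deg deg' i = g}) := by
      have := Submodule.mem_map_of_mem (f := LinearMap.inl k M N) (h.eq_span g ▸ hx)
      rw [Submodule.map_span] at this
      refine Submodule.span_mono ?_ this
      rintro _ ⟨_, ⟨i, hi, rfl⟩, rfl⟩
      exact ⟨Sum.inl i, hi, by ext <;> simp⟩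
    have hy' : ((0 : M), y) ∈ Submodule.span k (b.prod c '' {i | Sum.elim deg deg' i = g}) := by
      have := Submodule.mem_map_of_mem (f := LinearMap.inr k M N) (h'.eq_span g ▸ hy)
      rw [Submodule.map_span] at this
      refine Submodule.span_mono ?_ this
      rintro _ ⟨_, ⟨i, hi, rfl⟩, rfl⟩
      exact ⟨Sum.inr i, hi, by ext <;> simp⟩
    simpa using add_mem hx' hy'
  · rintro _ ⟨i | i, hi, rfl⟩
    · obtain rfl : deg i = g := hi
      exact ⟨by simpa using h.mem i, by simp⟩
    · obtain rfl : deg' i = g := hi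
      exact ⟨by simp, by simpa using h'.mem i⟩

end IsHomogeneousBasis

/-! ### Tensor algebras of graded vector spaces -/

section TensorPiece

variable {𝒞 : ℕ × ℕ → Submodule k M}

theorem one_mem_tensorPiece : (1 : TensorAlgebra k M) ∈ tensorPiece 𝒞 0 :=
  Submodule.subset_span ⟨[], by simp, by simp, by simp⟩

theorem ι_mul_mem_tensorPiece {p q : ℕ × ℕ} {c : M} (hc : c ∈ 𝒞 p) {t : TensorAlgebra k M}
    (ht : t ∈ tensorPiece 𝒞 q) : TensorAlgebra.ι k c * t ∈ tensorPiece 𝒞 (p + q) := by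
  induction ht using Submodule.span_induction with
  | mem t ht =>
    obtain ⟨l, hl, hs, rfl⟩ := ht
    exact Submodule.subset_span ⟨(c, p) :: l, by
      rintro x (_ | ⟨_, hx⟩)
      exacts [hc, hl x hx], by simp [hs], by simp⟩
  | zero => simp
  | add x y _ _ hx hy => rw [mul_add]; exact add_mem hx hy
  | smul a x _ hx => rw [mul_smul_comm]; exact Submodule.smul_mem _ _ hx

/-- To prove a property of all elements of bidegree `p`, it is enough to treat `1` and the products
`c · t` of homogeneous elements. -/
theorem tensorPiece_induction {P : ℕ × ℕ → TensorAlgebra k M → Prop}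
    (one : P 0 1)
    (mul : ∀ p q c t, c ∈ 𝒞 p → t ∈ tensorPiece 𝒞 q → P q t → P (p + q) (TensorAlgebra.ι k c * t))
    (zero : ∀ p, P p 0) (add : ∀ p t t', P p t → P p t' → P p (t + t'))
    (smul : ∀ p (a : k) t, P p t → P p (a • t)) {p : ℕ × ℕ} {t : TensorAlgebra k M}
    (ht : t ∈ tensorPiece 𝒞 p) : P p t := by
  induction ht using Submodule.span_induction with
  | mem t ht =>
    obtain ⟨l, hl, hs, rfl⟩ := ht
    induction l generalizing p with
    | nil => simp only [List.map_nil, List.sum_nil] at hs; subst hs; simpa using one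
    | cons x l ih =>
      simp only [List.map_cons, List.sum_cons] at hs
      subst hs
      simp only [List.map_cons, List.prod_cons]
      exact mul _ _ _ _ (hl x (by simp))
        (Submodule.subset_span ⟨l, fun y hy => hl y (by simp [hy]), rfl, rfl⟩)
        (ih (fun y hy => hl y (by simp [hy])) rfl)
  | zero => exact zero _
  | add x y _ _ hx hy => exact add _ _ _ hx hy
  | smul a x _ hx => exact smul _ _ _ hx

theorem mul_mem_tensorPiece {p q : ℕ × ℕ} {s t : TensorAlgebra k M} (hs : s ∈ tensorPiece 𝒞 p)
    (ht : t ∈ tensorPiece 𝒞 q) : s * t ∈ tensorPiece 𝒞 (p + q) := by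
  refine tensorPiece_induction (P := fun p s => s * t ∈ tensorPiece 𝒞 (p + q)) ?_ ?_ ?_ ?_ ?_ hs
  · simpa using ht
  · intro p' q' c s hc _ h
    rw [mul_assoc, add_assoc]
    exact ι_mul_mem_tensorPiece hc h
  · simp
  · intro p s s' h h'
    rw [add_mul]; exact add_mem h h'
  · intro p a s h
    rw [smul_mul_assoc]; exact Submodule.smul_mem _ _ h

/-- The sum of the degrees of the letters of a word. -/
def wordDeg {ι G : Type*} [AddMonoid G] (deg : ι → G) (w : FreeMonoid ι) : G :=
  (w.toList.map deg).sum

theorem tensorAlgebraBasis_cons {ι : Type*} (b : Module.Basis ι k M) (i : ι) (w : FreeMonoid ι) :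
    b.tensorAlgebra (FreeMonoid.of i * w) = TensorAlgebra.ι k (b i) * b.tensorAlgebra w := by
  simp only [Module.Basis.tensorAlgebra, Module.Basis.map_apply]
  have h : ∀ w, FreeAlgebra.basisFreeMonoid k ι w = FreeAlgebra.equivMonoidAlgebraFreeMonoid.symm
      (MonoidAlgebra.of k _ w) := fun w => rfl
  simp only [h, map_mul, AlgEquiv.toLinearEquiv_apply]
  congr 1
  rw [AlgEquiv.symm_apply_eq, TensorAlgebra.equivFreeAlgebra_ι_apply, AlgEquiv.symm_apply_eq]
  simp [FreeAlgebra.equivMonoidAlgebraFreeMonoid]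

theorem tensorAlgebraBasis_one {ι : Type*} (b : Module.Basis ι k M) :
    b.tensorAlgebra 1 = 1 := by
  simp only [Module.Basis.tensorAlgebra, Module.Basis.map_apply]
  have h : ∀ w, FreeAlgebra.basisFreeMonoid k ι w = FreeAlgebra.equivMonoidAlgebraFreeMonoid.symm
      (MonoidAlgebra.of k _ w) := fun w => rfl
  rw [h, map_one, map_one, AlgEquiv.toLinearEquiv_apply, map_one]

theorem IsHomogeneousBasis.tensorAlgebra {ι : Type*} {b : Module.Basis ι k M} {deg : ι → ℕ × ℕ}
    (h : IsHomogeneousBasis b deg 𝒞) :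
    IsHomogeneousBasis b.tensorAlgebra (wordDeg deg) (tensorPiece 𝒞) := by
  refine ⟨fun p => le_antisymm (fun t ht => ?_) (Submodule.span_le.2 ?_)⟩
  · refine tensorPiece_induction (P := fun p t => t ∈
      Submodule.span k (b.tensorAlgebra '' {i | wordDeg deg i = p})) ?_ ?_ ?_ ?_ ?_ ht
    · exact Submodule.subset_span ⟨1, rfl, tensorAlgebraBasis_one b⟩
    · intro p q c t hc _ ht
      rw [h.eq_span] at hc
      have := Submodule.apply_mem_map₂ (f := LinearMap.mul k (TensorAlgebra k M))
        (Submodule.mem_map_of_mem (f := TensorAlgebra.ι k) hc) ht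
      rw [Submodule.map_span, Submodule.map₂_span_span] at this
      refine Submodule.span_mono ?_ this
      rintro _ ⟨_, ⟨_, ⟨i, hi, rfl⟩, rfl⟩, _, ⟨w, hw, rfl⟩, rfl⟩
      refine ⟨FreeMonoid.of i * w, ?_, ?_⟩
      · have hi' : deg i = p := hi
        have hw' : (w.toList.map deg).sum = q := hw
        simp [wordDeg, hi', hw']
      · simp [tensorAlgebraBasis_cons]
    · intro p; exact zero_mem _
    · intro p t t' ht ht'; exact add_mem ht ht'
    · intro p a t ht; exact Submodule.smul_mem _ _ ht
  · rintro _ ⟨w, rfl, rfl⟩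
    induction w using FreeMonoid.inductionOn' with
    | one => rw [tensorAlgebraBasis_one]; exact one_mem_tensorPiece
    | of_mul i w ih =>
      rw [tensorAlgebraBasis_cons]
      have := ι_mul_mem_tensorPiece (h.mem i) ih
      simpa [wordDeg] using this

end TensorPiece

/-! ### Homogeneous components -/

section Component

variable {G : Type*} [DecidableEq G] {𝒜 : G → Submodule k M}

/-- The projection of `M = ⨁ 𝒜 g` onto the summand `𝒜 g`, as an endomorphism of `M`. -/
def DirectSum.IsInternal.comp (h : DirectSum.IsInternal 𝒜) (g : G) : M →ₗ[k] M :=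
  (𝒜 g).subtype ∘ₗ DirectSum.component k G (fun g => 𝒜 g) g ∘ₗ
    (LinearEquiv.ofBijective (DirectSum.coeLinearMap 𝒜) h).symm.toLinearMap

theorem DirectSum.IsInternal.comp_mem (h : DirectSum.IsInternal 𝒜) (g : G) (x : M) :
    h.comp g x ∈ 𝒜 g :=
  Subtype.prop _

theorem DirectSum.IsInternal.comp_of_mem_ite (h : DirectSum.IsInternal 𝒜) {g : G} (g' : G) {x : M}
    (hx : x ∈ 𝒜 g) : h.comp g' x = if g = g' then x else 0 := by
  have : (LinearEquiv.ofBijective (DirectSum.coeLinearMap 𝒜) h).symm x =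
      DirectSum.lof k G (fun g => 𝒜 g) g ⟨x, hx⟩ := by
    rw [LinearEquiv.symm_apply_eq]
    exact (DirectSum.coeLinearMap_lof 𝒜 g ⟨x, hx⟩).symm
  simp only [DirectSum.IsInternal.comp, LinearMap.comp_apply, LinearEquiv.coe_coe, this]
  split_ifs with hg
  · subst hg; simp [DirectSum.component.lof_self]
  · rw [DirectSum.component.of, dif_neg hg]; simp

theorem DirectSum.IsInternal.comp_of_mem (h : DirectSum.IsInternal 𝒜) {g : G} {x : M}
    (hx : x ∈ 𝒜 g) : h.comp g x = x := by
  rw [h.comp_of_mem_ite g hx, if_pos rfl]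

theorem DirectSum.IsInternal.comp_of_mem_ne (h : DirectSum.IsInternal 𝒜) {g g' : G} {x : M}
    (hx : x ∈ 𝒜 g) (hg : g ≠ g') : h.comp g' x = 0 := by
  rw [h.comp_of_mem_ite g' hx, if_neg hg]

/-- A property of the elements of `M = ⨁ 𝒜 g` that holds for homogeneous elements and is additive
holds in general. -/
theorem DirectSum.IsInternal.induction (h : DirectSum.IsInternal 𝒜) {P : M → Prop}
    (mem : ∀ g, ∀ x ∈ 𝒜 g, P x) (zero : P 0) (add : ∀ x y, P x → P y → P (x + y)) (x : M) :
    P x := by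
  have hx : x ∈ ⨆ g, 𝒜 g := by rw [h.submodule_iSup_eq_top]; trivial
  induction hx using Submodule.iSup_induction' with
  | mem g x hx => exact mem g x hx
  | zero => exact zero
  | add x y _ _ hx hy => exact add _ _ hx hy

theorem DirectSum.IsInternal.finite_support (h : DirectSum.IsInternal 𝒜) (x : M) :
    ∃ s : Finset G, (∀ g ∉ s, h.comp g x = 0) ∧ ∑ g ∈ s, h.comp g x = x := by
  classical
  suffices H : ∃ s : Finset G, ∀ s' : Finset G, s ⊆ s' →
      (∀ g ∉ s', h.comp g x = 0) ∧ ∑ g ∈ s', h.comp g x = x by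
    obtain ⟨s, hs⟩ := H
    exact ⟨s, hs s subset_rfl⟩
  refine h.induction (P := fun x => ∃ s : Finset G, ∀ s' : Finset G, s ⊆ s' →
      (∀ g ∉ s', h.comp g x = 0) ∧ ∑ g ∈ s', h.comp g x = x) ?_ ?_ ?_ x
  · intro g x hx
    refine ⟨{g}, fun s' hs => ⟨fun g' hg' => ?_, ?_⟩⟩
    · refine h.comp_of_mem_ne hx ?_
      rintro rfl; exact hg' (hs (by simp))
    · rw [Finset.sum_congr rfl fun g' _ => h.comp_of_mem_ite g' hx, Finset.sum_ite_eq,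
        if_pos (hs (by simp))]
  · exact ⟨∅, by simp⟩
  · rintro x y ⟨s, hs⟩ ⟨t, ht⟩
    refine ⟨s ∪ t, fun s' hs' => ?_⟩
    obtain ⟨h1, h2⟩ := hs s' (Finset.union_subset_left hs')
    obtain ⟨h3, h4⟩ := ht s' (Finset.union_subset_right hs')
    refine ⟨fun g hg => by rw [map_add, h1 g hg, h3 g hg, add_zero], ?_⟩
    simp only [map_add, Finset.sum_add_distrib, h2, h4]

theorem DirectSum.IsInternal.mem_of_comp_mem (h : DirectSum.IsInternal 𝒜) {S : Submodule k M}
    {x : M} (hx : ∀ g, h.comp g x ∈ S) : x ∈ S := by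
  obtain ⟨s, -, hs⟩ := h.finite_support x
  rw [← hs]
  exact sum_mem fun g _ => hx g

/-- If `f` maps the part `𝒜 g` to `ℬ g'` and the other parts to elements without component in
`ℬ g'`, then `f` commutes with taking these components. -/
theorem DirectSum.IsInternal.comp_map (h : DirectSum.IsInternal 𝒜) {H : Type*} [DecidableEq H]
    {ℬ : H → Submodule k N} (h' : DirectSum.IsInternal ℬ) (f : M →ₗ[k] N) {g : G} {g' : H}
    (hf : ∀ x ∈ 𝒜 g, f x ∈ ℬ g') (hf' : ∀ i ≠ g, ∀ x ∈ 𝒜 i, h'.comp g' (f x) = 0) (x : M) :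
    h'.comp g' (f x) = f (h.comp g x) := by
  refine h.induction (P := fun x => h'.comp g' (f x) = f (h.comp g x)) ?_ (by simp) ?_ x
  · intro i x hx
    by_cases hi : i = g
    · subst hi
      rw [h.comp_of_mem hx, h'.comp_of_mem (hf x hx)]
    · rw [hf' i hi x hx, h.comp_of_mem_ne hx hi, map_zero]
  · intro x y hx hy
    simp [hx, hy]

end Component

/-! ### Homogeneous subspaces and quotients -/

section Subquotient

variable {G : Type*} [DecidableEq G] {𝒜 : G → Submodule k M}

theorem isInternal_of_iSupIndep_iSup {𝒜 : G → Submodule k M} (h1 : iSupIndep 𝒜)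
    (h2 : ⨆ g, 𝒜 g = ⊤) : DirectSum.IsInternal 𝒜 :=
  (DirectSum.isInternal_submodule_iff_iSupIndep_and_iSup_eq_top 𝒜).2 ⟨h1, h2⟩

/-- A subspace containing the homogeneous components of its elements is graded. -/
theorem DirectSum.IsInternal.comap_subtype (h : DirectSum.IsInternal 𝒜) (S : Submodule k M)
    (hS : ∀ g, ∀ x ∈ S, h.comp g x ∈ S) :
    DirectSum.IsInternal fun g => (𝒜 g).comap S.subtype := by
  refine isInternal_of_iSupIndep_iSup ?_ ?_
  · intro g
    rw [Submodule.disjoint_def]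
    intro x hx hx'
    refine Subtype.ext (Submodule.disjoint_def.1 (h.submodule_iSupIndep g) _ hx ?_)
    have h2 : (⨆ g', ⨆ (_ : g' ≠ g), (𝒜 g').comap S.subtype) ≤
        (⨆ g', ⨆ (_ : g' ≠ g), 𝒜 g').comap S.subtype := iSup₂_le fun g' hg' =>
      Submodule.comap_mono (le_iSup₂_of_le g' hg' le_rfl)
    exact h2 hx'
  · rw [eq_top_iff]
    rintro x -
    obtain ⟨s, -, hs⟩ := h.finite_support x.1
    have : x = ∑ g ∈ s, (⟨h.comp g x.1, hS g _ x.2⟩ : S) := by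
      ext; simp [hs]
    rw [this]
    exact sum_mem fun g _ => Submodule.mem_iSup_of_mem g (h.comp_mem g x.1)

/-- The quotient by a subspace containing the homogeneous components of its elements is graded. -/
theorem DirectSum.IsInternal.map_mkQ (h : DirectSum.IsInternal 𝒜) (S : Submodule k M)
    (hS : ∀ g, ∀ x ∈ S, h.comp g x ∈ S) :
    DirectSum.IsInternal fun g => (𝒜 g).map S.mkQ := by
  have hc : ∀ g, ∃ f : (M ⧸ S) →ₗ[k] M ⧸ S, ∀ x, f (S.mkQ x) = S.mkQ (h.comp g x) := fun g =>
    ⟨S.mapQ S (h.comp g) (hS g), fun x => by simp⟩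
  refine isInternal_of_iSupIndep_iSup ?_ ?_
  · intro g
    obtain ⟨f, hf⟩ := hc g
    rw [Submodule.disjoint_def]
    rintro _ ⟨x, hx, rfl⟩ hx'
    -- the component map is the identity on one side and zero on the other
    have h1 : f (S.mkQ x) = S.mkQ x := by rw [hf, h.comp_of_mem hx]
    have h2 : (⨆ g', ⨆ (_ : g' ≠ g), (𝒜 g').map S.mkQ) ≤ LinearMap.ker f := by
      refine iSup₂_le fun g' hg' => ?_
      rintro _ ⟨y, hy, rfl⟩
      rw [LinearMap.mem_ker, hf, h.comp_of_mem_ne hy hg', map_zero]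
    rw [← h1]
    exact h2 hx'
  · rw [← Submodule.map_iSup, h.submodule_iSup_eq_top, Submodule.map_top, Submodule.range_mkQ]

end Subquotient

end HomogeneousBasis

/-! ### The first letter of a tensor -/

/-- Flatness over a field: an element of `A ⊗ C` killed by `φ ⊗ C` comes from `ker φ ⊗ C`. -/
theorem exists_rTensor_ker_subtype_eq {k : Type*} [Field k] {A B C : Type*} [AddCommGroup A]
    [Module k A] [AddCommGroup B] [Module k B] [AddCommGroup C] [Module k C] (φ : A →ₗ[k] B)
    {z : A ⊗[k] C} (hz : LinearMap.rTensor C φ z = 0) :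
    ∃ y : LinearMap.ker φ ⊗[k] C, LinearMap.rTensor C (LinearMap.ker φ).subtype y = z := by
  have h : Function.Exact (LinearMap.ker φ).subtype φ := LinearMap.exact_subtype_ker_map φ
  exact (Module.Flat.rTensor_exact C h z).1 hz

section FirstLetter

variable {k : Type*} [Field k] {V : Type*} [AddCommGroup V] [Module k V]

theorem TensorAlgebra.left_induction {P : TensorAlgebra k V → Prop} (one : P 1)
    (mul : ∀ v t, P t → P (TensorAlgebra.ι k v * t)) (add : ∀ s t, P s → P t → P (s + t))
    (smul : ∀ (a : k) t, P t → P (a • t)) (t : TensorAlgebra k V) : P t := by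
  suffices h : ∀ s, P s → P (t * s) by simpa using h 1 one
  induction t using TensorAlgebra.induction with
  | algebraMap r => intro s hs; rw [← Algebra.smul_def]; exact smul r s hs
  | ι x => exact fun s => mul x s
  | mul a b ha hb => intro s hs; rw [mul_assoc]; exact ha _ (hb s hs)
  | add a b ha hb => intro s hs; rw [add_mul]; exact add _ _ (ha s hs) (hb s hs)

/-- The map `V ⊗ T(V) → T(V)`, `v ⊗ t ↦ v t`. -/
def headJoin : V ⊗[k] TensorAlgebra k V →ₗ[k] TensorAlgebra k V :=
  TensorProduct.lift (LinearMap.mul k (TensorAlgebra k V) ∘ₗ TensorAlgebra.ι k)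

@[simp] theorem headJoin_tmul (v : V) (t : TensorAlgebra k V) :
    headJoin (v ⊗ₜ[k] t) = TensorAlgebra.ι k v * t := by
  simp [headJoin]

@[simp] theorem headSplit_headJoin (w : V ⊗[k] TensorAlgebra k V) : headSplit (headJoin w) = w := by
  induction w using TensorProduct.induction_on with
  | zero => simp
  | tmul v t => simp
  | add x y hx hy => simp [hx, hy]

theorem headJoin_headSplit (t : TensorAlgebra k V) :
    headJoin (headSplit t) + algebraMap k _ (TensorAlgebra.algebraMapInv t) = t := by
  induction t using TensorAlgebra.left_induction with
  | one => simp
  | mul v t _ => simp [TensorAlgebra.algebraMapInv]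
  | add s t hs ht =>
    conv_rhs => rw [← hs, ← ht]
    simp only [map_add]; abel
  | smul a t ht =>
    conv_rhs => rw [← ht]
    simp only [map_smul, smul_add]
    simp [Algebra.smul_def]

theorem eq_algebraMap_of_headSplit_eq_zero {t : TensorAlgebra k V} (h : headSplit t = 0) :
    t = algebraMap k _ (TensorAlgebra.algebraMapInv t) := by
  conv_lhs => rw [← headJoin_headSplit t, h, map_zero, zero_add]

theorem algebraMapInv_tensorGen_mul {S : Submodule k (TensorAlgebra k V)} {t : TensorAlgebra k V}
    (ht : t ∈ LinearMap.range (TensorAlgebra.ι k) * S) : TensorAlgebra.algebraMapInv t = 0 := by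
  induction ht using Submodule.mul_induction_on' with
  | mem_mul_mem m hm n hn =>
    obtain ⟨v, rfl⟩ := hm
    simp [TensorAlgebra.algebraMapInv]
  | add a _ b _ ha hb => rw [map_add, ha, hb, add_zero]

variable {R : Type*} [Ring R] [Algebra k R]

/-- For a linear map `f : V → R`, the `R`-linear endomorphism `r ⊗ v t ↦ r f(v) ⊗ t` of
`R ⊗ T(V)`, vanishing on `R ⊗ 1`. -/
def headD (f : V →ₗ[k] R) : R ⊗[k] TensorAlgebra k V →ₗ[R] R ⊗[k] TensorAlgebra k V :=
  TensorProduct.AlgebraTensorModule.lift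
    (LinearMap.toSpanSingleton R (TensorAlgebra k V →ₗ[k] R ⊗[k] TensorAlgebra k V)
      (LinearMap.rTensor (TensorAlgebra k V) f ∘ₗ headSplit))

theorem headD_tmul (f : V →ₗ[k] R) (r : R) (t : TensorAlgebra k V) :
    headD f (r ⊗ₜ t) = r • LinearMap.rTensor (TensorAlgebra k V) f (headSplit t) := by
  simp [headD]

@[simp] theorem headD_tmul_one (f : V →ₗ[k] R) (r : R) : headD f (r ⊗ₜ 1) = 0 := by
  simp [headD_tmul]

@[simp] theorem headD_tmul_ι_mul (f : V →ₗ[k] R) (r : R) (v : V) (t : TensorAlgebra k V) :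
    headD f (r ⊗ₜ (TensorAlgebra.ι k v * t)) = (r * f v) ⊗ₜ t := by
  simp [headD_tmul, TensorProduct.smul_tmul']

/-- Applying `headD f` twice multiplies the first two letters. -/
theorem headD_headD_mul (f : V →ₗ[k] R) {q : TensorAlgebra k V}
    (hq : q ∈ LinearMap.range (TensorAlgebra.ι k (M := V)) ^ 2) (t : TensorAlgebra k V) :
    headD f (headD f (1 ⊗ₜ (q * t))) = TensorAlgebra.lift k f q ⊗ₜ t := by
  rw [pow_two] at hq
  induction hq using Submodule.mul_induction_on' with
  | mem_mul_mem m hm n hn =>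
    obtain ⟨v, rfl⟩ := hm
    obtain ⟨w, rfl⟩ := hn
    simp [mul_assoc]
  | add a _ b _ ha hb => simp only [add_mul, TensorProduct.tmul_add, map_add, ha, hb,
      TensorProduct.add_tmul]

end FirstLetter

/-! ### The spaces `K_n` -/

section KoszulSpaces

variable {k R : Type*} [Field k] [Ring R] [Algebra k R] (𝓡 : ℕ → Submodule k R)

theorem tensorGen_isInternal :
    DirectSum.IsInternal fun n : ℕ => tensorGen 𝓡 ^ n :=
  DirectSum.Decomposition.isInternal _

theorem quadRel_le : quadRel 𝓡 ≤ tensorGen 𝓡 ^ 2 := inf_le_left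

theorem koszulK_zero : koszulK 𝓡 0 = 1 := rfl

theorem koszulK_one : koszulK 𝓡 1 = tensorGen 𝓡 := rfl

theorem koszulK_le_quadRel_mul (n : ℕ) : koszulK 𝓡 (n + 2) ≤ quadRel 𝓡 * tensorGen 𝓡 ^ n :=
  (iInf_le _ 0).trans (by simp)

theorem koszulK_le_pow : ∀ n, koszulK 𝓡 n ≤ tensorGen 𝓡 ^ n
  | 0 => by simp [koszulK_zero]
  | 1 => by simp [koszulK_one]
  | n + 2 => by
    refine (koszulK_le_quadRel_mul 𝓡 n).trans ((mul_le_mul_left (quadRel_le 𝓡) _).trans ?_)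
    rw [← pow_add, add_comm]

theorem koszulK_succ_le (n : ℕ) : koszulK 𝓡 (n + 1) ≤ tensorGen 𝓡 * koszulK 𝓡 n := by
  intro x hx
  obtain ⟨z, hz⟩ := headSplit_koszulK 𝓡 n x hx
  have h0 : TensorAlgebra.algebraMapInv x = 0 :=
    algebraMapInv_tensorGen_mul (S := tensorGen 𝓡 ^ n)
      (by rw [← pow_succ']; exact koszulK_le_pow 𝓡 _ hx)
  have hx' := headJoin_headSplit x
  rw [h0, map_zero, add_zero, ← hz] at hx'
  rw [← hx']
  clear hz hx'
  induction z using TensorProduct.induction_on with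
  | zero => simp
  | tmul v t =>
    rw [LinearMap.lTensor_tmul, headJoin_tmul]
    exact Submodule.mul_mem_mul ⟨v, rfl⟩ t.2
  | add x y hx hy => rw [map_add, map_add]; exact add_mem hx hy

theorem mem_koszulK_add_two {n : ℕ} {x : TensorAlgebra k (𝓡 1)}
    (h1 : x ∈ tensorGen 𝓡 * koszulK 𝓡 (n + 1)) (h2 : x ∈ quadRel 𝓡 * tensorGen 𝓡 ^ n) :
    x ∈ koszulK 𝓡 (n + 2) := by
  refine (Submodule.mem_iInf _).2 fun i => ?_
  refine Fin.cases (by simpa using h2) (fun j => ?_) i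
  match n, j with
  | n + 1, j =>
    have := mul_le_mul_right (iInf_le (fun i : Fin (n + 1) =>
      tensorGen 𝓡 ^ (i : ℕ) * quadRel 𝓡 * tensorGen 𝓡 ^ (n - (i : ℕ))) j) (tensorGen 𝓡) h1
    simpa [pow_succ', mul_assoc] using this

/-- The elements of degree `n + 2` of the right ideal generated by the quadratic relations. -/
theorem mem_quadRel_mul_pow {n : ℕ} {x : TensorAlgebra k (𝓡 1)} (h1 : x ∈ quadRel 𝓡 * ⊤)
    (h2 : x ∈ tensorGen 𝓡 ^ (n + 2)) : x ∈ quadRel 𝓡 * tensorGen 𝓡 ^ n := by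
  have h := tensorGen_isInternal 𝓡
  rw [← h.comp_of_mem h2]
  clear h2
  induction h1 using Submodule.mul_induction_on' with
  | mem_mul_mem q hq t _ =>
    refine h.induction (P := fun t => h.comp (n + 2) (q * t) ∈ quadRel 𝓡 * tensorGen 𝓡 ^ n)
      ?_ (by simp) ?_ t
    · intro m t ht
      have hqt : q * t ∈ tensorGen 𝓡 ^ (m + 2) := by
        rw [add_comm, pow_add]; exact Submodule.mul_mem_mul (quadRel_le 𝓡 hq) ht
      rw [h.comp_of_mem_ite (g := m + 2) _ hqt]
      split_ifs with hm
      · obtain rfl : m = n := by omega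
        exact Submodule.mul_mem_mul hq ht
      · exact zero_mem _
    · intro s t hs ht
      rw [mul_add, map_add]; exact add_mem hs ht
  | add a _ b _ ha hb => rw [map_add]; exact add_mem ha hb

theorem headD_headD_of_mem {x : TensorAlgebra k (𝓡 1)} (hx : x ∈ quadRel 𝓡 * ⊤) :
    headD (𝓡 1).subtype (headD (𝓡 1).subtype (1 ⊗ₜ x)) = 0 := by
  induction hx using Submodule.mul_induction_on' with
  | mem_mul_mem q hq t _ =>
    rw [headD_headD_mul _ (quadRel_le 𝓡 hq)]
    have : TensorAlgebra.lift k (𝓡 1).subtype q = 0 := hq.2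
    rw [this, TensorProduct.zero_tmul]
  | add a _ b _ ha hb => rw [TensorProduct.tmul_add, map_add, map_add, ha, hb, add_zero]

/-- The tensors killed by multiplying their first two letters lie in `ker φ ⊗ T(R_1)`; this is
flatness over the field `k`. -/
theorem mem_quadRel_mul_top {x : TensorAlgebra k (𝓡 1)} (hx : x ∈ tensorGen 𝓡 ^ 2 * ⊤)
    (h : headD (𝓡 1).subtype (headD (𝓡 1).subtype (1 ⊗ₜ x)) = 0) : x ∈ quadRel 𝓡 * ⊤ := by
  let W : Submodule k (TensorAlgebra k (𝓡 1)) := tensorGen 𝓡 ^ 2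
  let φ : W →ₗ[k] R := (TensorAlgebra.lift k (𝓡 1).subtype).toLinearMap ∘ₗ W.subtype
  let ψ : W ⊗[k] TensorAlgebra k (𝓡 1) →ₗ[k] TensorAlgebra k (𝓡 1) :=
    TensorProduct.lift (LinearMap.mul k (TensorAlgebra k (𝓡 1)) ∘ₗ W.subtype)
  obtain ⟨z, rfl⟩ : ∃ z, ψ z = x := by
    have key : W * ⊤ ≤ LinearMap.range ψ :=
      Submodule.mul_le.2 fun q hq t _ => ⟨⟨q, hq⟩ ⊗ₜ t, by simp [ψ]⟩
    exact key hx
  have hφ : LinearMap.rTensor (TensorAlgebra k (𝓡 1)) φ z = 0 := by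
    rw [← h]
    clear h hx
    induction z using TensorProduct.induction_on with
    | zero => simp
    | tmul q t =>
      have := headD_headD_mul (𝓡 1).subtype q.2 t
      simp only [ψ, TensorProduct.lift.tmul, LinearMap.comp_apply, LinearMap.mul_apply']
      exact this.symm
    | add a b ha hb => simp only [map_add, TensorProduct.tmul_add, ha, hb]
  obtain ⟨y, rfl⟩ := exists_rTensor_ker_subtype_eq φ hφ
  clear h hφ hx
  induction y using TensorProduct.induction_on with
  | zero => simp
  | tmul q t =>
    simp only [LinearMap.rTensor_tmul, ψ, TensorProduct.lift.tmul, LinearMap.comp_apply,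
      LinearMap.mul_apply']
    exact Submodule.mul_mem_mul ⟨q.1.2, q.2⟩ trivial
  | add a b ha hb => simp only [map_add]; exact add_mem ha hb

/-- `K_n` as a subspace of `K = ⨁ K_n`. -/
abbrev koszulPart (n : ℕ) : Submodule k (koszulTotal 𝓡) :=
  (koszulK 𝓡 n).comap (koszulTotal 𝓡).subtype

theorem koszulPart_isInternal : DirectSum.IsInternal (koszulPart 𝓡) := by
  refine isInternal_of_iSupIndep_iSup ?_ ?_
  · intro g
    rw [Submodule.disjoint_def]
    intro x hx hx'
    refine Subtype.ext (Submodule.disjoint_def.1 ((tensorGen_isInternal 𝓡).submodule_iSupIndep g) _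
      (koszulK_le_pow 𝓡 _ hx) ?_)
    have h2 : (⨆ g', ⨆ (_ : g' ≠ g), koszulPart 𝓡 g') ≤
        (⨆ g', ⨆ (_ : g' ≠ g), tensorGen 𝓡 ^ g').comap (koszulTotal 𝓡).subtype :=
      iSup₂_le fun g' hg' => Submodule.comap_mono
        ((koszulK_le_pow 𝓡 g').trans (le_iSup₂_of_le g' hg' le_rfl))
    exact h2 hx'
  · have h : (⨆ n, koszulPart 𝓡 n).map (koszulTotal 𝓡).subtype = koszulTotal 𝓡 := by
      rw [Submodule.map_iSup]
      refine iSup_congr fun n => ?_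
      rw [Submodule.map_comap_subtype, inf_eq_right]
      exact koszulK_le 𝓡 n
    refine Submodule.map_injective_of_injective (koszulTotal 𝓡).injective_subtype ?_
    rw [h, Submodule.map_subtype_top]

/-- The unit of `K_0 = k`. -/
def koszulOne : koszulTotal 𝓡 := ⟨1, koszulK_le 𝓡 0 (Submodule.mem_one.2 ⟨1, map_one _⟩)⟩

theorem koszulOne_mem : koszulOne 𝓡 ∈ koszulPart 𝓡 0 := Submodule.mem_one.2 ⟨1, map_one _⟩

theorem exists_smul_koszulOne {x : koszulTotal 𝓡} (hx : x ∈ koszulPart 𝓡 0) :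
    ∃ a : k, x = a • koszulOne 𝓡 := by
  obtain ⟨a, ha⟩ := Submodule.mem_one.1 hx
  exact ⟨a, Subtype.ext (ha.symm.trans (Algebra.algebraMap_eq_smul_one a))⟩

/-- The inclusion `R_1 = K_1 ⊆ K`. -/
def koszulGen (v : 𝓡 1) : koszulTotal 𝓡 := ⟨TensorAlgebra.ι k v, koszulK_le 𝓡 1 ⟨v, rfl⟩⟩

theorem koszulGen_mem (v : 𝓡 1) : koszulGen 𝓡 v ∈ koszulPart 𝓡 1 := ⟨v, rfl⟩

theorem lTensor_koszulTotal_injective {S : Type*} [AddCommGroup S] [Module k S] :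
    Function.Injective (LinearMap.lTensor S (koszulTotal 𝓡).subtype) :=
  Module.Flat.lTensor_preserves_injective_linearMap _ (koszulTotal 𝓡).injective_subtype

@[simp] theorem koszulSplit_koszulOne : koszulSplit 𝓡 (koszulOne 𝓡) = 0 := by
  apply lTensor_koszulTotal_injective
  rw [koszulSplit_spec, map_zero]
  exact headSplit_one

theorem koszulSplit_koszulGen (v : 𝓡 1) :
    koszulSplit 𝓡 (koszulGen 𝓡 v) = v ⊗ₜ koszulOne 𝓡 := by
  apply lTensor_koszulTotal_injective
  rw [koszulSplit_spec, LinearMap.lTensor_tmul]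
  have := headSplit_ι_mul v (1 : TensorAlgebra k (𝓡 1))
  rwa [mul_one] at this

theorem koszulSplit_mem {n : ℕ} {x : koszulTotal 𝓡} (hx : x ∈ koszulPart 𝓡 (n + 1)) :
    koszulSplit 𝓡 x ∈ Submodule.map₂ (TensorProduct.mk k (𝓡 1) (koszulTotal 𝓡)) ⊤
      (koszulPart 𝓡 n) := by
  obtain ⟨z, hz⟩ := headSplit_koszulK 𝓡 n x hx
  have : koszulSplit 𝓡 x = LinearMap.lTensor (𝓡 1) (Submodule.inclusion (koszulK_le 𝓡 n)) z := by
    apply lTensor_koszulTotal_injective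
    rw [koszulSplit_spec, ← hz, ← LinearMap.comp_apply, ← LinearMap.lTensor_comp]
    rfl
  rw [this]
  clear hz this
  induction z using TensorProduct.induction_on with
  | zero => simp
  | tmul v t =>
    rw [LinearMap.lTensor_tmul]
    exact Submodule.apply_mem_map₂ (TensorProduct.mk k (𝓡 1) (koszulTotal 𝓡)) trivial t.2
  | add a b ha hb => rw [map_add]; exact add_mem ha hb

end KoszulSpaces

/-! ### The generalized Koszul complex -/

section Koszul

variable {k R : Type*} [Field k] [Ring R] [Algebra k R] (𝓡 : ℕ → Submodule k R)

theorem gkD_tmul (r : R) (x : koszulTotal 𝓡) :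
    gkD 𝓡 (r ⊗ₜ x) =
      r • LinearMap.rTensor (koszulTotal 𝓡) (𝓡 1).subtype (koszulSplit 𝓡 x) := by
  simp [gkD]

/-- The inclusion of `GK_R = R ⊗ K` into `R ⊗ T(R_1)`. -/
def gkIncl : GKoszul 𝓡 →ₗ[R] R ⊗[k] TensorAlgebra k (𝓡 1) :=
  TensorProduct.AlgebraTensorModule.lTensor R R (koszulTotal 𝓡).subtype

@[simp] theorem gkIncl_tmul (r : R) (x : koszulTotal 𝓡) :
    gkIncl 𝓡 (r ⊗ₜ x) = r ⊗ₜ (x : TensorAlgebra k (𝓡 1)) := by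
  simp [gkIncl]

theorem gkIncl_injective : Function.Injective (gkIncl 𝓡) :=
  lTensor_koszulTotal_injective 𝓡 (S := R)

theorem gkIncl_rTensor (w : 𝓡 1 ⊗[k] koszulTotal 𝓡) :
    gkIncl 𝓡 (LinearMap.rTensor (koszulTotal 𝓡) (𝓡 1).subtype w) =
      LinearMap.rTensor _ (𝓡 1).subtype (LinearMap.lTensor (𝓡 1) (koszulTotal 𝓡).subtype w) := by
  induction w using TensorProduct.induction_on with
  | zero => simp
  | tmul v t => simp
  | add a b ha hb => simp only [map_add, ha, hb]

theorem gkIncl_gkD (x : GKoszul 𝓡) :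
    gkIncl 𝓡 (gkD 𝓡 x) = headD (𝓡 1).subtype (gkIncl 𝓡 x) := by
  induction x using TensorProduct.induction_on with
  | zero => simp
  | tmul r t => rw [gkD_tmul, map_smul, gkIncl_rTensor, koszulSplit_spec, gkIncl_tmul, headD_tmul]
  | add a b ha hb => simp only [map_add, ha, hb]

theorem gkD_gkD (x : GKoszul 𝓡) : gkD 𝓡 (gkD 𝓡 x) = 0 := by
  have key : ∀ y : koszulTotal 𝓡, gkD 𝓡 (gkD 𝓡 (1 ⊗ₜ y)) = 0 := by
    intro y
    refine (koszulPart_isInternal 𝓡).induction (P := fun y => gkD 𝓡 (gkD 𝓡 (1 ⊗ₜ y)) = 0)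
      ?_ (by simp) ?_ y
    · intro n y hy
      apply gkIncl_injective
      rw [gkIncl_gkD, gkIncl_gkD, gkIncl_tmul, map_zero]
      match n with
      | 0 =>
        obtain ⟨a, rfl⟩ := exists_smul_koszulOne 𝓡 hy
        simp [koszulOne]
      | 1 =>
        obtain ⟨v, hv⟩ := hy
        have := headD_tmul_ι_mul (𝓡 1).subtype 1 v 1
        rw [mul_one, hv] at this
        exact (congrArg _ this).trans (headD_tmul_one _ _)
      | n + 2 =>
        refine headD_headD_of_mem 𝓡 ?_
        exact (mul_le_mul_right le_top _ : _ ≤ quadRel 𝓡 * ⊤) (koszulK_le_quadRel_mul 𝓡 n hy)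
    · intro a b ha hb
      rw [TensorProduct.tmul_add, map_add, map_add, ha, hb, add_zero]
  induction x using TensorProduct.induction_on with
  | zero => simp
  | tmul r t =>
    have : r ⊗ₜ[k] t = r • ((1 : R) ⊗ₜ[k] t) := by simp [TensorProduct.smul_tmul']
    rw [this, map_smul, map_smul, key, smul_zero]
  | add a b ha hb => simp only [map_add, ha, hb, add_zero]

theorem tmul_mem_gkPiece {i n : ℕ} {r : R} (hr : r ∈ 𝓡 i) {x : koszulTotal 𝓡}
    (hx : x ∈ koszulPart 𝓡 n) : r ⊗ₜ x ∈ gkPiece 𝓡 i n :=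
  Submodule.apply_mem_map₂ (TensorProduct.mk k R (koszulTotal 𝓡)) hr hx

theorem gkPiece_le {i n : ℕ} {S : Submodule k (GKoszul 𝓡)}
    (h : ∀ r ∈ 𝓡 i, ∀ x ∈ koszulPart 𝓡 n, r ⊗ₜ x ∈ S) : gkPiece 𝓡 i n ≤ S :=
  Submodule.map₂_le.2 h

theorem gkD_eq_zero_of_mem {i : ℕ} {x : GKoszul 𝓡} (hx : x ∈ gkPiece 𝓡 i 0) : gkD 𝓡 x = 0 := by
  have : gkPiece 𝓡 i 0 ≤ LinearMap.ker ((gkD 𝓡).restrictScalars k) := by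
    refine gkPiece_le 𝓡 fun r _ y hy => ?_
    obtain ⟨a, rfl⟩ := exists_smul_koszulOne 𝓡 hy
    simp [gkD_tmul]
  exact this hx

/-- Exactness at `R_1 ⊗ K_n`: the space `K_{n+1}` is cut out in `R_1 ⊗ K_n` by the relation
imposed on the first two letters. -/
theorem exists_gkD_eq_of_mem_gkPiece_one {n : ℕ} {x : GKoszul 𝓡}
    (hx : x ∈ gkPiece 𝓡 1 n) (hd : gkD 𝓡 x = 0) :
    ∃ y ∈ koszulPart 𝓡 (n + 1), gkD 𝓡 (1 ⊗ₜ y) = x := by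
  obtain ⟨w, hw, rfl⟩ : ∃ w ∈ Submodule.map₂ (TensorProduct.mk k (𝓡 1) (koszulTotal 𝓡)) ⊤
      (koszulPart 𝓡 n), LinearMap.rTensor (koszulTotal 𝓡) (𝓡 1).subtype w = x := by
    have : gkPiece 𝓡 1 n ≤ (Submodule.map₂ (TensorProduct.mk k (𝓡 1) (koszulTotal 𝓡)) ⊤
        (koszulPart 𝓡 n)).map (LinearMap.rTensor (koszulTotal 𝓡) (𝓡 1).subtype) := by
      refine gkPiece_le 𝓡 fun r hr y hy => ⟨⟨r, hr⟩ ⊗ₜ y, ?_, by simp⟩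
      exact Submodule.apply_mem_map₂ (TensorProduct.mk k (𝓡 1) (koszulTotal 𝓡)) trivial hy
    exact this hx
  set t := headJoin (LinearMap.lTensor (𝓡 1) (koszulTotal 𝓡).subtype w) with ht
  have htK : t ∈ tensorGen 𝓡 * koszulK 𝓡 n := by
    have : Submodule.map₂ (TensorProduct.mk k (𝓡 1) (koszulTotal 𝓡)) ⊤ (koszulPart 𝓡 n) ≤
        (tensorGen 𝓡 * koszulK 𝓡 n).comap
          (headJoin ∘ₗ LinearMap.lTensor (𝓡 1) (koszulTotal 𝓡).subtype) := by
      refine Submodule.map₂_le.2 fun v _ y hy => ?_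
      simp only [Submodule.mem_comap, LinearMap.comp_apply, TensorProduct.mk_apply,
        LinearMap.lTensor_tmul, headJoin_tmul]
      exact Submodule.mul_mem_mul ⟨v, rfl⟩ hy
    exact this hw
  have hsplit : headSplit t = LinearMap.lTensor (𝓡 1) (koszulTotal 𝓡).subtype w :=
    headSplit_headJoin _
  have hmem : t ∈ koszulK 𝓡 (n + 1) := by
    match n with
    | 0 => simpa [koszulK_zero, koszulK_one] using htK
    | n + 1 =>
      refine mem_koszulK_add_two 𝓡 htK ?_
      have hpow : t ∈ tensorGen 𝓡 ^ (n + 2) := by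
        rw [pow_succ']
        exact mul_le_mul_right (koszulK_le_pow 𝓡 _) _ htK
      refine mem_quadRel_mul_pow 𝓡 (mem_quadRel_mul_top 𝓡 ?_ ?_) hpow
      · rw [add_comm, pow_add] at hpow
        exact (mul_le_mul_right le_top _ : _ ≤ tensorGen 𝓡 ^ 2 * ⊤) hpow
      · rw [headD_tmul _ 1 t, one_smul, hsplit, ← gkIncl_rTensor, ← gkIncl_gkD, hd, map_zero]
  refine ⟨⟨t, koszulK_le 𝓡 _ hmem⟩, hmem, ?_⟩
  rw [gkD_tmul, one_smul]
  congr 1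
  apply lTensor_koszulTotal_injective
  rw [koszulSplit_spec, hsplit]

section GradedRing

variable [GradedAlgebra 𝓡]

theorem smul_mem_gkPiece {i j n : ℕ} {r : R} (hr : r ∈ 𝓡 i) {x : GKoszul 𝓡}
    (hx : x ∈ gkPiece 𝓡 j n) : r • x ∈ gkPiece 𝓡 (i + j) n := by
  have : gkPiece 𝓡 j n ≤ (gkPiece 𝓡 (i + j) n).comap (Algebra.lsmul k k (GKoszul 𝓡) r) := by
    refine gkPiece_le 𝓡 fun s hs y hy => ?_
    exact tmul_mem_gkPiece 𝓡 (SetLike.mul_mem_graded hr hs) hy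
  exact this hx

theorem gkD_mem {i n : ℕ} {x : GKoszul 𝓡} (hx : x ∈ gkPiece 𝓡 i (n + 1)) :
    gkD 𝓡 x ∈ gkPiece 𝓡 (i + 1) n := by
  have : gkPiece 𝓡 i (n + 1) ≤ (gkPiece 𝓡 (i + 1) n).comap ((gkD 𝓡).restrictScalars k) := by
    refine gkPiece_le 𝓡 fun r hr y hy => ?_
    rw [Submodule.mem_comap, LinearMap.restrictScalars_apply, gkD_tmul]
    refine smul_mem_gkPiece 𝓡 hr ?_
    have h : Submodule.map₂ (TensorProduct.mk k (𝓡 1) (koszulTotal 𝓡)) ⊤ (koszulPart 𝓡 n) ≤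
        (gkPiece 𝓡 1 n).comap (LinearMap.rTensor (koszulTotal 𝓡) (𝓡 1).subtype) :=
      Submodule.map₂_le.2 fun v _ t ht => tmul_mem_gkPiece 𝓡 v.2 ht
    exact h (koszulSplit_mem 𝓡 hy)
  exact this hx

variable {𝓡}

theorem IsStandardGraded.eq_pow (hR : IsStandardGraded 𝓡) (n : ℕ) : 𝓡 n = 𝓡 1 ^ n := by
  have hle : ∀ n, 𝓡 1 ^ n ≤ 𝓡 n := by
    intro n
    induction n with
    | zero => rw [pow_zero, hR.connected]
    | succ n ih =>
      rw [pow_succ, Submodule.mul_le]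
      exact fun a ha b hb => SetLike.mul_mem_graded (ih ha) hb
  refine le_antisymm (fun x hx => ?_) (hle n)
  have h : DirectSum.IsInternal 𝓡 := DirectSum.Decomposition.isInternal 𝓡
  have htop : ∀ y : R, ∀ m, h.comp m y ∈ 𝓡 1 ^ m := by
    intro y
    have hy : y ∈ Algebra.adjoin k (𝓡 1 : Set R) := hR.generated ▸ trivial
    induction hy using Algebra.adjoin_induction with
    | mem x hx =>
      intro m
      rw [h.comp_of_mem_ite m hx]
      split_ifs with hm
      · subst hm; simpa using hx
      · exact zero_mem _
    | algebraMap r =>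
      intro m
      have hr : algebraMap k R r ∈ 𝓡 0 := by
        rw [hR.connected]; exact Submodule.mem_one.2 ⟨r, rfl⟩
      rw [h.comp_of_mem_ite m hr]
      split_ifs with hm
      · subst hm; simp
      · exact zero_mem _
    | add x y _ _ hx hy => intro m; rw [map_add]; exact add_mem (hx m) (hy m)
    | mul x y _ _ hx hy =>
      intro m
      obtain ⟨s, -, hs⟩ := h.finite_support x
      obtain ⟨t, -, ht⟩ := h.finite_support y
      rw [← hs, ← ht, Finset.sum_mul_sum, map_sum]
      refine sum_mem fun i _ => ?_
      rw [map_sum]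
      refine sum_mem fun j _ => ?_
      rw [h.comp_of_mem_ite m (SetLike.mul_mem_graded (h.comp_mem i x) (h.comp_mem j y))]
      split_ifs with hm
      · rw [← hm, pow_add]; exact Submodule.mul_mem_mul (hx i) (hy j)
      · exact zero_mem _
  rw [← h.comp_of_mem hx]
  exact htop x n

theorem IsStandardGraded.eq_bot (hR : IsStandardGraded 𝓡) (hR3 : 𝓡 3 = ⊥) {i : ℕ} (hi : 3 ≤ i) :
    𝓡 i = ⊥ := by
  rw [hR.eq_pow, ← Nat.add_sub_of_le hi, pow_add, ← hR.eq_pow 3, hR3, Submodule.bot_mul]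

theorem gkPiece_eq_bot (hR : IsStandardGraded 𝓡) (hR3 : 𝓡 3 = ⊥) {i : ℕ} (hi : 3 ≤ i) (n : ℕ) :
    gkPiece 𝓡 i n = ⊥ := by
  rw [gkPiece, hR.eq_bot hR3 hi, Submodule.map₂_bot_left]

/-- `K_{n+1} → R_1 ⊗ K_n` is injective. -/
theorem eq_zero_of_mem_gkPiece_zero (hR : IsStandardGraded 𝓡) {n : ℕ} {x : GKoszul 𝓡}
    (hx : x ∈ gkPiece 𝓡 0 (n + 1)) (hd : gkD 𝓡 x = 0) : x = 0 := by
  have h1 : ∃ y ∈ koszulPart 𝓡 (n + 1), x = 1 ⊗ₜ y := by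
    have : gkPiece 𝓡 0 (n + 1) ≤
        (koszulPart 𝓡 (n + 1)).map (TensorProduct.mk k R (koszulTotal 𝓡) 1) := by
      refine gkPiece_le 𝓡 fun r hr y hy => ?_
      rw [hR.connected] at hr
      obtain ⟨a, rfl⟩ := Submodule.mem_one.1 hr
      refine ⟨a • y, Submodule.smul_mem _ _ hy, ?_⟩
      rw [Algebra.algebraMap_eq_smul_one, TensorProduct.smul_tmul]; rfl
    obtain ⟨y, hy, hxy⟩ := this hx
    exact ⟨y, hy, hxy.symm⟩
  obtain ⟨y, hy, rfl⟩ := h1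
  have h2 : headSplit (y : TensorAlgebra k (𝓡 1)) = 0 := by
    have h3 := congrArg (gkIncl 𝓡) hd
    rw [gkIncl_gkD, gkIncl_tmul, headD_tmul, one_smul, map_zero] at h3
    exact Module.Flat.rTensor_preserves_injective_linearMap _ (𝓡 1).injective_subtype
      (h3.trans (map_zero _).symm)
  have h4 : TensorAlgebra.algebraMapInv (y : TensorAlgebra k (𝓡 1)) = 0 :=
    algebraMapInv_tensorGen_mul (S := tensorGen 𝓡 ^ n)
      (by rw [← pow_succ']; exact koszulK_le_pow 𝓡 _ hy)
  have h5 := eq_algebraMap_of_headSplit_eq_zero h2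
  rw [h4, map_zero] at h5
  obtain rfl : y = 0 := Subtype.ext h5
  simp

/-- `R_+ ⊗ K_0` consists of boundaries, since `R` is generated in degree one. -/
theorem exists_gkD_eq_of_mem_gkPiece_succ_zero (hR : IsStandardGraded 𝓡) {i : ℕ} {x : GKoszul 𝓡}
    (hx : x ∈ gkPiece 𝓡 (i + 1) 0) : ∃ y ∈ gkPiece 𝓡 i 1, gkD 𝓡 y = x := by
  have : gkPiece 𝓡 (i + 1) 0 ≤ (gkPiece 𝓡 i 1).map ((gkD 𝓡).restrictScalars k) := by
    refine gkPiece_le 𝓡 fun r hr y hy => ?_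
    obtain ⟨a, rfl⟩ := exists_smul_koszulOne 𝓡 hy
    rw [TensorProduct.tmul_smul]
    refine Submodule.smul_mem _ _ ?_
    rw [hR.eq_pow, pow_succ, ← hR.eq_pow] at hr
    induction hr using Submodule.mul_induction_on' with
    | mem_mul_mem s hs v hv =>
      refine ⟨s ⊗ₜ koszulGen 𝓡 ⟨v, hv⟩, tmul_mem_gkPiece 𝓡 hs (koszulGen_mem 𝓡 _), ?_⟩
      simp [gkD_tmul, koszulSplit_koszulGen, TensorProduct.smul_tmul']
    | add a _ b _ ha hb => rw [TensorProduct.add_tmul]; exact add_mem ha hb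
  exact this hx

end GradedRing

end Koszul

/-! ### The bigrading of the generalized Koszul complex and its homology -/

section HomologyGrading

variable {k : Type*} [Field k] {M : Type*} [AddCommGroup M] [Module k M]

/-- The bigrading, with a shift of the homological degree by one, of the homology in the part `S` of
a bigraded vector space. -/
def homologyPiece (𝒜 : ℕ × ℕ → Submodule k M) (d : M →ₗ[k] M) (S : Submodule k M) :
    ℕ × ℕ → Submodule k (HomologyAt d S)
  | (0, _) => ⊥
  | (n + 1, j) => ((𝒜 (n, j)).comap (LinearMap.ker d ⊓ S).subtype).map
      ((LinearMap.range d).comap (LinearMap.ker d ⊓ S).subtype).mkQ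

theorem homologyPiece_isInternal {𝒜 : ℕ × ℕ → Submodule k M} (h : DirectSum.IsInternal 𝒜)
    (d : M →ₗ[k] M) (S : Submodule k M)
    (hd : ∀ n j x, h.comp (n, j) (d x) = d (h.comp (n + 1, j) x))
    (hS : ∀ p, ∀ x ∈ LinearMap.ker d ⊓ S, h.comp p x ∈ LinearMap.ker d ⊓ S) :
    DirectSum.IsInternal (homologyPiece 𝒜 d S) := by
  have h1 := h.comap_subtype _ hS
  have h2 := h1.map_mkQ ((LinearMap.range d).comap (LinearMap.ker d ⊓ S).subtype)
    (by
      rintro ⟨n, j⟩ x ⟨y, hy⟩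
      refine ⟨h.comp (n + 1, j) y, ?_⟩
      have hx : (LinearMap.ker d ⊓ S).subtype (h1.comp (n, j) x) = h.comp (n, j) x :=
        (h1.comp_map h (LinearMap.ker d ⊓ S).subtype (g := (n, j)) (fun x hx => hx)
          (fun p hp y hy => h.comp_of_mem_ne hy hp) x).symm
      rw [hx, ← hd, hy]
      rfl)
  obtain ⟨ι, b, deg, hb⟩ := h2.exists_isHomogeneousBasis
  refine ((hb.coarsen fun p => (p.1 + 1, p.2)).congr fun p => ?_).isInternal
  match p with
  | (0, j) =>
    refine (iSup₂_eq_bot.2 fun q hq => ?_).symm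
    simp at hq
  | (n + 1, j) =>
    refine le_antisymm (le_iSup₂_of_le (n, j) rfl le_rfl) (iSup₂_le fun q hq => ?_)
    obtain rfl : q = (n, j) := by ext <;> simp_all
    exact le_rfl

/-- A surjection onto a graded space has a linear section respecting prescribed subspaces, as soon
as homogeneous elements can be lifted to these subspaces. -/
theorem exists_graded_section {C : Type*} [AddCommGroup C] [Module k C]
    {𝒞 : ℕ × ℕ → Submodule k C} (h : DirectSum.IsInternal 𝒞) (mk : M →ₗ[k] C)
    (P : ℕ → Submodule k M) (h0 : ∀ j, 𝒞 (0, j) = ⊥)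
    (hP : ∀ n j, ∀ c ∈ 𝒞 (n + 1, j), ∃ z ∈ P n, mk z = c) :
    ∃ α : C →ₗ[k] M, (∀ c, mk (α c) = c) ∧ ∀ n j, ∀ c ∈ 𝒞 (n + 1, j), α c ∈ P n := by
  obtain ⟨ι, b, deg, hb⟩ := h.exists_isHomogeneousBasis
  have h : ∀ i, ∃ z : M, mk z = b i ∧ ∀ n j, deg i = (n + 1, j) → z ∈ P n := by
    intro i
    have hi := hb.mem i
    rcases hd : deg i with ⟨_ | n, j⟩
    · rw [hd, h0] at hi
      exact absurd hi (b.ne_zero i)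
    · rw [hd] at hi
      obtain ⟨z, hz, hzc⟩ := hP n j _ hi
      refine ⟨z, hzc, fun n' j' h => ?_⟩
      obtain rfl : n = n' := by simpa using congrArg Prod.fst h
      exact hz
  choose z hz1 hz2 using h
  refine ⟨b.constr k z, fun c => ?_, fun n j c hc => ?_⟩
  · have : mk ∘ₗ b.constr k z = LinearMap.id := b.ext fun i => by
      rw [LinearMap.comp_apply, Module.Basis.constr_basis, hz1, LinearMap.id_apply]
    exact LinearMap.congr_fun this c
  · rw [hb.eq_span] at hc
    have hle : Submodule.span k (b '' {i | deg i = (n + 1, j)}) ≤ (P n).comap (b.constr k z) := by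
      rw [Submodule.span_le]
      rintro _ ⟨i, hi, rfl⟩
      simpa [Module.Basis.constr_basis] using hz2 i n j hi
    exact hle hc

theorem exists_eq_sub_of_mkQ_eq {d : M →ₗ[k] M} {S : Submodule k M}
    {y z : ↥(LinearMap.ker d ⊓ S)}
    (h : ((LinearMap.range d).comap (LinearMap.ker d ⊓ S).subtype).mkQ y =
      ((LinearMap.range d).comap (LinearMap.ker d ⊓ S).subtype).mkQ z) :
    ∃ x, d x = (y : M) - z :=
  (Submodule.Quotient.eq _).1 h

end HomologyGrading

section KoszulGrading

variable {k R : Type*} [Field k] [Ring R] [Algebra k R] (𝓡 : ℕ → Submodule k R)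

theorem gkBideg_add (n i : ℕ) : gkBideg 𝓡 (n, i + n) = gkPiece 𝓡 i n := by
  refine le_antisymm (iSup₂_le fun i' hi => ?_) (le_iSup₂_of_le i rfl le_rfl)
  obtain rfl : i' = i := by simpa using hi
  exact le_rfl

theorem gkBideg_eq_bot {n j : ℕ} (h : j < n) : gkBideg 𝓡 (n, j) = ⊥ := by
  refine iSup₂_eq_bot.2 fun i hi => ?_
  simp only at hi
  omega

theorem gkPiece_succ_le_gkPos (i n : ℕ) : gkPiece 𝓡 i (n + 1) ≤ gkPos 𝓡 :=
  le_iSup₂_of_le i n le_rfl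

theorem gkBideg_succ_le_gkPos (n j : ℕ) : gkBideg 𝓡 (n + 1, j) ≤ gkPos 𝓡 :=
  iSup₂_le fun i _ => gkPiece_succ_le_gkPos 𝓡 i n

theorem mem_gkCycles_iff {x : GKoszul 𝓡} : x ∈ gkCycles 𝓡 ↔ gkD 𝓡 x = 0 ∧ x ∈ gkPos 𝓡 :=
  Iff.rfl

theorem koszulCMk_eq_zero_iff (z : gkCycles 𝓡) :
    koszulCMk 𝓡 z = 0 ↔ ∃ x, gkD 𝓡 x = z := by
  rw [koszulCMk, Submodule.mkQ_apply, Submodule.Quotient.mk_eq_zero]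
  rfl

variable [GradedAlgebra 𝓡]

theorem gkBideg_isInternal : DirectSum.IsInternal (gkBideg 𝓡) := by
  have hR : DirectSum.IsInternal 𝓡 := DirectSum.Decomposition.isInternal 𝓡
  obtain ⟨ι, b, deg, hb⟩ := hR.exists_isHomogeneousBasis
  obtain ⟨κ, c, deg', hc⟩ := (koszulPart_isInternal 𝓡).exists_isHomogeneousBasis
  refine (((hb.tensorProduct hc).coarsen fun p => (p.2, p.1 + p.2)).congr fun p => ?_).isInternal
  refine le_antisymm (iSup₂_le fun i hi => ?_) (iSup₂_le fun q hq => ?_)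
  · exact le_iSup₂_of_le (i, p.1) (Prod.ext rfl hi) le_rfl
  · subst hq
    exact le_iSup₂_of_le q.1 rfl le_rfl

theorem gkD_mem_gkBideg {n j : ℕ} {x : GKoszul 𝓡} (hx : x ∈ gkBideg 𝓡 (n + 1, j)) :
    gkD 𝓡 x ∈ gkBideg 𝓡 (n, j) := by
  have : gkBideg 𝓡 (n + 1, j) ≤ (gkBideg 𝓡 (n, j)).comap ((gkD 𝓡).restrictScalars k) := by
    refine iSup₂_le fun i hi y hy => ?_
    obtain rfl : i + 1 + n = j := by simp only at hi; omega
    rw [gkBideg_add]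
    exact gkD_mem 𝓡 hy
  exact this hx

omit [GradedAlgebra 𝓡] in
theorem gkD_eq_zero_of_mem_gkBideg {j : ℕ} {x : GKoszul 𝓡} (hx : x ∈ gkBideg 𝓡 (0, j)) :
    gkD 𝓡 x = 0 := by
  have : gkBideg 𝓡 (0, j) ≤ LinearMap.ker ((gkD 𝓡).restrictScalars k) :=
    iSup₂_le fun i _ y hy => gkD_eq_zero_of_mem 𝓡 hy
  exact this hx

theorem comp_gkD (n j : ℕ) (x : GKoszul 𝓡) :
    (gkBideg_isInternal 𝓡).comp (n, j) (gkD 𝓡 x) =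
      gkD 𝓡 ((gkBideg_isInternal 𝓡).comp (n + 1, j) x) := by
  refine (gkBideg_isInternal 𝓡).comp_map (gkBideg_isInternal 𝓡) ((gkD 𝓡).restrictScalars k)
    (fun x hx => gkD_mem_gkBideg 𝓡 hx) ?_ x
  rintro ⟨m, j'⟩ hne y hy
  rw [LinearMap.restrictScalars_apply]
  match m with
  | 0 => rw [gkD_eq_zero_of_mem_gkBideg 𝓡 hy, map_zero]
  | m + 1 =>
    refine (gkBideg_isInternal 𝓡).comp_of_mem_ne (gkD_mem_gkBideg 𝓡 hy) ?_
    simpa using hne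

theorem comp_zero_of_mem_gkPos {j : ℕ} {x : GKoszul 𝓡} (hx : x ∈ gkPos 𝓡) :
    (gkBideg_isInternal 𝓡).comp (0, j) x = 0 := by
  have : gkPos 𝓡 ≤ LinearMap.ker ((gkBideg_isInternal 𝓡).comp (0, j)) := by
    refine iSup₂_le fun i n y hy => ?_
    rw [← gkBideg_add] at hy
    exact (gkBideg_isInternal 𝓡).comp_of_mem_ne hy (by simp)
  exact this hx

theorem comp_mem_gkPos (p : ℕ × ℕ) {x : GKoszul 𝓡} (hx : x ∈ gkPos 𝓡) :
    (gkBideg_isInternal 𝓡).comp p x ∈ gkPos 𝓡 := by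
  match p with
  | (0, j) => rw [comp_zero_of_mem_gkPos 𝓡 hx]; exact zero_mem _
  | (n + 1, j) => exact gkBideg_succ_le_gkPos 𝓡 n j ((gkBideg_isInternal 𝓡).comp_mem _ x)

theorem comp_mem_gkCycles (p : ℕ × ℕ) {x : GKoszul 𝓡} (hx : x ∈ gkCycles 𝓡) :
    (gkBideg_isInternal 𝓡).comp p x ∈ gkCycles 𝓡 := by
  rw [mem_gkCycles_iff] at hx ⊢
  refine ⟨?_, comp_mem_gkPos 𝓡 p hx.2⟩
  match p with
  | (0, j) => exact gkD_eq_zero_of_mem_gkBideg 𝓡 ((gkBideg_isInternal 𝓡).comp_mem _ x)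
  | (n + 1, j) =>
    rw [← comp_gkD, hx.1, map_zero]

theorem koszulCPiece_isInternal : DirectSum.IsInternal (koszulCPiece 𝓡) := by
  have h := homologyPiece_isInternal (gkBideg_isInternal 𝓡) ((gkD 𝓡).restrictScalars k) (gkPos 𝓡)
    (comp_gkD 𝓡) (fun p x hx => comp_mem_gkCycles 𝓡 p hx)
  have he : homologyPiece (gkBideg 𝓡) ((gkD 𝓡).restrictScalars k) (gkPos 𝓡) = koszulCPiece 𝓡 := by
    funext p
    match p with
    | (0, j) => rfl
    | (n + 1, j) => rfl
  rwa [he] at h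

variable {𝓡}

theorem mem_gkCycles_of_mem_gkPiece_two (hR3 : 𝓡 3 = ⊥) {n : ℕ} {x : GKoszul 𝓡}
    (hx : x ∈ gkPiece 𝓡 2 (n + 1)) : x ∈ gkCycles 𝓡 := by
  refine ⟨?_, gkPiece_succ_le_gkPos 𝓡 _ _ hx⟩
  have := gkD_mem 𝓡 hx
  rwa [gkPiece, hR3, Submodule.map₂_bot_left] at this

/-- The homology of `GK_R` in positive degrees is a quotient of `R_2 ⊗ K_n`, `n > 0`. -/
theorem mem_gkPiece_two_or_koszulCMk_eq_zero (hR : IsStandardGraded 𝓡) (hR3 : 𝓡 3 = ⊥) {n j : ℕ}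
    (z : gkCycles 𝓡) (hz : (z : GKoszul 𝓡) ∈ gkBideg 𝓡 (n, j)) :
    (0 < n ∧ j = n + 2 ∧ (z : GKoszul 𝓡) ∈ gkPiece 𝓡 2 n) ∨ koszulCMk 𝓡 z = 0 := by
  have hz0 : ∀ h : (z : GKoszul 𝓡) = 0, koszulCMk 𝓡 z = 0 := fun h => by
    rw [koszulCMk_eq_zero_iff]; exact ⟨0, by rw [h, map_zero]⟩
  have hd : gkD 𝓡 z = 0 := z.2.1
  rcases Nat.eq_zero_or_pos n with rfl | hn
  · right
    apply hz0
    rw [← (gkBideg_isInternal 𝓡).comp_of_mem hz]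
    exact comp_zero_of_mem_gkPos 𝓡 z.2.2
  · rcases lt_or_ge j n with hj | hj
    · rw [gkBideg_eq_bot 𝓡 hj] at hz
      exact Or.inr (hz0 hz)
    · obtain ⟨i, rfl⟩ : ∃ i, j = i + n := ⟨j - n, by omega⟩
      rw [gkBideg_add] at hz
      obtain ⟨n, rfl⟩ : ∃ m, n = m + 1 := ⟨n - 1, by omega⟩
      match i with
      | 0 => exact Or.inr (hz0 (eq_zero_of_mem_gkPiece_zero hR hz hd))
      | 1 =>
        obtain ⟨y, -, hy⟩ := exists_gkD_eq_of_mem_gkPiece_one 𝓡 hz hd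
        exact Or.inr ((koszulCMk_eq_zero_iff 𝓡 z).2 ⟨_, hy⟩)
      | 2 => exact Or.inl ⟨hn, by omega, hz⟩
      | i + 3 =>
        rw [gkPiece_eq_bot hR hR3 (by omega)] at hz
        exact Or.inr (hz0 hz)

theorem koszulCPiece_eq_bot (hR : IsStandardGraded 𝓡) (hR3 : 𝓡 3 = ⊥) {p : ℕ × ℕ}
    (hp : ∀ n, p ≠ (n + 2, n + 3)) : koszulCPiece 𝓡 p = ⊥ := by
  match p with
  | (0, j) => rfl
  | (n + 1, j) =>
    rw [eq_bot_iff]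
    rintro _ ⟨z, hz, rfl⟩
    rcases mem_gkPiece_two_or_koszulCMk_eq_zero hR hR3 z hz with ⟨h1, h2, -⟩ | h
    · refine absurd ?_ (hp (n - 1))
      ext <;> simp <;> omega
    · exact h

theorem exists_cycle_of_mem_koszulCPiece (hR : IsStandardGraded 𝓡) (hR3 : 𝓡 3 = ⊥) {n j : ℕ}
    {c : KoszulC 𝓡} (hc : c ∈ koszulCPiece 𝓡 (n + 1, j)) :
    ∃ z : gkCycles 𝓡, (z : GKoszul 𝓡) ∈ gkPiece 𝓡 2 n ∧ koszulCMk 𝓡 z = c := by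
  obtain ⟨z, hz, rfl⟩ := hc
  rcases mem_gkPiece_two_or_koszulCMk_eq_zero hR hR3 z hz with ⟨-, -, h⟩ | h
  · exact ⟨z, h, rfl⟩
  · exact ⟨0, zero_mem _, by rw [h, map_zero]⟩

end KoszulGrading

section KoszulSection

variable {k R : Type*} [Field k] [Ring R] [Algebra k R] {𝓡 : ℕ → Submodule k R}

theorem IsKoszulSection.eq_zero_of_gkD_eq {α : KoszulC 𝓡 →ₗ[k] gkCycles 𝓡}
    (hα : IsKoszulSection 𝓡 α) {c : KoszulC 𝓡} {x : GKoszul 𝓡} (h : gkD 𝓡 x = α c) : c = 0 := by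
  rw [← hα.mk_apply c, koszulCMk_eq_zero_iff]
  exact ⟨x, h⟩

theorem IsKoszulSection.exists_eq_gkD_add {α : KoszulC 𝓡 →ₗ[k] gkCycles 𝓡}
    (hα : IsKoszulSection 𝓡 α) {z : GKoszul 𝓡} (hd : gkD 𝓡 z = 0) (hz : z ∈ gkPos 𝓡) :
    ∃ (v : GKoszul 𝓡) (c : KoszulC 𝓡), z = gkD 𝓡 v + α c := by
  obtain ⟨y, rfl⟩ : ∃ y : gkCycles 𝓡, (y : GKoszul 𝓡) = z :=
    ⟨⟨z, (mem_gkCycles_iff 𝓡).2 ⟨hd, hz⟩⟩, rfl⟩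
  obtain ⟨c, hc⟩ : ∃ c, koszulCMk 𝓡 y = c := ⟨_, rfl⟩
  obtain ⟨v, hv⟩ := exists_eq_sub_of_mkQ_eq (hc.trans (hα.mk_apply c).symm)
  exact ⟨v, c, (sub_eq_iff_eq_add.1 hv.symm)⟩

variable (𝓡) in
/-- The unit vector of `R_0 ⊗ K_0`. -/
def gkOne : GKoszul 𝓡 := 1 ⊗ₜ koszulOne 𝓡

theorem gkD_eq_zero_of_mem_iSup {x : GKoszul 𝓡} (hx : x ∈ ⨆ i, gkPiece 𝓡 i 0) :
    gkD 𝓡 x = 0 := by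
  have : (⨆ i, gkPiece 𝓡 i 0) ≤ LinearMap.ker ((gkD 𝓡).restrictScalars k) :=
    iSup_le fun i y hy => gkD_eq_zero_of_mem 𝓡 hy
  exact this hx

variable [GradedAlgebra 𝓡]

theorem exists_isKoszulSection (hR : IsStandardGraded 𝓡) (hR3 : 𝓡 3 = ⊥) :
    ∃ α : KoszulC 𝓡 →ₗ[k] gkCycles 𝓡, IsKoszulSection 𝓡 α := by
  have h := @exists_graded_section k _ (gkCycles 𝓡) _ _ (KoszulC 𝓡) _ _ _
    (koszulCPiece_isInternal 𝓡) (koszulCMk 𝓡)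
    (fun n => (gkPiece 𝓡 2 n).comap (gkCycles 𝓡).subtype) (fun j => rfl)
    (fun n j c hc => by
      obtain ⟨z, hz, hzc⟩ := exists_cycle_of_mem_koszulCPiece hR hR3 hc
      exact ⟨z, hz, hzc⟩)
  obtain ⟨α, h1, h2⟩ := h
  exact ⟨α, h1, h2⟩

theorem exists_add_gkPos (x : GKoszul 𝓡) :
    ∃ x₀ ∈ ⨆ i, gkPiece 𝓡 i 0, ∃ x₁ ∈ gkPos 𝓡, x₀ + x₁ = x := by
  rw [← Submodule.mem_sup]
  refine (gkBideg_isInternal 𝓡).induction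
    (P := fun x => x ∈ (⨆ i, gkPiece 𝓡 i 0) ⊔ gkPos 𝓡) ?_ (zero_mem _)
    (fun x y hx hy => add_mem hx hy) x
  rintro ⟨n, j⟩ x hx
  match n with
  | 0 =>
    refine Submodule.mem_sup_left ?_
    exact iSup₂_le (fun i _ => le_iSup (fun i => gkPiece 𝓡 i 0) i) hx
  | n + 1 => exact Submodule.mem_sup_right (gkBideg_succ_le_gkPos 𝓡 n j hx)

theorem exists_eq_gkD_add_smul_gkOne (hR : IsStandardGraded 𝓡) {z : GKoszul 𝓡}
    (hz : z ∈ ⨆ i, gkPiece 𝓡 i 0) : ∃ u ∈ gkPos 𝓡, ∃ a : k, z = gkD 𝓡 u + a • gkOne 𝓡 := by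
  have hle : (⨆ i, gkPiece 𝓡 i 0) ≤ (gkPos 𝓡).map ((gkD 𝓡).restrictScalars k) ⊔
      Submodule.span k {gkOne 𝓡} := by
    refine iSup_le fun i => ?_
    match i with
    | 0 =>
      refine le_sup_of_le_right (gkPiece_le 𝓡 fun r hr x hx => ?_)
      rw [hR.connected] at hr
      obtain ⟨a, rfl⟩ := Submodule.mem_one.1 hr
      obtain ⟨b, rfl⟩ := exists_smul_koszulOne 𝓡 hx
      refine Submodule.mem_span_singleton.2 ⟨b * a, ?_⟩
      rw [gkOne, Algebra.algebraMap_eq_smul_one, TensorProduct.tmul_smul,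
        ← TensorProduct.smul_tmul', smul_smul]
    | i + 1 =>
      refine le_sup_of_le_left fun x hx => ?_
      obtain ⟨y, hy, hyx⟩ := exists_gkD_eq_of_mem_gkPiece_succ_zero hR hx
      exact ⟨y, gkPiece_succ_le_gkPos 𝓡 _ _ hy, hyx⟩
  obtain ⟨_, ⟨u, hu, rfl⟩, y, hy, h⟩ := Submodule.mem_sup.1 (hle hz)
  obtain ⟨a, rfl⟩ := Submodule.mem_span_singleton.1 hy
  exact ⟨u, hu, a, h.symm⟩

/-- The cycles of `GK_R` are spanned by the boundaries, the chosen cycles `α(c)`, and `1 ∈ R_0`. -/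
theorem IsKoszulSection.exists_of_gkD_eq_zero (hR : IsStandardGraded 𝓡)
    {α : KoszulC 𝓡 →ₗ[k] gkCycles 𝓡} (hα : IsKoszulSection 𝓡 α) {z : GKoszul 𝓡}
    (hz : gkD 𝓡 z = 0) :
    ∃ u ∈ gkPos 𝓡, ∃ (c : KoszulC 𝓡) (a : k), z = gkD 𝓡 u + α c + a • gkOne 𝓡 := by
  obtain ⟨z₀, hz₀, z₁, hz₁, hzz⟩ := exists_add_gkPos z
  obtain ⟨u₀, hu₀, a, h0⟩ := exists_eq_gkD_add_smul_gkOne hR hz₀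
  have hd1 : gkD 𝓡 z₁ = 0 := by
    rw [← hzz, map_add, gkD_eq_zero_of_mem_iSup hz₀, zero_add] at hz
    exact hz
  obtain ⟨v, c, hv⟩ := hα.exists_eq_gkD_add hd1 hz₁
  obtain ⟨v₀, hv₀, v₁, hv₁, hvv⟩ := exists_add_gkPos v
  rw [← hvv, map_add, gkD_eq_zero_of_mem_iSup hv₀, zero_add] at hv
  have hu : gkD 𝓡 (u₀ + v₁) = gkD 𝓡 u₀ + gkD 𝓡 v₁ := map_add _ _ _
  refine ⟨u₀ + v₁, add_mem hu₀ hv₁, c, a, ?_⟩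
  have aux : ∀ z₀ z₁ z a b c y w : GKoszul 𝓡, z₀ + z₁ = z → z₀ = a + w → z₁ = b + y → c = a + b →
      z = c + y + w := by
    rintro _ _ _ a b _ y w rfl rfl rfl rfl
    abel
  exact aux _ _ _ _ _ _ _ _ hzz h0 hv hu

end KoszulSection

/-! ### Twisting a complex by the tensor algebra of its homology -/

section Twist

variable {k : Type*} [Field k] {G C : Type*} [AddCommGroup G] [Module k G] [AddCommGroup C]
  [Module k C]

/-- The differential `x ⊗ t ↦ d x ⊗ t + ε(x) (α ⊗ 1)(t)` of `G ⊗ T(C)`, where `T(C)_+` is identified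
with `C ⊗ T(C)`. -/
def twistD (d : G →ₗ[k] G) (ε : G →ₗ[k] k) (α : C →ₗ[k] G) :
    G ⊗[k] TensorAlgebra k C →ₗ[k] G ⊗[k] TensorAlgebra k C :=
  LinearMap.rTensor _ d +
    LinearMap.rTensor _ α ∘ₗ headSplit ∘ₗ (TensorProduct.lid k _).toLinearMap ∘ₗ
      LinearMap.rTensor _ ε

variable {d : G →ₗ[k] G} {ε : G →ₗ[k] k} {α : C →ₗ[k] G}

theorem twistD_tmul (x : G) (t : TensorAlgebra k C) :
    twistD d ε α (x ⊗ₜ t) = d x ⊗ₜ t + ε x • LinearMap.rTensor _ α (headSplit t) := by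
  simp [twistD]

theorem rTensor_rTensor_eq_zero {A B D X : Type*} [AddCommGroup A] [Module k A] [AddCommGroup B]
    [Module k B] [AddCommGroup D] [Module k D] [AddCommGroup X] [Module k X] {f : A →ₗ[k] B}
    {g : B →ₗ[k] D} (h : ∀ x, g (f x) = 0) (w : A ⊗[k] X) :
    LinearMap.rTensor X g (LinearMap.rTensor X f w) = 0 := by
  rw [← LinearMap.comp_apply, ← LinearMap.rTensor_comp, show g ∘ₗ f = 0 from LinearMap.ext h,
    LinearMap.rTensor_zero, LinearMap.zero_apply]

theorem twistD_twistD (hdd : ∀ x, d (d x) = 0) (hεd : ∀ x, ε (d x) = 0) (hdα : ∀ c, d (α c) = 0)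
    (hεα : ∀ c, ε (α c) = 0) (y : G ⊗[k] TensorAlgebra k C) :
    twistD d ε α (twistD d ε α y) = 0 := by
  have h : ∀ w : C ⊗[k] TensorAlgebra k C, twistD d ε α (LinearMap.rTensor _ α w) = 0 := by
    intro w
    simp [twistD, rTensor_rTensor_eq_zero hdα, rTensor_rTensor_eq_zero hεα]
  induction y using TensorProduct.induction_on with
  | zero => simp
  | tmul x t =>
    rw [twistD_tmul, map_add, map_smul, h, twistD_tmul, hdd, hεd]
    simp
  | add x y hx hy => rw [map_add, map_add, hx, hy, add_zero]

/-- If the homology of `(G, d)` is spanned by the class of `1` and, isomorphically, by the image of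
`α`, then twisting kills everything but the class of `1`: the class of `α(c) ⊗ t` is the boundary
of `1 ⊗ c t`. -/
theorem exists_of_twistD_eq_zero {e : G} (hdd : ∀ x, d (d x) = 0) (hεd : ∀ x, ε (d x) = 0)
    (hdα : ∀ c, d (α c) = 0) (hεα : ∀ c, ε (α c) = 0) (hεe : ε e = 1) (hde : d e = 0)
    (hα : ∀ c x, d x = α c → c = 0)
    (hker : ∀ z, d z = 0 → ∃ u c, ∃ a : k, ε u = 0 ∧ z = d u + α c + a • e)
    {y : G ⊗[k] TensorAlgebra k C} (hy : twistD d ε α y = 0) :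
    ∃ z, ∃ a : k, y = twistD d ε α z + a • (e ⊗ₜ 1) := by
  -- the classes of the cycles `α(c)` stay independent after tensoring with `T(C)`
  have hinj : ∀ (w : C ⊗[k] TensorAlgebra k C) (y : G ⊗[k] TensorAlgebra k C),
      LinearMap.rTensor _ d y + LinearMap.rTensor _ α w = 0 → w = 0 := by
    intro w y h
    have hq : Function.Injective ((LinearMap.range d).mkQ ∘ₗ α) := by
      rw [← LinearMap.ker_eq_bot, eq_bot_iff]
      intro c hc
      rw [LinearMap.mem_ker, LinearMap.comp_apply, Submodule.mkQ_apply,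
        Submodule.Quotient.mk_eq_zero] at hc
      obtain ⟨x, hx⟩ := hc
      exact hα c x hx
    have hq' := Module.Flat.rTensor_preserves_injective_linearMap (M := TensorAlgebra k C) _ hq
    apply hq'
    have h2 := congrArg (LinearMap.rTensor (TensorAlgebra k C) (LinearMap.range d).mkQ) h
    rw [map_add, rTensor_rTensor_eq_zero (fun x => by simp), zero_add, map_zero] at h2
    rw [LinearMap.rTensor_comp, LinearMap.comp_apply, h2, map_zero]
  have hsplit := hinj (headSplit (TensorProduct.lid k _ (LinearMap.rTensor _ ε y))) y
    (by simpa [twistD] using hy)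
  have hdy : LinearMap.rTensor _ d y = 0 := by
    have := hy
    simp only [twistD, LinearMap.add_apply, LinearMap.comp_apply, LinearEquiv.coe_coe, hsplit,
      map_zero, add_zero] at this
    exact this
  obtain ⟨w, rfl⟩ := exists_rTensor_ker_subtype_eq d hdy
  have key : ∀ w : LinearMap.ker d ⊗[k] TensorAlgebra k C, ∃ z τ,
      LinearMap.rTensor _ (LinearMap.ker d).subtype w = twistD d ε α z + e ⊗ₜ τ := by
    intro w
    induction w using TensorProduct.induction_on with
    | zero => exact ⟨0, 0, by simp⟩
    | tmul x t =>
      obtain ⟨u, c, a, hu, hx⟩ := hker x x.2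
      refine ⟨u ⊗ₜ t + e ⊗ₜ (TensorAlgebra.ι k c * t), a • t, ?_⟩
      rw [map_add, twistD_tmul, twistD_tmul, hu, hde, hεe, headSplit_ι_mul]
      simp [hx, TensorProduct.add_tmul, TensorProduct.smul_tmul]
    | add x y hx hy =>
      obtain ⟨z, τ, hz⟩ := hx
      obtain ⟨z', τ', hz'⟩ := hy
      refine ⟨z + z', τ + τ', ?_⟩
      rw [map_add, hz, hz', map_add, TensorProduct.tmul_add]
      abel
  obtain ⟨z, τ, hz⟩ := key w
  rw [hz, map_add, twistD_twistD hdd hεd hdα hεα, zero_add, twistD_tmul, hde, hεe,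
    TensorProduct.zero_tmul, zero_add, one_smul] at hy
  have hτ := hinj (headSplit τ) 0 (by rw [map_zero, zero_add, hy])
  refine ⟨z, TensorAlgebra.algebraMapInv τ, hz.trans ?_⟩
  congr 1
  conv_lhs => rw [eq_algebraMap_of_headSplit_eq_zero hτ]
  rw [Algebra.algebraMap_eq_smul_one, TensorProduct.tmul_smul]

end Twist

/-! ### The minimal resolution `GK_R ⊗ T(C)` -/

section Augmentation

variable {k R : Type*} [Field k] [Ring R] [Algebra k R] (𝓡 : ℕ → Submodule k R)

/-- `ε : R → k` is the augmentation: it sends `1` to `1` and vanishes in positive degrees. -/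
structure IsAugmentation (ε : R →ₗ[k] k) : Prop where
  map_one : ε 1 = 1
  map_succ : ∀ i, ∀ r ∈ 𝓡 (i + 1), ε r = 0

variable {𝓡}

theorem IsAugmentation.map_algebraMap {ε : R →ₗ[k] k} (hε : IsAugmentation 𝓡 ε) (a : k) :
    ε (algebraMap k R a) = a := by
  rw [Algebra.algebraMap_eq_smul_one, map_smul, hε.map_one, smul_eq_mul, mul_one]

theorem IsAugmentation.map_of_pos {ε : R →ₗ[k] k} (hε : IsAugmentation 𝓡 ε) {i : ℕ} (hi : i ≠ 0)
    {r : R} (hr : r ∈ 𝓡 i) : ε r = 0 := by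
  obtain ⟨i, rfl⟩ := Nat.exists_eq_succ_of_ne_zero hi
  exact hε.map_succ i r hr

variable [GradedAlgebra 𝓡]

theorem IsStandardGraded.exists_isAugmentation (hR : IsStandardGraded 𝓡) :
    ∃ ε : R →ₗ[k] k, IsAugmentation 𝓡 ε := by
  have h : DirectSum.IsInternal 𝓡 := DirectSum.Decomposition.isInternal 𝓡
  have := hR.nontrivial
  obtain ⟨f, hf⟩ := Module.Projective.exists_dual_eq_one k (one_ne_zero (α := R))
  refine ⟨f ∘ₗ h.comp 0, ?_, fun i r hr => ?_⟩
  · rw [LinearMap.comp_apply, h.comp_of_mem (SetLike.GradedOne.one_mem), hf]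
  · rw [LinearMap.comp_apply, h.comp_of_mem_ne hr (by omega), map_zero]

theorem mem_augIdeal_of_mem {i : ℕ} (hi : i ≠ 0) {r : R} (hr : r ∈ 𝓡 i) : r ∈ augIdeal 𝓡 := by
  have : r ∈ HomogeneousIdeal.irrelevant 𝓡 := by
    rw [HomogeneousIdeal.mem_irrelevant_iff, GradedRing.proj_apply,
      DirectSum.decompose_of_mem_ne 𝓡 hr hi]
  exact this

theorem IsAugmentation.proj_zero {ε : R →ₗ[k] k} (hε : IsAugmentation 𝓡 ε)
    (hR : IsStandardGraded 𝓡) (r : R) : GradedRing.proj 𝓡 0 r = algebraMap k R (ε r) := by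
  have h : DirectSum.IsInternal 𝓡 := DirectSum.Decomposition.isInternal 𝓡
  refine h.induction (P := fun r => GradedRing.proj 𝓡 0 r = algebraMap k R (ε r)) ?_ (by simp) ?_ r
  · intro i r hr
    rcases Nat.eq_zero_or_pos i with rfl | hi
    · rw [GradedRing.proj_apply, DirectSum.decompose_of_mem_same 𝓡 hr]
      rw [hR.connected] at hr
      obtain ⟨a, rfl⟩ := Submodule.mem_one.1 hr
      rw [hε.map_algebraMap]
    · rw [GradedRing.proj_apply, DirectSum.decompose_of_mem_ne 𝓡 hr hi.ne',
        hε.map_of_pos hi.ne' hr, map_zero]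
  · intro r s hr hs
    rw [map_add, map_add, map_add, hr, hs]

theorem IsAugmentation.mem_augIdeal_iff {ε : R →ₗ[k] k} (hε : IsAugmentation 𝓡 ε)
    (hR : IsStandardGraded 𝓡) {r : R} : r ∈ augIdeal 𝓡 ↔ ε r = 0 := by
  have := hR.nontrivial
  have h : r ∈ augIdeal 𝓡 ↔ GradedRing.proj 𝓡 0 r = 0 := HomogeneousIdeal.mem_irrelevant_iff 𝓡 r
  rw [h, hε.proj_zero hR]
  exact map_eq_zero_iff _ (algebraMap k R).injective

/-- The augmentation `GK_R → R_0 ⊗ K_0 = k`. -/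
def gkEps (ε : R →ₗ[k] k) : GKoszul 𝓡 →ₗ[k] k :=
  LinearMap.mul' k k ∘ₗ TensorProduct.map ε
    (TensorAlgebra.algebraMapInv.toLinearMap ∘ₗ (koszulTotal 𝓡).subtype)

variable (𝓡) in
/-- The projection `GK_R → R ⊗ K_0 = R`. -/
def gkAug : GKoszul 𝓡 →ₗ[R] R :=
  (TensorProduct.AlgebraTensorModule.rid k R R).toLinearMap ∘ₗ
    TensorProduct.AlgebraTensorModule.lTensor R R
      (TensorAlgebra.algebraMapInv.toLinearMap ∘ₗ (koszulTotal 𝓡).subtype)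

omit [GradedAlgebra 𝓡] in
@[simp] theorem gkEps_tmul (ε : R →ₗ[k] k) (r : R) (x : koszulTotal 𝓡) :
    gkEps ε (r ⊗ₜ x) = ε r * TensorAlgebra.algebraMapInv (x : TensorAlgebra k (𝓡 1)) := by
  simp [gkEps]

omit [GradedAlgebra 𝓡] in
@[simp] theorem gkAug_tmul (r : R) (x : koszulTotal 𝓡) :
    gkAug 𝓡 (r ⊗ₜ x) = TensorAlgebra.algebraMapInv (x : TensorAlgebra k (𝓡 1)) • r := by
  simp [gkAug]

omit [GradedAlgebra 𝓡] in
theorem gkEps_eq (ε : R →ₗ[k] k) (x : GKoszul 𝓡) : gkEps ε x = ε (gkAug 𝓡 x) := by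
  induction x using TensorProduct.induction_on with
  | zero => simp
  | tmul r t => rw [gkEps_tmul, gkAug_tmul, map_smul, smul_eq_mul, mul_comm]
  | add a b ha hb => rw [map_add, map_add, map_add, ha, hb]

omit [GradedAlgebra 𝓡] in
theorem algebraMapInv_of_mem_koszulPart_succ {n : ℕ} {x : koszulTotal 𝓡}
    (hx : x ∈ koszulPart 𝓡 (n + 1)) :
    TensorAlgebra.algebraMapInv (x : TensorAlgebra k (𝓡 1)) = 0 :=
  algebraMapInv_tensorGen_mul (koszulK_succ_le 𝓡 n hx)

omit [GradedAlgebra 𝓡] in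
theorem gkAug_eq_zero_of_mem_gkPos {x : GKoszul 𝓡} (hx : x ∈ gkPos 𝓡) : gkAug 𝓡 x = 0 := by
  have : gkPos 𝓡 ≤ LinearMap.ker ((gkAug 𝓡).restrictScalars k) := by
    refine iSup₂_le fun i n => gkPiece_le 𝓡 fun r _ y hy => ?_
    rw [LinearMap.mem_ker, LinearMap.restrictScalars_apply, gkAug_tmul,
      algebraMapInv_of_mem_koszulPart_succ hy, zero_smul]
  exact this hx

omit [GradedAlgebra 𝓡] in
theorem gkAug_mem_of_mem_gkPiece {i n : ℕ} {x : GKoszul 𝓡} (hx : x ∈ gkPiece 𝓡 i n) :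
    gkAug 𝓡 x ∈ 𝓡 i := by
  have : gkPiece 𝓡 i n ≤ (𝓡 i).comap ((gkAug 𝓡).restrictScalars k) := by
    refine gkPiece_le 𝓡 fun r hr y hy => ?_
    rw [Submodule.mem_comap, LinearMap.restrictScalars_apply, gkAug_tmul]
    exact Submodule.smul_mem _ _ hr
  exact this hx

theorem gkAug_gkD_mem (x : GKoszul 𝓡) : gkAug 𝓡 (gkD 𝓡 x) ∈ augIdeal 𝓡 := by
  have h : ∀ y : 𝓡 1 ⊗[k] koszulTotal 𝓡,
      gkAug 𝓡 (LinearMap.rTensor (koszulTotal 𝓡) (𝓡 1).subtype y) ∈ augIdeal 𝓡 := by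
    intro y
    induction y using TensorProduct.induction_on with
    | zero => simp
    | tmul v t =>
      rw [LinearMap.rTensor_tmul, gkAug_tmul]
      exact Submodule.smul_of_tower_mem _ _ (mem_augIdeal_of_mem one_ne_zero v.2)
    | add a b ha hb => rw [map_add, map_add]; exact add_mem ha hb
  induction x using TensorProduct.induction_on with
  | zero => simp
  | tmul r t => rw [gkD_tmul, map_smul]; exact Submodule.smul_mem _ _ (h _)
  | add a b ha hb => rw [map_add, map_add]; exact add_mem ha hb

/-- As `R_+ R_2 = 0`, the ring `R` acts on `R_2 ⊗ K_n` through the augmentation. -/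
theorem smul_of_mem_gkPiece_two (hR : IsStandardGraded 𝓡) (hR3 : 𝓡 3 = ⊥) {ε : R →ₗ[k] k}
    (hε : IsAugmentation 𝓡 ε) {n : ℕ} {x : GKoszul 𝓡} (hx : x ∈ gkPiece 𝓡 2 n) (r : R) :
    r • x = ε r • x := by
  have h : DirectSum.IsInternal 𝓡 := DirectSum.Decomposition.isInternal 𝓡
  refine h.induction (P := fun r => r • x = ε r • x) ?_ (by simp) ?_ r
  · intro i r hr
    rcases Nat.eq_zero_or_pos i with rfl | hi
    · rw [hR.connected] at hr
      obtain ⟨a, rfl⟩ := Submodule.mem_one.1 hr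
      rw [hε.map_algebraMap, algebraMap_smul]
    · have := smul_mem_gkPiece 𝓡 hr hx
      rw [gkPiece_eq_bot hR hR3 (by omega), Submodule.mem_bot] at this
      rw [this, hε.map_of_pos hi.ne' hr, zero_smul]
  · intro r s hr hs
    rw [add_smul, map_add, add_smul, hr, hs]

/-- The properties of the map `β : C → GK_R`, `c ↦ α(c)`, on which the resolution `GK_R ⊗ T(C)`
rests: `C` lives in the bidegrees `(n + 2, n + 3)`, it is mapped to `⨁ R_2 ⊗ K_n`, and the classes
of the cycles `β(c)` form, without repetition, the homology of `GK_R` in positive degrees. -/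
structure IsKoszulLift {C : Type*} [AddCommGroup C] [Module k C] (𝒞 : ℕ × ℕ → Submodule k C)
    (β : C →ₗ[k] GKoszul 𝓡) : Prop where
  isInternal : DirectSum.IsInternal 𝒞
  eq_bot : ∀ p, (∀ n, p ≠ (n + 2, n + 3)) → 𝒞 p = ⊥
  mem : ∀ n, ∀ c ∈ 𝒞 (n + 2, n + 3), β c ∈ gkPiece 𝓡 2 (n + 1)
  eq_zero : ∀ c x, gkD 𝓡 x = β c → c = 0
  exists_eq : ∀ z, gkD 𝓡 z = 0 → ∃ u ∈ gkPos 𝓡, ∃ c, ∃ a : k, z = gkD 𝓡 u + β c + a • gkOne 𝓡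

theorem IsKoszulSection.isKoszulLift {α : KoszulC 𝓡 →ₗ[k] gkCycles 𝓡} (hα : IsKoszulSection 𝓡 α)
    (hR : IsStandardGraded 𝓡) (hR3 : 𝓡 3 = ⊥) :
    IsKoszulLift (koszulCPiece 𝓡) ((gkCycles 𝓡).subtype ∘ₗ α) where
  isInternal := koszulCPiece_isInternal 𝓡
  eq_bot := fun _ hp => koszulCPiece_eq_bot hR hR3 hp
  mem := fun n c hc => hα.mem (n + 1) (n + 3) c hc
  eq_zero := fun _ _ h => hα.eq_zero_of_gkD_eq h
  exists_eq := fun _ hz => hα.exists_of_gkD_eq_zero hR hz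

end Augmentation

section Resolution

variable {k R : Type*} [Field k] [Ring R] [Algebra k R] {𝓡 : ℕ → Submodule k R}
  {C : Type*} [AddCommGroup C] [Module k C] {𝒞 : ℕ × ℕ → Submodule k C} {β : C →ₗ[k] GKoszul 𝓡}

/-- The differential of `GK_R ⊗ T(C)` for a general map `β : C → GK_R`. -/
def koszulLiftD (β : C →ₗ[k] GKoszul 𝓡) :
    GKoszul 𝓡 ⊗[k] TensorAlgebra k C →ₗ[R] GKoszul 𝓡 ⊗[k] TensorAlgebra k C :=
  TensorProduct.AlgebraTensorModule.rTensor k (TensorAlgebra k C) (gkD 𝓡) +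
    TensorProduct.AlgebraTensorModule.lift (TensorProduct.AlgebraTensorModule.lift
      (LinearMap.toSpanSingleton R
        (koszulTotal 𝓡 →ₗ[k] TensorAlgebra k C →ₗ[k] GKoszul 𝓡 ⊗[k] TensorAlgebra k C)
        (LinearMap.smulRight
          (TensorAlgebra.algebraMapInv.toLinearMap ∘ₗ (koszulTotal 𝓡).subtype)
          (LinearMap.rTensor (TensorAlgebra k C) β ∘ₗ headSplit))))

theorem koszulLiftD_tmul (x : GKoszul 𝓡) (t : TensorAlgebra k C) :
    koszulLiftD β (x ⊗ₜ t) = gkD 𝓡 x ⊗ₜ t +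
      gkAug 𝓡 x • LinearMap.rTensor (TensorAlgebra k C) β (headSplit t) := by
  induction x using TensorProduct.induction_on with
  | zero => simp
  | tmul r y => simp [koszulLiftD, smul_comm r]
  | add a b ha hb => rw [TensorProduct.add_tmul, map_add, map_add, map_add, add_smul, ha, hb,
      TensorProduct.add_tmul, add_add_add_comm]

variable [GradedAlgebra 𝓡]

omit [GradedAlgebra 𝓡] in
theorem IsKoszulLift.mem_gkPos (h : IsKoszulLift 𝒞 β) (c : C) : β c ∈ gkPos 𝓡 := by
  refine h.isInternal.induction (P := fun c => β c ∈ gkPos 𝓡) ?_ ?_ ?_ c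
  · intro p c hc
    by_cases hp : ∀ n, p ≠ (n + 2, n + 3)
    · rw [h.eq_bot p hp, Submodule.mem_bot] at hc
      rw [hc, map_zero]; exact zero_mem _
    · push Not at hp
      obtain ⟨n, rfl⟩ := hp
      exact gkPiece_succ_le_gkPos 𝓡 _ _ (h.mem n c hc)
  · rw [map_zero]; exact zero_mem _
  · intro c c' hc hc'
    rw [map_add]; exact add_mem hc hc'

theorem IsKoszulLift.gkD_apply (h : IsKoszulLift 𝒞 β) (hR3 : 𝓡 3 = ⊥) (c : C) :
    gkD 𝓡 (β c) = 0 := by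
  refine h.isInternal.induction (P := fun c => gkD 𝓡 (β c) = 0) ?_ ?_ ?_ c
  · intro p c hc
    by_cases hp : ∀ n, p ≠ (n + 2, n + 3)
    · rw [h.eq_bot p hp, Submodule.mem_bot] at hc
      rw [hc, map_zero, map_zero]
    · push Not at hp
      obtain ⟨n, rfl⟩ := hp
      exact (mem_gkCycles_of_mem_gkPiece_two hR3 (h.mem n c hc)).1
  · rw [map_zero, map_zero]
  · intro c c' hc hc'
    rw [map_add, map_add, hc, hc', add_zero]

theorem IsKoszulLift.smul_apply (h : IsKoszulLift 𝒞 β) (hR : IsStandardGraded 𝓡)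
    (hR3 : 𝓡 3 = ⊥) {ε : R →ₗ[k] k} (hε : IsAugmentation 𝓡 ε) (r : R) (c : C) :
    r • β c = ε r • β c := by
  refine h.isInternal.induction (P := fun c => r • β c = ε r • β c) ?_ ?_ ?_ c
  · intro p c hc
    by_cases hp : ∀ n, p ≠ (n + 2, n + 3)
    · rw [h.eq_bot p hp, Submodule.mem_bot] at hc
      rw [hc, map_zero, smul_zero, smul_zero]
    · push Not at hp
      obtain ⟨n, rfl⟩ := hp
      exact smul_of_mem_gkPiece_two hR hR3 hε (h.mem n c hc) r
  · rw [map_zero, smul_zero, smul_zero]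
  · intro c c' hc hc'
    rw [map_add, smul_add, smul_add, hc, hc']

end Resolution

/-! ### Homogeneity, exactness and minimality of the twisted complex -/

section TotalGrading

variable {k : Type*} [Field k] {M : Type*} [AddCommGroup M] [Module k M]
  {N : Type*} [AddCommGroup N] [Module k N] {𝒜 : ℕ × ℕ → Submodule k M} {ℬ : ℕ × ℕ → Submodule k N}

theorem isInternal_tensorPiece (h : DirectSum.IsInternal 𝒜) :
    DirectSum.IsInternal (tensorPiece 𝒜) := by
  obtain ⟨ι, b, deg, hb⟩ := h.exists_isHomogeneousBasis
  exact hb.tensorAlgebra.isInternal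

theorem IsHomogeneousBasis.tensorProduct_add {ι κ : Type*} {b : Module.Basis ι k M}
    {deg : ι → ℕ × ℕ} {c : Module.Basis κ k N} {deg' : κ → ℕ × ℕ} (hb : IsHomogeneousBasis b deg 𝒜)
    (hc : IsHomogeneousBasis c deg' ℬ) :
    IsHomogeneousBasis (b.tensorProduct c) (fun i => deg i.1 + deg' i.2) fun l : ℕ × ℕ =>
      ⨆ (p : ℕ × ℕ) (q : ℕ × ℕ) (_ : p + q = (l.1, l.2)),
        Submodule.map₂ (TensorProduct.mk k M N) (𝒜 p) (ℬ q) := by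
  refine ((hb.tensorProduct hc).coarsen fun p => p.1 + p.2).congr
    fun p => le_antisymm ?_ (iSup₂_le fun q hq => ?_)
  · refine iSup_le fun p' => iSup_le fun q => iSup_le fun hpq => ?_
    exact le_iSup₂_of_le (p', q) hpq le_rfl
  · exact le_iSup_of_le q.1 (le_iSup_of_le q.2 (le_iSup_of_le hq le_rfl))

theorem DirectSum.IsInternal.tensorProduct (h : DirectSum.IsInternal 𝒜)
    (h' : DirectSum.IsInternal ℬ) :
    DirectSum.IsInternal fun l : ℕ × ℕ => ⨆ (p : ℕ × ℕ) (q : ℕ × ℕ) (_ : p + q = (l.1, l.2)),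
      Submodule.map₂ (TensorProduct.mk k M N) (𝒜 p) (ℬ q) := by
  obtain ⟨ι, b, deg, hb⟩ := h.exists_isHomogeneousBasis
  obtain ⟨κ, c, deg', hc⟩ := h'.exists_isHomogeneousBasis
  exact (hb.tensorProduct_add hc).isInternal

theorem DirectSum.IsInternal.iSup_snd {𝒜 : ℕ → ℕ → Submodule k M}
    (h : DirectSum.IsInternal fun p : ℕ × ℕ => 𝒜 p.1 p.2) :
    DirectSum.IsInternal fun n => ⨆ j, 𝒜 n j := by
  obtain ⟨ι, b, deg, hb⟩ := h.exists_isHomogeneousBasis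
  refine ((hb.coarsen Prod.fst).congr fun n => le_antisymm (iSup_le fun j => ?_)
    (iSup₂_le fun p hp => ?_)).isInternal
  · exact le_iSup₂_of_le (n, j) rfl le_rfl
  · subst hp
    exact le_iSup (𝒜 p.1) p.2

theorem DirectSum.IsInternal.tensorProduct_iSup_snd (h : DirectSum.IsInternal 𝒜)
    (h' : DirectSum.IsInternal ℬ) :
    DirectSum.IsInternal fun n : ℕ => ⨆ (j : ℕ) (p : ℕ × ℕ) (q : ℕ × ℕ) (_ : p + q = (n, j)),
      Submodule.map₂ (TensorProduct.mk k M N) (𝒜 p) (ℬ q) :=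
  (h.tensorProduct h').iSup_snd (𝒜 := fun n j => ⨆ (p : ℕ × ℕ) (q : ℕ × ℕ) (_ : p + q = (n, j)),
      Submodule.map₂ (TensorProduct.mk k M N) (𝒜 p) (ℬ q))

/-- An endomorphism of degree `-1` commutes with taking components. -/
theorem DirectSum.IsInternal.comp_lowering {𝒜 : ℕ → Submodule k M} (h : DirectSum.IsInternal 𝒜)
    {d : M →ₗ[k] M} (hd : ∀ n, ∀ x ∈ 𝒜 (n + 1), d x ∈ 𝒜 n) (hd0 : ∀ x ∈ 𝒜 0, d x = 0) (n : ℕ)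
    (x : M) : h.comp n (d x) = d (h.comp (n + 1) x) := by
  refine h.comp_map h d (hd n) ?_ x
  intro m hm y hy
  match m with
  | 0 => rw [hd0 y hy, map_zero]
  | m + 1 => exact h.comp_of_mem_ne (hd m y hy) (by omega)

/-- If the homology of a complex is spanned by the class of an element `e` of degree `0`, then it is
exact in positive degrees. -/
theorem DirectSum.IsInternal.exact_of_forall_exists {𝒜 : ℕ → ℕ → Submodule k M}
    (h : DirectSum.IsInternal fun p : ℕ × ℕ => 𝒜 p.1 p.2) {d : M →ₗ[k] M}
    (hd : ∀ n j, ∀ x ∈ 𝒜 (n + 1) j, d x ∈ 𝒜 n j) (hd0 : ∀ j, ∀ x ∈ 𝒜 0 j, d x = 0) {e : M}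
    (he : e ∈ 𝒜 0 0) (hex : ∀ x, d x = 0 → ∃ z, ∃ a : k, x = d z + a • e) :
    (∀ n, ∀ x ∈ ⨆ j, 𝒜 (n + 1) j, d x = 0 → ∃ z ∈ ⨆ j, 𝒜 (n + 2) j, d z = x) ∧
      ∀ x ∈ ⨆ j, 𝒜 0 j, ∃ z ∈ ⨆ j, 𝒜 1 j, ∃ a : k, x = d z + a • e := by
  have hd' : ∀ n, ∀ x ∈ ⨆ j, 𝒜 (n + 1) j, d x ∈ ⨆ j, 𝒜 n j := fun n => by
    have : ⨆ j, 𝒜 (n + 1) j ≤ (⨆ j, 𝒜 n j).comap d :=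
      iSup_le fun j x hx => (le_iSup (𝒜 n) j) (hd n j x hx)
    exact this
  have hd0' : ∀ x ∈ ⨆ j, 𝒜 0 j, d x = 0 := by
    have : ⨆ j, 𝒜 0 j ≤ LinearMap.ker d := iSup_le fun j x hx => hd0 j x hx
    exact this
  have he' : e ∈ ⨆ j, 𝒜 0 j := (le_iSup (𝒜 0) 0) he
  constructor
  · intro n x hx hdx
    obtain ⟨z, a, hz⟩ := hex x hdx
    refine ⟨h.iSup_snd.comp (n + 2) z, h.iSup_snd.comp_mem _ _, ?_⟩
    have h2 := congrArg (h.iSup_snd.comp (n + 1)) hz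
    rw [h.iSup_snd.comp_of_mem hx, map_add, map_smul,
      h.iSup_snd.comp_of_mem_ne he' (Nat.succ_ne_zero n).symm, smul_zero, add_zero,
      h.iSup_snd.comp_lowering hd' hd0'] at h2
    exact h2.symm
  · intro x hx
    obtain ⟨z, a, hz⟩ := hex x (hd0' x hx)
    refine ⟨h.iSup_snd.comp 1 z, h.iSup_snd.comp_mem _ _, a, ?_⟩
    have h2 := congrArg (h.iSup_snd.comp 0) hz
    rwa [h.iSup_snd.comp_of_mem hx, map_add, map_smul, h.iSup_snd.comp_of_mem he',
      h.iSup_snd.comp_lowering hd' hd0'] at h2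

end TotalGrading

section ResolutionGrading

variable {k R : Type*} [Field k] [Ring R] [Algebra k R] {𝓡 : ℕ → Submodule k R}
  {C : Type*} [AddCommGroup C] [Module k C] {𝒞 : ℕ × ℕ → Submodule k C} {β : C →ₗ[k] GKoszul 𝓡}

variable (𝓡 𝒞) in
/-- The bigrading of `GK_R ⊗ T(C)` for a general bigraded space `C`. -/
def koszulLiftPiece (n j : ℕ) : Submodule k (GKoszul 𝓡 ⊗[k] TensorAlgebra k C) :=
  ⨆ (p : ℕ × ℕ) (q : ℕ × ℕ) (_ : p + q = (n, j)),
    Submodule.map₂ (TensorProduct.mk k (GKoszul 𝓡) (TensorAlgebra k C))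
      (gkBideg 𝓡 p) (tensorPiece 𝒞 q)

theorem tmul_mem_koszulLiftPiece {p q : ℕ × ℕ} {n j : ℕ} (hpq : p + q = (n, j)) {x : GKoszul 𝓡}
    (hx : x ∈ gkBideg 𝓡 p) {t : TensorAlgebra k C} (ht : t ∈ tensorPiece 𝒞 q) :
    x ⊗ₜ t ∈ koszulLiftPiece 𝓡 𝒞 n j := by
  have h : x ⊗ₜ t ∈ Submodule.map₂ (TensorProduct.mk k (GKoszul 𝓡) (TensorAlgebra k C))
      (gkBideg 𝓡 p) (tensorPiece 𝒞 q) :=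
    Submodule.apply_mem_map₂ (TensorProduct.mk k (GKoszul 𝓡) (TensorAlgebra k C)) hx ht
  exact (le_iSup_of_le p (le_iSup_of_le q (le_iSup_of_le hpq le_rfl)) :
    _ ≤ koszulLiftPiece 𝓡 𝒞 n j) h

theorem koszulLiftPiece_le {n j : ℕ} {S : Submodule k (GKoszul 𝓡 ⊗[k] TensorAlgebra k C)}
    (h : ∀ p q, p + q = (n, j) → ∀ x ∈ gkBideg 𝓡 p, ∀ t ∈ tensorPiece 𝒞 q, x ⊗ₜ t ∈ S) :
    koszulLiftPiece 𝓡 𝒞 n j ≤ S :=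
  iSup_le fun p => iSup_le fun q => iSup_le fun hpq => Submodule.map₂_le.2 (h p q hpq)

variable [GradedAlgebra 𝓡]

theorem koszulLiftPiece_isInternal (h𝒞 : DirectSum.IsInternal 𝒞) :
    DirectSum.IsInternal fun p : ℕ × ℕ => koszulLiftPiece 𝓡 𝒞 p.1 p.2 :=
  (gkBideg_isInternal 𝓡).tensorProduct (isInternal_tensorPiece h𝒞)

theorem smul_mem_koszulLiftPiece (i n j : ℕ) (r : R) (hr : r ∈ 𝓡 i)
    (y : GKoszul 𝓡 ⊗[k] TensorAlgebra k C) (hy : y ∈ koszulLiftPiece 𝓡 𝒞 n j) :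
    r • y ∈ koszulLiftPiece 𝓡 𝒞 n (i + j) := by
  have : koszulLiftPiece 𝓡 𝒞 n j ≤ (koszulLiftPiece 𝓡 𝒞 n (i + j)).comap
      (Algebra.lsmul k k (GKoszul 𝓡 ⊗[k] TensorAlgebra k C) r) := by
    refine koszulLiftPiece_le fun p q hpq x hx t ht => ?_
    change r • (x ⊗ₜ[k] t) ∈ koszulLiftPiece 𝓡 𝒞 n (i + j)
    rw [TensorProduct.smul_tmul']
    refine tmul_mem_koszulLiftPiece (p := (p.1, i + p.2)) (q := q) ?_ ?_ ht
    · simp only [Prod.ext_iff, Prod.fst_add, Prod.snd_add] at hpq ⊢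
      omega
    · have : gkBideg 𝓡 p ≤ (gkBideg 𝓡 (p.1, i + p.2)).comap
          (Algebra.lsmul k k (GKoszul 𝓡) r) := by
        refine iSup₂_le fun i' hi' y hy => ?_
        rw [← hi', ← add_assoc]
        rw [Submodule.mem_comap, gkBideg_add]
        exact smul_mem_gkPiece 𝓡 hr hy
      exact this hx
  exact this hy

theorem koszulLift_free (h𝒞 : DirectSum.IsInternal 𝒞) :
    ∃ b : Set (GKoszul 𝓡 ⊗[k] TensorAlgebra k C),
      LinearIndependent R (Subtype.val : b → GKoszul 𝓡 ⊗[k] TensorAlgebra k C) ∧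
      Submodule.span R b = ⊤ ∧ ∀ y ∈ b, ∃ n j, y ∈ koszulLiftPiece 𝓡 𝒞 n j := by
  obtain ⟨ι, b, deg, hb⟩ := (koszulPart_isInternal 𝓡).exists_isHomogeneousBasis
  obtain ⟨κ, c, deg', hc⟩ := h𝒞.exists_isHomogeneousBasis
  let B := (Algebra.TensorProduct.basis R b).tensorProduct c.tensorAlgebra
  refine ⟨Set.range B, B.linearIndependent.linearIndepOn_id, B.span_eq, ?_⟩
  rintro _ ⟨⟨i, w⟩, rfl⟩
  have hw := hc.tensorAlgebra.mem w
  have hi : (1 : R) ⊗ₜ[k] b i ∈ gkBideg 𝓡 (deg i, 0 + deg i) := by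
    rw [gkBideg_add]
    exact tmul_mem_gkPiece 𝓡 SetLike.GradedOne.one_mem (hb.mem i)
  have h := tmul_mem_koszulLiftPiece (n := deg i + (wordDeg deg' w).1)
    (j := 0 + deg i + (wordDeg deg' w).2) rfl hi hw
  exact ⟨_, _, by simpa only [B, Module.Basis.tensorProduct_apply,
    Algebra.TensorProduct.basis_apply] using h⟩

end ResolutionGrading

section ResolutionDifferential

variable {k R : Type*} [Field k] [Ring R] [Algebra k R] {𝓡 : ℕ → Submodule k R} [GradedAlgebra 𝓡]
  {C : Type*} [AddCommGroup C] [Module k C] {𝒞 : ℕ × ℕ → Submodule k C} {β : C →ₗ[k] GKoszul 𝓡}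

theorem koszulLiftD_eq_twistD (h : IsKoszulLift 𝒞 β) (hR : IsStandardGraded 𝓡) (hR3 : 𝓡 3 = ⊥)
    {ε : R →ₗ[k] k} (hε : IsAugmentation 𝓡 ε) (y : GKoszul 𝓡 ⊗[k] TensorAlgebra k C) :
    koszulLiftD β y = twistD ((gkD 𝓡).restrictScalars k) (gkEps ε) β y := by
  have hs : ∀ (r : R) (w : C ⊗[k] TensorAlgebra k C),
      r • LinearMap.rTensor (TensorAlgebra k C) β w =
        ε r • LinearMap.rTensor (TensorAlgebra k C) β w := by
    intro r w
    induction w using TensorProduct.induction_on with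
    | zero => simp
    | tmul c t =>
      rw [LinearMap.rTensor_tmul, TensorProduct.smul_tmul', TensorProduct.smul_tmul',
        h.smul_apply hR hR3 hε]
    | add a b ha hb => rw [map_add, smul_add, smul_add, ha, hb]
  induction y using TensorProduct.induction_on with
  | zero => rw [map_zero, map_zero]
  | tmul x t => rw [koszulLiftD_tmul, twistD_tmul, hs, gkEps_eq, LinearMap.restrictScalars_apply]
  | add a b ha hb => rw [map_add, map_add, ha, hb]

theorem gkEps_gkD (hR : IsStandardGraded 𝓡) {ε : R →ₗ[k] k} (hε : IsAugmentation 𝓡 ε)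
    (x : GKoszul 𝓡) : gkEps ε (gkD 𝓡 x) = 0 := by
  rw [gkEps_eq]
  exact (hε.mem_augIdeal_iff hR).1 (gkAug_gkD_mem x)

omit [GradedAlgebra 𝓡] in
theorem gkEps_eq_zero_of_mem_gkPos {ε : R →ₗ[k] k} {x : GKoszul 𝓡} (hx : x ∈ gkPos 𝓡) :
    gkEps ε x = 0 := by
  rw [gkEps_eq, gkAug_eq_zero_of_mem_gkPos hx, map_zero]

omit [GradedAlgebra 𝓡] in
theorem gkEps_gkOne {ε : R →ₗ[k] k} (hε : IsAugmentation 𝓡 ε) : gkEps ε (gkOne 𝓡) = 1 := by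
  simp [gkOne, koszulOne, hε.map_one]

omit [GradedAlgebra 𝓡] in
theorem gkD_gkOne : gkD 𝓡 (gkOne 𝓡) = 0 := by
  simp [gkOne, gkD_tmul]

theorem koszulLiftD_koszulLiftD (h : IsKoszulLift 𝒞 β) (hR : IsStandardGraded 𝓡) (hR3 : 𝓡 3 = ⊥)
    (y : GKoszul 𝓡 ⊗[k] TensorAlgebra k C) : koszulLiftD β (koszulLiftD β y) = 0 := by
  obtain ⟨ε, hε⟩ := hR.exists_isAugmentation
  rw [koszulLiftD_eq_twistD h hR hR3 hε, koszulLiftD_eq_twistD h hR hR3 hε]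
  exact twistD_twistD (d := (gkD 𝓡).restrictScalars k) (gkD_gkD 𝓡) (gkEps_gkD hR hε)
    (h.gkD_apply hR3) (fun c => gkEps_eq_zero_of_mem_gkPos (h.mem_gkPos c)) y

theorem exists_of_koszulLiftD_eq_zero (h : IsKoszulLift 𝒞 β) (hR : IsStandardGraded 𝓡)
    (hR3 : 𝓡 3 = ⊥) {y : GKoszul 𝓡 ⊗[k] TensorAlgebra k C} (hy : koszulLiftD β y = 0) :
    ∃ z, ∃ a : k, y = koszulLiftD β z + a • (gkOne 𝓡 ⊗ₜ 1) := by
  obtain ⟨ε, hε⟩ := hR.exists_isAugmentation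
  rw [koszulLiftD_eq_twistD h hR hR3 hε] at hy
  obtain ⟨z, a, hz⟩ := exists_of_twistD_eq_zero
    (d := (gkD 𝓡).restrictScalars k) (e := gkOne 𝓡) (gkD_gkD 𝓡) (gkEps_gkD hR hε)
    (h.gkD_apply hR3) (fun c => gkEps_eq_zero_of_mem_gkPos (h.mem_gkPos c)) (gkEps_gkOne hε)
    gkD_gkOne h.eq_zero (fun z hz => by
      obtain ⟨u, hu, c, a, h⟩ := h.exists_eq z hz
      exact ⟨u, c, a, gkEps_eq_zero_of_mem_gkPos hu, h⟩) hy
  exact ⟨z, a, by rw [koszulLiftD_eq_twistD h hR hR3 hε, hz]⟩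

omit [GradedAlgebra 𝓡] in
/-- The map `c ⊗ t ↦ β(c) ⊗ t` has bidegree `(-1, 0)`. -/
theorem rTensor_headSplit_mem (h : IsKoszulLift 𝒞 β) {q : ℕ × ℕ} {t : TensorAlgebra k C}
    (ht : t ∈ tensorPiece 𝒞 q) :
    (∀ n j, q = (n + 1, j) →
      LinearMap.rTensor (TensorAlgebra k C) β (headSplit t) ∈ koszulLiftPiece 𝓡 𝒞 n j) ∧
    (q.1 = 0 → LinearMap.rTensor (TensorAlgebra k C) β (headSplit t) = 0) := by
  refine tensorPiece_induction (P := fun q t => (∀ n j, q = (n + 1, j) →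
      LinearMap.rTensor (TensorAlgebra k C) β (headSplit t) ∈ koszulLiftPiece 𝓡 𝒞 n j) ∧
    (q.1 = 0 → LinearMap.rTensor (TensorAlgebra k C) β (headSplit t) = 0)) ?_ ?_ ?_ ?_ ?_ ht
  · simp
  · intro p q c t hc ht _
    rw [headSplit_ι_mul, LinearMap.rTensor_tmul]
    by_cases hp : ∀ n, p ≠ (n + 2, n + 3)
    · rw [h.eq_bot p hp, Submodule.mem_bot] at hc
      rw [hc, map_zero, TensorProduct.zero_tmul]
      exact ⟨fun _ _ _ => zero_mem _, fun _ => rfl⟩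
    · push Not at hp
      obtain ⟨m, rfl⟩ := hp
      refine ⟨fun n j hn => ?_, fun h0 => ?_⟩
      · refine tmul_mem_koszulLiftPiece (p := (m + 1, 2 + (m + 1))) ?_ ?_ ht
        · simp only [Prod.ext_iff, Prod.fst_add, Prod.snd_add] at hn ⊢
          omega
        · rw [gkBideg_add]
          exact h.mem m c hc
      · simp only [Prod.fst_add] at h0
        omega
  · simp
  · rintro p t t' ⟨h1, h2⟩ ⟨h3, h4⟩
    rw [map_add, map_add]
    exact ⟨fun n j hn => add_mem (h1 n j hn) (h3 n j hn), fun h0 => by rw [h2 h0, h4 h0, add_zero]⟩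
  · rintro p a t ⟨h1, h2⟩
    rw [map_smul, map_smul]
    exact ⟨fun n j hn => Submodule.smul_mem _ _ (h1 n j hn), fun h0 => by rw [h2 h0, smul_zero]⟩

omit [GradedAlgebra 𝓡] in
theorem gkEps_eq_zero_of_mem_gkBideg {ε : R →ₗ[k] k} (hε : IsAugmentation 𝓡 ε) {p : ℕ × ℕ}
    (hp : p ≠ 0) {x : GKoszul 𝓡} (hx : x ∈ gkBideg 𝓡 p) : gkEps ε x = 0 := by
  match p with
  | (n + 1, j) => exact gkEps_eq_zero_of_mem_gkPos (gkBideg_succ_le_gkPos 𝓡 n j hx)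
  | (0, j) =>
    have h := gkBideg_add 𝓡 0 j
    rw [add_zero] at h
    rw [h] at hx
    rw [gkEps_eq]
    exact hε.map_of_pos (fun h0 => hp (by rw [h0]; rfl)) (gkAug_mem_of_mem_gkPiece hx)

theorem koszulLiftD_mem (h : IsKoszulLift 𝒞 β) (hR : IsStandardGraded 𝓡) (hR3 : 𝓡 3 = ⊥)
    (n j : ℕ) (y : GKoszul 𝓡 ⊗[k] TensorAlgebra k C) (hy : y ∈ koszulLiftPiece 𝓡 𝒞 (n + 1) j) :
    koszulLiftD β y ∈ koszulLiftPiece 𝓡 𝒞 n j := by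
  obtain ⟨ε, hε⟩ := hR.exists_isAugmentation
  have : koszulLiftPiece 𝓡 𝒞 (n + 1) j ≤ (koszulLiftPiece 𝓡 𝒞 n j).comap
      (twistD ((gkD 𝓡).restrictScalars k) (gkEps ε) β) := by
    refine koszulLiftPiece_le fun p q hpq x hx t ht => ?_
    rw [Submodule.mem_comap, twistD_tmul, LinearMap.restrictScalars_apply]
    refine add_mem ?_ ?_
    · match p with
      | (0, i) =>
        rw [gkD_eq_zero_of_mem_gkBideg 𝓡 hx, TensorProduct.zero_tmul]
        exact zero_mem _
      | (m + 1, i) =>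
        refine tmul_mem_koszulLiftPiece (p := (m, i)) ?_ (gkD_mem_gkBideg 𝓡 hx) ht
        simp only [Prod.ext_iff, Prod.fst_add, Prod.snd_add] at hpq ⊢
        omega
    · by_cases hp : p = 0
      · refine Submodule.smul_mem _ _ ((rTensor_headSplit_mem h ht).1 n j ?_)
        rw [← hpq, hp, zero_add]
      · rw [gkEps_eq_zero_of_mem_gkBideg hε hp hx, zero_smul]
        exact zero_mem _
  rw [koszulLiftD_eq_twistD h hR hR3 hε]
  exact this hy

theorem koszulLiftD_eq_zero (h : IsKoszulLift 𝒞 β) (hR : IsStandardGraded 𝓡) (hR3 : 𝓡 3 = ⊥)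
    (j : ℕ) (y : GKoszul 𝓡 ⊗[k] TensorAlgebra k C) (hy : y ∈ koszulLiftPiece 𝓡 𝒞 0 j) :
    koszulLiftD β y = 0 := by
  obtain ⟨ε, hε⟩ := hR.exists_isAugmentation
  have : koszulLiftPiece 𝓡 𝒞 0 j ≤
      LinearMap.ker (twistD ((gkD 𝓡).restrictScalars k) (gkEps ε) β) := by
    refine koszulLiftPiece_le fun p q hpq x hx t ht => ?_
    simp only [Prod.ext_iff, Prod.fst_add, Prod.snd_add] at hpq
    obtain ⟨p1, p2⟩ := p
    obtain rfl : p1 = 0 := by simp only at hpq; omega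
    rw [LinearMap.mem_ker, twistD_tmul, LinearMap.restrictScalars_apply,
      gkD_eq_zero_of_mem_gkBideg 𝓡 hx, (rTensor_headSplit_mem h ht).2 (by omega)]
    simp
  rw [koszulLiftD_eq_twistD h hR hR3 hε]
  exact this hy

end ResolutionDifferential

section MinimalResolution

variable {k R : Type*} [Field k] [Ring R] [Algebra k R] {𝓡 : ℕ → Submodule k R} [GradedAlgebra 𝓡]
  {C : Type*} [AddCommGroup C] [Module k C] {𝒞 : ℕ × ℕ → Submodule k C} {β : C →ₗ[k] GKoszul 𝓡}

variable (𝓡) in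
/-- The span of the products `a w` with `a ∈ R_+`, that is `R_+ N`. -/
def augSpan (N : Type*) [AddCommMonoid N] [Module R N] : Submodule R N :=
  Submodule.span R {z : N | ∃ a ∈ augIdeal 𝓡, ∃ w : N, z = a • w}

theorem smul_mem_augSpan {N : Type*} [AddCommMonoid N] [Module R N] {a : R} (ha : a ∈ augIdeal 𝓡)
    (w : N) : a • w ∈ augSpan 𝓡 N :=
  Submodule.subset_span ⟨a, ha, w, rfl⟩

theorem map_mem_augSpan {N N' : Type*} [AddCommMonoid N] [Module R N] [AddCommMonoid N']
    [Module R N'] (f : N →ₗ[R] N') {x : N} (hx : x ∈ augSpan 𝓡 N) : f x ∈ augSpan 𝓡 N' := by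
  have : augSpan 𝓡 N ≤ (augSpan 𝓡 N').comap f := by
    refine Submodule.span_le.2 ?_
    rintro _ ⟨a, ha, w, rfl⟩
    change f (a • w) ∈ augSpan 𝓡 N'
    rw [map_smul]
    exact smul_mem_augSpan ha _
  exact this hx

theorem tmul_mem_augSpan {N T : Type*} [AddCommGroup N] [Module k N] [Module R N]
    [IsScalarTower k R N] [AddCommGroup T] [Module k T] {x : N} (hx : x ∈ augSpan 𝓡 N) (t : T) :
    x ⊗ₜ[k] t ∈ augSpan 𝓡 (N ⊗[k] T) :=
  map_mem_augSpan ((TensorProduct.AlgebraTensorModule.mk k R N T).flip t) hx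

theorem rTensor_mem_augSpan {C N T : Type*} [AddCommGroup C] [Module k C] [AddCommGroup N]
    [Module k N] [Module R N]
    [IsScalarTower k R N] [AddCommGroup T] [Module k T] {f : C →ₗ[k] N}
    (hf : ∀ c, f c ∈ augSpan 𝓡 N) (w : C ⊗[k] T) :
    LinearMap.rTensor T f w ∈ augSpan 𝓡 (N ⊗[k] T) := by
  induction w using TensorProduct.induction_on with
  | zero => rw [map_zero]; exact zero_mem _
  | tmul c t => rw [LinearMap.rTensor_tmul]; exact tmul_mem_augSpan (hf c) t
  | add x y hx hy => rw [map_add]; exact add_mem hx hy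

theorem gkPiece_le_augSpan {i n : ℕ} (hi : i ≠ 0) {x : GKoszul 𝓡} (hx : x ∈ gkPiece 𝓡 i n) :
    x ∈ augSpan 𝓡 (GKoszul 𝓡) := by
  have : gkPiece 𝓡 i n ≤ (augSpan 𝓡 (GKoszul 𝓡)).restrictScalars k := by
    refine gkPiece_le 𝓡 fun r hr y _ => ?_
    have := smul_mem_augSpan (mem_augIdeal_of_mem hi hr) ((1 : R) ⊗ₜ[k] y)
    rwa [TensorProduct.smul_tmul', smul_eq_mul, mul_one] at this
  exact this hx

theorem gkD_mem_augSpan (x : GKoszul 𝓡) : gkD 𝓡 x ∈ augSpan 𝓡 (GKoszul 𝓡) := by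
  refine (gkBideg_isInternal 𝓡).induction (P := fun x => gkD 𝓡 x ∈ augSpan 𝓡 (GKoszul 𝓡)) ?_
    (by rw [map_zero]; exact zero_mem _)
    (fun x y hx hy => by rw [map_add]; exact add_mem hx hy) x
  rintro ⟨n, j⟩ x hx
  have : gkBideg 𝓡 (n, j) ≤
      ((augSpan 𝓡 (GKoszul 𝓡)).restrictScalars k).comap ((gkD 𝓡).restrictScalars k) := by
    refine iSup₂_le fun i _ y hy => ?_
    change gkD 𝓡 y ∈ augSpan 𝓡 (GKoszul 𝓡)
    match n with
    | 0 => rw [gkD_eq_zero_of_mem 𝓡 hy]; exact zero_mem _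
    | n + 1 => exact gkPiece_le_augSpan (Nat.succ_ne_zero i) (gkD_mem 𝓡 hy)
  exact this hx

theorem IsKoszulLift.apply_mem_augSpan (h : IsKoszulLift 𝒞 β) (c : C) :
    β c ∈ augSpan 𝓡 (GKoszul 𝓡) := by
  refine h.isInternal.induction (P := fun c => β c ∈ augSpan 𝓡 (GKoszul 𝓡)) ?_
    (by rw [map_zero]; exact zero_mem _)
    (fun x y hx hy => by rw [map_add]; exact add_mem hx hy) c
  intro p c hc
  by_cases hp : ∀ n, p ≠ (n + 2, n + 3)
  · rw [h.eq_bot p hp, Submodule.mem_bot] at hc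
    rw [hc, map_zero]; exact zero_mem _
  · push Not at hp
    obtain ⟨n, rfl⟩ := hp
    exact gkPiece_le_augSpan two_ne_zero (h.mem n c hc)

theorem koszulLiftD_mem_augSpan (h : IsKoszulLift 𝒞 β) (y : GKoszul 𝓡 ⊗[k] TensorAlgebra k C) :
    koszulLiftD β y ∈ augSpan 𝓡 (GKoszul 𝓡 ⊗[k] TensorAlgebra k C) := by
  induction y using TensorProduct.induction_on with
  | zero => rw [map_zero]; exact zero_mem _
  | tmul x t =>
    rw [koszulLiftD_tmul]
    exact add_mem (tmul_mem_augSpan (gkD_mem_augSpan x) t)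
      (Submodule.smul_mem _ _ (rTensor_mem_augSpan h.apply_mem_augSpan _))
  | add x y hx hy => rw [map_add]; exact add_mem hx hy

/-- The projection of `N ⊗ T(C)` onto `N ⊗ 1`. -/
def tensorAug (N C : Type*) [AddCommGroup N] [Module k N] [Module R N]
    [IsScalarTower k R N] [AddCommGroup C] [Module k C] : N ⊗[k] TensorAlgebra k C →ₗ[R] N :=
  (TensorProduct.AlgebraTensorModule.rid k R N).toLinearMap ∘ₗ
    TensorProduct.AlgebraTensorModule.lTensor R N TensorAlgebra.algebraMapInv.toLinearMap

theorem tensorAug_tmul {N C : Type*} [AddCommGroup N] [Module k N] [Module R N]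
    [IsScalarTower k R N] [AddCommGroup C] [Module k C] (x : N) (t : TensorAlgebra k C) :
    tensorAug (R := R) N C (x ⊗ₜ t) = TensorAlgebra.algebraMapInv t • x := by
  simp [tensorAug]

theorem algebraMapInv_of_mem_tensorPiece {C : Type*} [AddCommGroup C] [Module k C]
    {𝒞 : ℕ × ℕ → Submodule k C} {q : ℕ × ℕ} (hq : q ≠ 0) {t : TensorAlgebra k C}
    (ht : t ∈ tensorPiece 𝒞 q) : TensorAlgebra.algebraMapInv t = 0 := by
  refine tensorPiece_induction (P := fun q t => q ≠ 0 → TensorAlgebra.algebraMapInv t = 0)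
    ?_ ?_ ?_ ?_ ?_ ht hq
  · exact fun h => absurd rfl h
  · intro p q c t _ _ _ _
    simp [TensorAlgebra.algebraMapInv]
  · simp
  · intro p t t' h h' hp
    rw [map_add, h hp, h' hp, add_zero]
  · intro p a t h hp
    rw [map_smul, h hp, smul_zero]

theorem gkAug_tensorAug_mem {n j : ℕ} (hnj : (n, j) ≠ (0, 0))
    {y : GKoszul 𝓡 ⊗[k] TensorAlgebra k C} (hy : y ∈ koszulLiftPiece 𝓡 𝒞 n j) :
    gkAug 𝓡 (tensorAug (R := R) (GKoszul 𝓡) C y) ∈ augIdeal 𝓡 := by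
  have : koszulLiftPiece 𝓡 𝒞 n j ≤ ((augIdeal 𝓡).restrictScalars k).comap
      ((gkAug 𝓡 ∘ₗ tensorAug (R := R) (GKoszul 𝓡) C).restrictScalars k) := by
    refine koszulLiftPiece_le fun p q hpq x hx t ht => ?_
    change gkAug 𝓡 (tensorAug (R := R) (GKoszul 𝓡) C (x ⊗ₜ[k] t)) ∈ augIdeal 𝓡
    rw [tensorAug_tmul]
    by_cases hq : q = 0
    · subst hq
      rw [add_zero] at hpq
      subst hpq
      rw [← algebraMap_smul R, map_smul]
      refine Submodule.smul_mem _ _ ?_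
      match n with
      | 0 =>
        have h := gkBideg_add 𝓡 0 j
        rw [add_zero] at h
        rw [h] at hx
        exact mem_augIdeal_of_mem (fun h => hnj (by rw [h])) (gkAug_mem_of_mem_gkPiece hx)
      | n + 1 =>
        rw [gkAug_eq_zero_of_mem_gkPos (gkBideg_succ_le_gkPos 𝓡 n j hx)]
        exact zero_mem _
    · rw [algebraMapInv_of_mem_tensorPiece hq ht, zero_smul, map_zero]
      exact zero_mem _
  exact this hy

theorem map_mem_augIdeal_of_mem_augSpan {N : Type*} [AddCommMonoid N] [Module R N] (f : N →ₗ[R] R)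
    (hI : ∀ a ∈ augIdeal 𝓡, ∀ r, a * r ∈ augIdeal 𝓡) {x : N} (hx : x ∈ augSpan 𝓡 N) :
    f x ∈ augIdeal 𝓡 := by
  have : augSpan 𝓡 N ≤ Submodule.comap f (augIdeal 𝓡) := by
    refine Submodule.span_le.2 ?_
    rintro _ ⟨a, ha, w, rfl⟩
    change f (a • w) ∈ augIdeal 𝓡
    rw [LinearMap.map_smul]
    exact hI a ha _
  exact this hx

theorem mul_mem_augIdeal {a : R} (ha : a ∈ augIdeal 𝓡) (r : R) : a * r ∈ augIdeal 𝓡 := by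
  have h : ∀ x : R, x ∈ augIdeal 𝓡 ↔ GradedRing.proj 𝓡 0 x = 0 := fun x =>
    HomogeneousIdeal.mem_irrelevant_iff 𝓡 x
  have hm : ∀ x y : R, GradedRing.proj 𝓡 0 (x * y) =
      GradedRing.proj 𝓡 0 x * GradedRing.proj 𝓡 0 y := fun x y =>
    map_mul (GradedRing.projZeroRingHom 𝓡) x y
  rw [h] at ha ⊢
  rw [hm, ha, zero_mul]

/-- A minimal complex of free modules whose homology is spanned by the class of an element `e`
of bidegree `(0, 0)` is a minimal resolution of `k`, if `e` is detected by a linear form. -/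
theorem isMinimalFreeResolution_of_forall_exists {Y : Type*} [AddCommGroup Y] [Module k Y]
    [Module R Y] [IsScalarTower k R Y] (hR : IsStandardGraded 𝓡) {𝒴 : ℕ → ℕ → Submodule k Y}
    {d : Y →ₗ[R] Y} (hint : DirectSum.IsInternal fun p : ℕ × ℕ => 𝒴 p.1 p.2)
    (hsmul : ∀ i n j, ∀ r ∈ 𝓡 i, ∀ y ∈ 𝒴 n j, r • y ∈ 𝒴 n (i + j))
    (hfree : ∃ b : Set Y, LinearIndependent R (Subtype.val : b → Y) ∧ Submodule.span R b = ⊤ ∧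
      ∀ y ∈ b, ∃ n j, y ∈ 𝒴 n j)
    (hd : ∀ n j, ∀ y ∈ 𝒴 (n + 1) j, d y ∈ 𝒴 n j) (hd0 : ∀ j, ∀ y ∈ 𝒴 0 j, d y = 0)
    (hdd : ∀ y, d (d y) = 0) (hmin : ∀ y, d y ∈ augSpan 𝓡 Y)
    {e : Y} (he : e ∈ 𝒴 0 0) (hex : ∀ y, d y = 0 → ∃ z, ∃ a : k, y = d z + a • e)
    {φ : Y →ₗ[R] R} (hφe : φ e = 1)
    (hφ : ∀ n j, (n, j) ≠ (0, 0) → ∀ y ∈ 𝒴 n j, φ y ∈ augIdeal 𝓡) :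
    IsMinimalFreeResolution 𝓡 𝒴 d := by
  obtain ⟨ε, hε⟩ := hR.exists_isAugmentation
  obtain ⟨hex1, hex0⟩ := hint.exact_of_forall_exists (d := d.restrictScalars k) hd hd0 he hex
  have hdz : ∀ z, φ (d z) ∈ augIdeal 𝓡 := fun z =>
    map_mem_augIdeal_of_mem_augSpan φ (fun a ha r => mul_mem_augIdeal ha r) (hmin z)
  refine ⟨hint, hsmul, hfree, hd, hd0, hdd, hex1, ⟨(augIdeal 𝓡).mkQ ∘ₗ φ, ?_, ?_, ?_⟩, hmin⟩
  · intro q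
    obtain ⟨r, rfl⟩ := Submodule.mkQ_surjective _ q
    exact ⟨r • e, by rw [LinearMap.comp_apply, map_smul, hφe, smul_eq_mul, mul_one]⟩
  · intro n j hnj y hy
    exact (Submodule.Quotient.mk_eq_zero _).2 (hφ n j hnj y hy)
  · intro y hy
    constructor
    · intro hy0
      have hy0' : φ y ∈ augIdeal 𝓡 := (Submodule.Quotient.mk_eq_zero _).1 hy0
      obtain ⟨z, hz, a, rfl⟩ := hex0 y hy
      refine ⟨z, hz, ?_⟩
      have ha : a = 0 := by
        have h1 : φ (a • e) = algebraMap k R a := by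
          rw [← algebraMap_smul R, map_smul, hφe, smul_eq_mul, mul_one]
        rw [map_add, h1] at hy0'
        have h2 := (Submodule.add_mem_iff_right _ (hdz z)).1 hy0'
        rwa [hε.mem_augIdeal_iff hR, hε.map_algebraMap] at h2
      rw [ha, zero_smul, add_zero]
      rfl
    · rintro ⟨z, -, rfl⟩
      exact (Submodule.Quotient.mk_eq_zero _).2 (hdz z)

theorem gkOne_tmul_one_mem :
    gkOne 𝓡 ⊗ₜ[k] (1 : TensorAlgebra k C) ∈ koszulLiftPiece 𝓡 𝒞 0 0 := by
  refine tmul_mem_koszulLiftPiece (p := (0, 0 + 0)) (q := 0) rfl ?_ one_mem_tensorPiece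
  rw [gkBideg_add]
  exact tmul_mem_gkPiece 𝓡 SetLike.GradedOne.one_mem (koszulOne_mem 𝓡)

omit [GradedAlgebra 𝓡] in
theorem gkAug_tensorAug_gkOne :
    gkAug 𝓡 (tensorAug (R := R) (GKoszul 𝓡) C (gkOne 𝓡 ⊗ₜ[k] 1)) = 1 := by
  rw [tensorAug_tmul, map_one, one_smul]
  simp [gkOne, koszulOne]

theorem IsKoszulLift.isMinimalFreeResolution (h : IsKoszulLift 𝒞 β) (hR : IsStandardGraded 𝓡)
    (hR3 : 𝓡 3 = ⊥) :
    IsMinimalFreeResolution 𝓡 (koszulLiftPiece 𝓡 𝒞) (koszulLiftD β) := by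
  apply isMinimalFreeResolution_of_forall_exists (k := k) (Y := GKoszul 𝓡 ⊗[k] TensorAlgebra k C)
    (𝒴 := koszulLiftPiece 𝓡 𝒞) (d := koszulLiftD β) hR (e := gkOne 𝓡 ⊗ₜ[k] 1)
    (φ := gkAug 𝓡 ∘ₗ tensorAug (R := R) (GKoszul 𝓡) C)
  · exact koszulLiftPiece_isInternal (𝓡 := 𝓡) h.isInternal
  · exact smul_mem_koszulLiftPiece
  · exact koszulLift_free h.isInternal
  · exact koszulLiftD_mem h hR hR3
  · exact koszulLiftD_eq_zero h hR hR3
  · exact koszulLiftD_koszulLiftD h hR hR3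
  · exact koszulLiftD_mem_augSpan h
  · exact gkOne_tmul_one_mem
  · exact fun y hy => exists_of_koszulLiftD_eq_zero h hR hR3 hy
  · exact gkAug_tensorAug_gkOne
  · exact fun n j hnj y hy => gkAug_tensorAug_mem hnj hy

theorem IsKoszulSection.isMinimalFreeResolution (hR : IsStandardGraded 𝓡)
    (hR3 : 𝓡 3 = ⊥) {α : KoszulC 𝓡 →ₗ[k] gkCycles 𝓡} (hα : IsKoszulSection 𝓡 α) :
    IsMinimalFreeResolution 𝓡 (koszulYPiece 𝓡) (koszulYD 𝓡 α) :=
  (hα.isKoszulLift hR hR3).isMinimalFreeResolution hR hR3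

end MinimalResolution

/-! ### The bar resolution -/

section BarResolution

variable {k R : Type*} [Field k] [Ring R] [Algebra k R] (𝓡 : ℕ → Submodule k R) [GradedAlgebra 𝓡]

@[simp] theorem barMulHead_tmul (a b : augPart 𝓡) (t : BarSpace 𝓡) :
    barMulHead 𝓡 a (b ⊗ₜ t) = TensorAlgebra.ι k (augMul 𝓡 a b) * t := by
  simp [barMulHead]

theorem barD_ι_mul (a : augPart 𝓡) (t : BarSpace 𝓡) :
    barD 𝓡 (TensorAlgebra.ι k a * t) =
      barMulHead 𝓡 a (headSplit t) - TensorAlgebra.ι k a * barD 𝓡 t := by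
  have h' := barD_aux 𝓡 (TensorAlgebra.ι k a * t)
  rw [map_mul, Module.End.mul_apply, barD_aux 𝓡 t] at h'
  refine (congrArg (fun p => p.2.2) h').symm.trans ?_
  simp [barAux]

theorem barMulHead_barMulHead (a b : augPart 𝓡) (w : augPart 𝓡 ⊗[k] BarSpace 𝓡) :
    barMulHead 𝓡 a (headSplit (barMulHead 𝓡 b w)) = barMulHead 𝓡 (augMul 𝓡 a b) w := by
  induction w using TensorProduct.induction_on with
  | zero => simp
  | tmul c t =>
    rw [barMulHead_tmul, headSplit_ι_mul, barMulHead_tmul, barMulHead_tmul]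
    congr 2
    exact Subtype.ext (mul_assoc a.1 b.1 c.1).symm
  | add x y hx hy => rw [map_add, map_add, map_add, map_add, hx, hy]

theorem barD_barMulHead (a : augPart 𝓡) (t : BarSpace 𝓡) :
    barD 𝓡 (barMulHead 𝓡 a (headSplit t)) = barMulHead 𝓡 a (headSplit (barD 𝓡 t)) := by
  induction t using TensorAlgebra.left_induction with
  | one => simp
  | mul b t _ =>
    rw [headSplit_ι_mul, barMulHead_tmul, barD_ι_mul, barD_ι_mul, map_sub, map_sub,
      headSplit_ι_mul, barMulHead_barMulHead, barMulHead_tmul]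
  | add s t hs ht => simp only [map_add, hs, ht]
  | smul c t ht => simp only [map_smul, ht]

theorem barD_barD (t : BarSpace 𝓡) : barD 𝓡 (barD 𝓡 t) = 0 := by
  induction t using TensorAlgebra.left_induction with
  | one => simp
  | mul a t ih =>
    rw [barD_ι_mul, map_sub, barD_barMulHead, barD_ι_mul, ih, mul_zero, sub_zero, sub_self]
  | add s t hs ht => rw [map_add, map_add, hs, ht, add_zero]
  | smul c t ht => rw [map_smul, map_smul, ht, smul_zero]

/-- The differential `r ⊗ a t ↦ r a ⊗ t - r ⊗ d(a t)` of the bar resolution `R ⊗ T(R_+)`. -/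
def barResD : R ⊗[k] BarSpace 𝓡 →ₗ[R] R ⊗[k] BarSpace 𝓡 :=
  headD (augPart 𝓡).subtype - TensorProduct.AlgebraTensorModule.lTensor R R (barD 𝓡)

theorem barResD_tmul (r : R) (t : BarSpace 𝓡) :
    barResD 𝓡 (r ⊗ₜ t) = r • LinearMap.rTensor (BarSpace 𝓡) (augPart 𝓡).subtype (headSplit t) -
      r ⊗ₜ barD 𝓡 t := by
  simp [barResD, headD_tmul]

theorem rTensor_headSplit_barMulHead (a : augPart 𝓡) (w : augPart 𝓡 ⊗[k] BarSpace 𝓡) :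
    LinearMap.rTensor (BarSpace 𝓡) (augPart 𝓡).subtype (headSplit (barMulHead 𝓡 a w)) =
      a.1 • LinearMap.rTensor (BarSpace 𝓡) (augPart 𝓡).subtype w := by
  induction w using TensorProduct.induction_on with
  | zero => simp
  | tmul c t =>
    rw [barMulHead_tmul, headSplit_ι_mul, LinearMap.rTensor_tmul, LinearMap.rTensor_tmul,
      TensorProduct.smul_tmul']
    rfl
  | add x y hx hy => simp only [map_add, hx, hy, smul_add]

theorem barResD_barResD (z : R ⊗[k] BarSpace 𝓡) : barResD 𝓡 (barResD 𝓡 z) = 0 := by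
  have key : ∀ t : BarSpace 𝓡, barResD 𝓡 (barResD 𝓡 (1 ⊗ₜ t)) = 0 := by
    intro t
    induction t using TensorAlgebra.left_induction with
    | one => simp [barResD_tmul]
    | mul a t ih =>
      rw [barResD_tmul, map_sub, one_smul, headSplit_ι_mul, LinearMap.rTensor_tmul, barResD_tmul,
        barResD_tmul, barD_barD, one_smul, TensorProduct.tmul_zero, sub_zero, barD_ι_mul,
        map_sub, map_sub, rTensor_headSplit_barMulHead, headSplit_ι_mul, LinearMap.rTensor_tmul,
        Submodule.subtype_apply]
      abel
    | add s t hs ht => rw [TensorProduct.tmul_add, map_add, map_add, hs, ht, add_zero]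
    | smul c t ht =>
      rw [TensorProduct.tmul_smul, LinearMap.map_smul_of_tower, LinearMap.map_smul_of_tower, ht,
        smul_zero]
  induction z using TensorProduct.induction_on with
  | zero => simp
  | tmul r t =>
    have : r ⊗ₜ[k] t = r • ((1 : R) ⊗ₜ[k] t) := by
      rw [TensorProduct.smul_tmul', smul_eq_mul, mul_one]
    rw [this, map_smul, map_smul, key, smul_zero]
  | add x y hx hy => rw [map_add, map_add, hx, hy, add_zero]

variable {𝓡}

/-- The projection `R → R_+`, `r ↦ r - ε(r)`. -/
def augProj {ε : R →ₗ[k] k} (hε : IsAugmentation 𝓡 ε) (hR : IsStandardGraded 𝓡) :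
    R →ₗ[k] augPart 𝓡 :=
  (LinearMap.id - Algebra.linearMap k R ∘ₗ ε).codRestrict (augPart 𝓡) fun r =>
    (hε.mem_augIdeal_iff hR).2 (by simp [hε.map_algebraMap])

theorem augProj_coe {ε : R →ₗ[k] k} (hε : IsAugmentation 𝓡 ε) (hR : IsStandardGraded 𝓡) (r : R) :
    (augProj hε hR r : R) = r - algebraMap k R (ε r) :=
  rfl

theorem augProj_of_eq_zero {ε : R →ₗ[k] k} (hε : IsAugmentation 𝓡 ε) (hR : IsStandardGraded 𝓡)
    {r : R} (hr : ε r = 0) : (augProj hε hR r : R) = r := by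
  rw [augProj_coe, hr, map_zero, sub_zero]

theorem augProj_mul {ε : R →ₗ[k] k} (hε : IsAugmentation 𝓡 ε) (hR : IsStandardGraded 𝓡) (r : R)
    (a : augPart 𝓡) : augProj hε hR (r * a) = augMul 𝓡 (augProj hε hR r) a + ε r • a := by
  have ha : ε (r * a) = 0 := (hε.mem_augIdeal_iff hR).1 ((augIdeal 𝓡).mul_mem_left r a.2)
  refine Subtype.ext ?_
  rw [augProj_of_eq_zero hε hR ha]
  have : ((augMul 𝓡 (augProj hε hR r) a + ε r • a : augPart 𝓡) : R) =
      (augProj hε hR r : R) * a + ε r • (a : R) := rfl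
  rw [this, augProj_coe, sub_mul, Algebra.smul_def, sub_add_cancel]

/-- The contracting homotopy of the bar resolution. -/
def barContr {ε : R →ₗ[k] k} (hε : IsAugmentation 𝓡 ε) (hR : IsStandardGraded 𝓡) :
    R ⊗[k] BarSpace 𝓡 →ₗ[k] R ⊗[k] BarSpace 𝓡 :=
  TensorProduct.mk k R (BarSpace 𝓡) 1 ∘ₗ headJoin ∘ₗ LinearMap.rTensor _ (augProj hε hR)

theorem barContr_tmul {ε : R →ₗ[k] k} (hε : IsAugmentation 𝓡 ε) (hR : IsStandardGraded 𝓡) (r : R)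
    (t : BarSpace 𝓡) :
    barContr hε hR (r ⊗ₜ t) = 1 ⊗ₜ (TensorAlgebra.ι k (augProj hε hR r) * t) := by
  simp [barContr]

/-- The augmentation `R ⊗ T(R_+) → k` of the bar resolution. -/
def barEps (ε : R →ₗ[k] k) : R ⊗[k] BarSpace 𝓡 →ₗ[k] k :=
  LinearMap.mul' k k ∘ₗ TensorProduct.map ε TensorAlgebra.algebraMapInv.toLinearMap

theorem barEps_tmul (ε : R →ₗ[k] k) (r : R) (t : BarSpace 𝓡) :
    barEps ε (r ⊗ₜ t) = ε r * TensorAlgebra.algebraMapInv t := by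
  simp [barEps]

theorem barContr_smul_rTensor {ε : R →ₗ[k] k} (hε : IsAugmentation 𝓡 ε)
    (hR : IsStandardGraded 𝓡) (r : R) (w : augPart 𝓡 ⊗[k] BarSpace 𝓡) :
    barContr hε hR (r • LinearMap.rTensor _ (augPart 𝓡).subtype w) =
      1 ⊗ₜ barMulHead 𝓡 (augProj hε hR r) w + ε r • (1 ⊗ₜ headJoin w) := by
  induction w using TensorProduct.induction_on with
  | zero => simp
  | tmul a t =>
    rw [LinearMap.rTensor_tmul, TensorProduct.smul_tmul', barContr_tmul, smul_eq_mul,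
      Submodule.subtype_apply, augProj_mul, map_add, add_mul, TensorProduct.tmul_add,
      barMulHead_tmul, headJoin_tmul, map_smul, smul_mul_assoc, TensorProduct.tmul_smul]
  | add x y hx hy =>
    rw [map_add, smul_add, map_add, hx, hy, map_add, map_add, TensorProduct.tmul_add,
      TensorProduct.tmul_add, smul_add]
    abel

theorem barContr_homotopy {ε : R →ₗ[k] k} (hε : IsAugmentation 𝓡 ε) (hR : IsStandardGraded 𝓡)
    (z : R ⊗[k] BarSpace 𝓡) :
    barResD 𝓡 (barContr hε hR z) + barContr hε hR (barResD 𝓡 z) + barEps ε z • (1 ⊗ₜ 1) = z := by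
  induction z using TensorProduct.induction_on with
  | zero => simp
  | tmul r t =>
    have h1 : r ⊗ₜ[k] t = (augProj hε hR r : R) ⊗ₜ[k] t + ε r • ((1 : R) ⊗ₜ[k] t) := by
      rw [augProj_coe, Algebra.algebraMap_eq_smul_one, TensorProduct.sub_tmul,
        TensorProduct.smul_tmul']
      abel
    have h2 : (1 : R) ⊗ₜ[k] t = 1 ⊗ₜ headJoin (headSplit t) +
        TensorAlgebra.algebraMapInv t • (1 ⊗ₜ 1) := by
      conv_lhs => rw [← headJoin_headSplit t]
      rw [TensorProduct.tmul_add, Algebra.algebraMap_eq_smul_one, TensorProduct.tmul_smul]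
    rw [barContr_tmul, barResD_tmul, barResD_tmul, map_sub, barContr_smul_rTensor, barContr_tmul,
      one_smul, headSplit_ι_mul, barD_ι_mul, barEps_tmul, TensorProduct.tmul_sub,
      LinearMap.rTensor_tmul, Submodule.subtype_apply, h1, mul_smul]
    conv_rhs => rw [h2, smul_add]
    abel
  | add x y hx hy =>
    conv_rhs => rw [← hx, ← hy]
    simp only [map_add, add_smul]
    abel

theorem barEps_barResD {ε : R →ₗ[k] k} (hε : IsAugmentation 𝓡 ε) (hR : IsStandardGraded 𝓡)
    (z : R ⊗[k] BarSpace 𝓡) : barEps ε (barResD 𝓡 z) = 0 := by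
  have h1 : ∀ (r : R) (w : augPart 𝓡 ⊗[k] BarSpace 𝓡),
      barEps ε (r • LinearMap.rTensor _ (augPart 𝓡).subtype w) = 0 := by
    intro r w
    induction w using TensorProduct.induction_on with
    | zero => simp
    | tmul a t =>
      rw [LinearMap.rTensor_tmul, TensorProduct.smul_tmul', barEps_tmul, smul_eq_mul,
        Submodule.subtype_apply, (hε.mem_augIdeal_iff hR).1 ((augIdeal 𝓡).mul_mem_left r a.2),
        zero_mul]
    | add x y hx hy => rw [map_add, smul_add, map_add, hx, hy, add_zero]
  have h2 : ∀ t : BarSpace 𝓡, TensorAlgebra.algebraMapInv (barD 𝓡 t) = 0 := by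
    intro t
    have h3 : ∀ (a : augPart 𝓡) (s : BarSpace 𝓡),
        TensorAlgebra.algebraMapInv (TensorAlgebra.ι k a * s) = 0 := fun a s => by
      simp [TensorAlgebra.algebraMapInv]
    have h4 : ∀ (a : augPart 𝓡) (w : augPart 𝓡 ⊗[k] BarSpace 𝓡),
        TensorAlgebra.algebraMapInv (barMulHead 𝓡 a w) = 0 := by
      intro a w
      induction w using TensorProduct.induction_on with
      | zero => simp
      | tmul b t => rw [barMulHead_tmul, h3]
      | add x y hx hy => rw [map_add, map_add, hx, hy, add_zero]
    induction t using TensorAlgebra.left_induction with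
    | one => simp
    | mul a t _ => rw [barD_ι_mul, map_sub, h4, h3, sub_zero]
    | add s t hs ht => rw [map_add, map_add, hs, ht, add_zero]
    | smul c t ht => rw [map_smul, map_smul, ht, smul_zero]
  induction z using TensorProduct.induction_on with
  | zero => simp
  | tmul r t => rw [barResD_tmul, map_sub, h1, barEps_tmul, h2, mul_zero, sub_zero]
  | add x y hx hy => rw [map_add, map_add, hx, hy, add_zero]

end BarResolution

/-! ### The comparison map from `K ⊗ T(C)` to the bar construction -/

section Comparison

variable {k R : Type*} [Field k] [Ring R] [Algebra k R] (𝓡 : ℕ → Submodule k R) [GradedAlgebra 𝓡]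

/-- The inclusion `R_1 ⊆ R_+`. -/
def augIncl : 𝓡 1 →ₗ[k] augPart 𝓡 :=
  Submodule.inclusion fun _ hr => mem_augIdeal_of_mem one_ne_zero hr

/-- The inclusion `T(R_1) ⊆ T(R_+)`. -/
def barIncl : TensorAlgebra k (𝓡 1) →ₐ[k] BarSpace 𝓡 :=
  TensorAlgebra.lift k (TensorAlgebra.ι k ∘ₗ augIncl 𝓡)

@[simp] theorem barIncl_ι (v : 𝓡 1) :
    barIncl 𝓡 (TensorAlgebra.ι k v) = TensorAlgebra.ι k (augIncl 𝓡 v) := by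
  simp [barIncl]

variable {𝓡}

/-- The map `s ↦ m(s x)` on `T(R_1)`, where `m` multiplies the first two letters, kills the right
ideal generated by the quadratic relations. -/
theorem barMulHead_quadRel {q : TensorAlgebra k (𝓡 1)} (hq : q ∈ quadRel 𝓡)
    (s : TensorAlgebra k (𝓡 1)) (x : BarSpace 𝓡) :
    TensorProduct.lift (barMulHead 𝓡 ∘ₗ augIncl 𝓡) (LinearMap.lTensor (𝓡 1)
      (headSplit ∘ₗ LinearMap.mulRight k x ∘ₗ (barIncl 𝓡).toLinearMap) (headSplit (q * s))) =
        0 := by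
  -- the first two letters of `q` are multiplied
  have key : ∀ q ∈ tensorGen 𝓡 ^ 2, ∃ a : augPart 𝓡,
      a.1 = TensorAlgebra.lift k (𝓡 1).subtype q ∧
      TensorProduct.lift (barMulHead 𝓡 ∘ₗ augIncl 𝓡) (LinearMap.lTensor (𝓡 1)
        (headSplit ∘ₗ LinearMap.mulRight k x ∘ₗ (barIncl 𝓡).toLinearMap) (headSplit (q * s))) =
      TensorAlgebra.ι k a * (barIncl 𝓡 s * x) := by
    intro q hq
    rw [pow_two] at hq
    induction hq using Submodule.mul_induction_on' with
    | mem_mul_mem m hm n hn =>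
      obtain ⟨v, rfl⟩ := hm
      obtain ⟨w, rfl⟩ := hn
      refine ⟨augMul 𝓡 (augIncl 𝓡 v) (augIncl 𝓡 w), ?_, ?_⟩
      · rw [map_mul, TensorAlgebra.lift_ι_apply, TensorAlgebra.lift_ι_apply]
        rfl
      · rw [mul_assoc, headSplit_ι_mul, LinearMap.lTensor_tmul, TensorProduct.lift.tmul]
        simp [mul_assoc]
    | add a _ b _ ha hb =>
      obtain ⟨c, hc, hc'⟩ := ha
      obtain ⟨d, hd, hd'⟩ := hb
      refine ⟨c + d, ?_, ?_⟩
      · rw [map_add, ← hc, ← hd]; rfl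
      · rw [add_mul, map_add, map_add, map_add, hc', hd', map_add, add_mul]
  obtain ⟨a, ha, ha'⟩ := key q hq.1
  have h0 : TensorAlgebra.lift k (𝓡 1).subtype q = 0 := hq.2
  rw [ha', Subtype.ext (ha.trans h0 : a.1 = (0 : augPart 𝓡).1), map_zero, zero_mul]

/-- If `x` is a cycle of the bar construction whose first letter is killed by `R_1`, then all the
products `κ x` with `κ ∈ K` are cycles. -/
theorem barD_barIncl_mul {x : BarSpace 𝓡} (h1 : ∀ v, barMulHead 𝓡 (augIncl 𝓡 v) (headSplit x) = 0)
    (h2 : barD 𝓡 x = 0) : ∀ n, ∀ κ ∈ koszulK 𝓡 n, barD 𝓡 (barIncl 𝓡 κ * x) = 0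
  | 0, κ, hκ => by
    obtain ⟨a, rfl⟩ := Submodule.mem_one.1 hκ
    rw [AlgHom.commutes, ← Algebra.smul_def, map_smul, h2, smul_zero]
  | 1, κ, hκ => by
    obtain ⟨v, rfl⟩ := hκ
    rw [barIncl_ι, barD_ι_mul, h1, h2, mul_zero, sub_zero]
  | n + 2, κ, hκ => by
    have ih := barD_barIncl_mul h1 h2 (n + 1)
    have h3 : barD 𝓡 (barIncl 𝓡 κ * x) =
        TensorProduct.lift (barMulHead 𝓡 ∘ₗ augIncl 𝓡) (LinearMap.lTensor (𝓡 1)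
          (headSplit ∘ₗ LinearMap.mulRight k x ∘ₗ (barIncl 𝓡).toLinearMap) (headSplit κ)) := by
      have hκ' := koszulK_succ_le 𝓡 (n + 1) hκ
      clear hκ
      induction hκ' using Submodule.mul_induction_on' with
      | mem_mul_mem m hm κ hκ =>
        obtain ⟨v, rfl⟩ := hm
        rw [map_mul (barIncl 𝓡), barIncl_ι, mul_assoc, barD_ι_mul, ih κ hκ, headSplit_ι_mul,
          LinearMap.lTensor_tmul, TensorProduct.lift.tmul, mul_zero, sub_zero]
        rfl
      | add a _ b _ ha hb => rw [map_add, add_mul, map_add, ha, hb, map_add, map_add, map_add]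
    rw [h3]
    have hκ' := koszulK_le_quadRel_mul 𝓡 n hκ
    clear hκ h3
    induction hκ' using Submodule.mul_induction_on' with
    | mem_mul_mem q hq s _ => exact barMulHead_quadRel hq s x
    | add a _ b _ ha hb => rw [map_add, map_add, map_add, ha, hb, add_zero]

/-- The map `r ⊗ κ ↦ r κ` from `GK_R` to `T(R_+)`, where `r ∈ R` is projected to `R_+`. -/
def gkToBar {ε : R →ₗ[k] k} (hε : IsAugmentation 𝓡 ε) (hR : IsStandardGraded 𝓡) :
    GKoszul 𝓡 →ₗ[k] BarSpace 𝓡 :=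
  headJoin ∘ₗ TensorProduct.map (augProj hε hR) ((barIncl 𝓡).toLinearMap ∘ₗ (koszulTotal 𝓡).subtype)

theorem gkToBar_tmul {ε : R →ₗ[k] k} (hε : IsAugmentation 𝓡 ε) (hR : IsStandardGraded 𝓡) (r : R)
    (κ : koszulTotal 𝓡) :
    gkToBar hε hR (r ⊗ₜ κ) = TensorAlgebra.ι k (augProj hε hR r) * barIncl 𝓡 κ := by
  simp [gkToBar]

variable {C : Type*} [AddCommGroup C] [Module k C] {𝒞 : ℕ × ℕ → Submodule k C}
  {β : C →ₗ[k] GKoszul 𝓡}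

/-- The algebra map `γ : T(C) → T(R_+)` with `γ(c) = ∑ r κ` if `β(c) = ∑ r ⊗ κ`. -/
def barGamma (β : C →ₗ[k] GKoszul 𝓡) {ε : R →ₗ[k] k} (hε : IsAugmentation 𝓡 ε)
    (hR : IsStandardGraded 𝓡) : TensorAlgebra k C →ₐ[k] BarSpace 𝓡 :=
  TensorAlgebra.lift k (gkToBar hε hR ∘ₗ β)

theorem barGamma_ι_mul {ε : R →ₗ[k] k} (hε : IsAugmentation 𝓡 ε) (hR : IsStandardGraded 𝓡) (c : C)
    (t : TensorAlgebra k C) : barGamma β hε hR (TensorAlgebra.ι k c * t) =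
      gkToBar hε hR (β c) * barGamma β hε hR t := by
  simp [barGamma]

theorem augMul_eq_zero (hR : IsStandardGraded 𝓡) (hR3 : 𝓡 3 = ⊥) {i j : ℕ} (hij : 3 ≤ i + j)
    {a b : augPart 𝓡} (ha : a.1 ∈ 𝓡 i) (hb : b.1 ∈ 𝓡 j) : augMul 𝓡 a b = 0 := by
  have h : a.1 * b.1 ∈ 𝓡 (i + j) := SetLike.GradedMul.mul_mem ha hb
  rw [hR.eq_bot hR3 hij, Submodule.mem_bot] at h
  exact Subtype.ext h

/-- The products `(∑ r κ) x` with `∑ r ⊗ κ ∈ R_2 ⊗ K_{n+1}` are cycles if the products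
`κ x` are. -/
theorem barD_gkToBar_mul (hR3 : 𝓡 3 = ⊥) {ε : R →ₗ[k] k} (hε : IsAugmentation 𝓡 ε)
    (hR : IsStandardGraded 𝓡) {x : BarSpace 𝓡}
    (hx : ∀ n, ∀ κ ∈ koszulK 𝓡 n, barD 𝓡 (barIncl 𝓡 κ * x) = 0) {n : ℕ} {z : GKoszul 𝓡}
    (hz : z ∈ gkPiece 𝓡 2 (n + 1)) :
    (∀ v, barMulHead 𝓡 (augIncl 𝓡 v) (headSplit (gkToBar hε hR z * x)) = 0) ∧
      barD 𝓡 (gkToBar hε hR z * x) = 0 := by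
  have h1 : gkPiece 𝓡 2 (n + 1) ≤ LinearMap.ker
      (barD 𝓡 ∘ₗ LinearMap.mulRight k x ∘ₗ gkToBar hε hR) := by
    refine gkPiece_le 𝓡 fun r hr κ hκ => ?_
    have hr' : (augProj hε hR r).1 ∈ 𝓡 2 := by
      rwa [augProj_of_eq_zero hε hR (hε.map_succ 1 r hr)]
    change barD 𝓡 (gkToBar hε hR (r ⊗ₜ[k] κ) * x) = 0
    rw [gkToBar_tmul, mul_assoc, barD_ι_mul, hx (n + 1) κ.1 hκ, mul_zero, sub_zero]
    have hκ' : (κ : TensorAlgebra k (𝓡 1)) ∈ tensorGen 𝓡 * koszulK 𝓡 n := koszulK_succ_le 𝓡 n hκ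
    generalize (κ : TensorAlgebra k (𝓡 1)) = s at hκ'
    induction hκ' using Submodule.mul_induction_on' with
    | mem_mul_mem m hm s _ =>
      obtain ⟨v, rfl⟩ := hm
      rw [map_mul (barIncl 𝓡), barIncl_ι, mul_assoc, headSplit_ι_mul, barMulHead_tmul,
        augMul_eq_zero hR hR3 (i := 2) (j := 1) le_rfl hr' v.2, map_zero, zero_mul]
    | add a _ b _ ha hb => rw [map_add, add_mul, map_add, map_add, ha, hb, add_zero]
  have h2 : ∀ v, gkPiece 𝓡 2 (n + 1) ≤ LinearMap.ker
      (barMulHead 𝓡 (augIncl 𝓡 v) ∘ₗ headSplit ∘ₗ LinearMap.mulRight k x ∘ₗ gkToBar hε hR) := by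
    refine fun v => gkPiece_le 𝓡 fun r hr κ hκ => ?_
    have hr' : (augProj hε hR r).1 ∈ 𝓡 2 := by
      rwa [augProj_of_eq_zero hε hR (hε.map_succ 1 r hr)]
    change barMulHead 𝓡 (augIncl 𝓡 v) (headSplit (gkToBar hε hR (r ⊗ₜ[k] κ) * x)) = 0
    rw [gkToBar_tmul, mul_assoc, headSplit_ι_mul, barMulHead_tmul,
      augMul_eq_zero hR hR3 (i := 1) (j := 2) le_rfl v.2 hr', map_zero, zero_mul]
  exact ⟨fun v => h2 v hz, h1 hz⟩

theorem IsKoszulLift.barD_gkToBar_mul (h : IsKoszulLift 𝒞 β) (hR3 : 𝓡 3 = ⊥) {ε : R →ₗ[k] k}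
    (hε : IsAugmentation 𝓡 ε)
    (hR : IsStandardGraded 𝓡) {x : BarSpace 𝓡}
    (hx : ∀ n, ∀ κ ∈ koszulK 𝓡 n, barD 𝓡 (barIncl 𝓡 κ * x) = 0) (c : C) :
    (∀ v, barMulHead 𝓡 (augIncl 𝓡 v) (headSplit (gkToBar hε hR (β c) * x)) = 0) ∧
      barD 𝓡 (gkToBar hε hR (β c) * x) = 0 := by
  refine h.isInternal.induction (P := fun c =>
    (∀ v, barMulHead 𝓡 (augIncl 𝓡 v) (headSplit (gkToBar hε hR (β c) * x)) = 0) ∧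
      barD 𝓡 (gkToBar hε hR (β c) * x) = 0) ?_ ?_ ?_ c
  · intro p c hc
    by_cases hp : ∀ n, p ≠ (n + 2, n + 3)
    · rw [h.eq_bot p hp, Submodule.mem_bot] at hc
      rw [hc, map_zero, map_zero, zero_mul, map_zero, map_zero]
      exact ⟨fun v => by rw [map_zero], rfl⟩
    · push Not at hp
      obtain ⟨n, rfl⟩ := hp
      exact _root_.barD_gkToBar_mul hR3 hε hR hx (h.mem n c hc)
  · rw [map_zero, map_zero, zero_mul, map_zero, map_zero]
    exact ⟨fun v => by rw [map_zero], rfl⟩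
  · rintro c c' ⟨h1, h2⟩ ⟨h3, h4⟩
    rw [map_add, map_add, add_mul, map_add, map_add, h2, h4, add_zero]
    exact ⟨fun v => by rw [map_add, h1, h3, add_zero], rfl⟩

theorem IsKoszulLift.barD_barGamma (h : IsKoszulLift 𝒞 β) (hR3 : 𝓡 3 = ⊥) {ε : R →ₗ[k] k}
    (hε : IsAugmentation 𝓡 ε) (hR : IsStandardGraded 𝓡) (t : TensorAlgebra k C) :
    (∀ v, barMulHead 𝓡 (augIncl 𝓡 v) (headSplit (barGamma β hε hR t)) = 0) ∧
      barD 𝓡 (barGamma β hε hR t) = 0 := by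
  induction t using TensorAlgebra.left_induction with
  | one => simp
  | mul c t ih =>
    rw [barGamma_ι_mul]
    exact h.barD_gkToBar_mul hR3 hε hR (barD_barIncl_mul ih.1 ih.2) c
  | add s t hs ht =>
    rw [map_add, map_add, map_add, hs.2, ht.2, add_zero]
    exact ⟨fun v => by rw [map_add, hs.1, ht.1, add_zero], rfl⟩
  | smul a t ht =>
    rw [map_smul, map_smul, map_smul, ht.2, smul_zero]
    exact ⟨fun v => by rw [map_smul, ht.1, smul_zero], rfl⟩

/-- The chain map `κ ⊗ t ↦ κ γ(t)` from `K ⊗ T(C) = k ⊗_R Y` to the bar construction. -/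
def koszulToBar (β : C →ₗ[k] GKoszul 𝓡) {ε : R →ₗ[k] k} (hε : IsAugmentation 𝓡 ε)
    (hR : IsStandardGraded 𝓡) : koszulTotal 𝓡 ⊗[k] TensorAlgebra k C →ₗ[k] BarSpace 𝓡 :=
  LinearMap.mul' k (BarSpace 𝓡) ∘ₗ TensorProduct.map ((barIncl 𝓡).toLinearMap ∘ₗ
    (koszulTotal 𝓡).subtype) (barGamma β hε hR).toLinearMap

@[simp] theorem koszulToBar_tmul {ε : R →ₗ[k] k} (hε : IsAugmentation 𝓡 ε)
    (hR : IsStandardGraded 𝓡) (κ : koszulTotal 𝓡) (t : TensorAlgebra k C) :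
    koszulToBar β hε hR (κ ⊗ₜ t) = barIncl 𝓡 κ * barGamma β hε hR t := by
  simp [koszulToBar]

theorem IsKoszulLift.barD_koszulToBar (h : IsKoszulLift 𝒞 β) (hR3 : 𝓡 3 = ⊥) {ε : R →ₗ[k] k}
    (hε : IsAugmentation 𝓡 ε) (hR : IsStandardGraded 𝓡)
    (w : koszulTotal 𝓡 ⊗[k] TensorAlgebra k C) : barD 𝓡 (koszulToBar β hε hR w) = 0 := by
  induction w using TensorProduct.induction_on with
  | zero => simp
  | tmul κ t =>
    rw [koszulToBar_tmul]
    refine (koszulPart_isInternal 𝓡).induction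
      (P := fun κ => barD 𝓡 (barIncl 𝓡 κ * barGamma β hε hR t) = 0) ?_ (by simp) ?_ κ
    · intro n κ hκ
      have ht := h.barD_barGamma hR3 hε hR t
      exact barD_barIncl_mul ht.1 ht.2 n κ hκ
    · intro a b ha hb
      rw [Submodule.coe_add, map_add, add_mul, map_add, ha, hb, add_zero]
  | add x y hx hy => rw [map_add, map_add, hx, hy, add_zero]

end Comparison

/-! ### Reducing exact complexes of free modules modulo `R_+` -/

section FreeComplex

variable {k R : Type*} [Field k] [Ring R] [Algebra k R] (𝓡 : ℕ → Submodule k R)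
  {V : Type*} [AddCommGroup V] [Module k V] {𝒱 : ℕ → Submodule k V}

variable (𝒱) in
/-- The subspace `R_i ⊗ V_n` of `R ⊗ V`. -/
abbrev freePiece (i n : ℕ) : Submodule k (R ⊗[k] V) :=
  Submodule.map₂ (TensorProduct.mk k R V) (𝓡 i) (𝒱 n)

variable {𝓡}

theorem tmul_mem_freePiece {i n : ℕ} {r : R} (hr : r ∈ 𝓡 i) {v : V} (hv : v ∈ 𝒱 n) :
    r ⊗ₜ[k] v ∈ freePiece 𝓡 𝒱 i n :=
  Submodule.apply_mem_map₂ (TensorProduct.mk k R V) hr hv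

theorem freePiece_le {i n : ℕ} {S : Submodule k (R ⊗[k] V)}
    (h : ∀ r ∈ 𝓡 i, ∀ v ∈ 𝒱 n, r ⊗ₜ[k] v ∈ S) : freePiece 𝓡 𝒱 i n ≤ S :=
  Submodule.map₂_le.2 h

theorem lTensor_mem_freePiece {V' : Type*} [AddCommGroup V'] [Module k V'] {𝒱' : ℕ → Submodule k V'}
    {f : V →ₗ[k] V'} {i n m : ℕ} (hf : ∀ v ∈ 𝒱 n, f v ∈ 𝒱' m) {z : R ⊗[k] V}
    (hz : z ∈ freePiece 𝓡 𝒱 i n) : LinearMap.lTensor R f z ∈ freePiece 𝓡 𝒱' i m := by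
  have : freePiece 𝓡 𝒱 i n ≤ (freePiece 𝓡 𝒱' i m).comap (LinearMap.lTensor R f) :=
    freePiece_le fun r hr v hv => by
      rw [Submodule.mem_comap, LinearMap.lTensor_tmul]
      exact tmul_mem_freePiece hr (hf v hv)
  exact this hz

/-- Exactness of `f` in degree `n` is preserved by tensoring with `R_i`. -/
theorem exists_lTensor_eq_of_mem_freePiece {f : V →ₗ[k] V} {i n : ℕ}
    (hf : ∀ v ∈ 𝒱 (n + 1), f v ∈ 𝒱 n) (hff : ∀ v, f (f v) = 0)
    (hex : ∀ v ∈ 𝒱 n, f v = 0 → ∃ u ∈ 𝒱 (n + 1), f u = v)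
    {z : R ⊗[k] V} (hz : z ∈ freePiece 𝓡 𝒱 i n) (hfz : LinearMap.lTensor R f z = 0) :
    ∃ y ∈ freePiece 𝓡 𝒱 i (n + 1), LinearMap.lTensor R f y = z := by
  have hr : ∀ m, ∀ z ∈ freePiece 𝓡 𝒱 i m,
      ∃ z', TensorProduct.map (𝓡 i).subtype (𝒱 m).subtype z' = z := by
    intro m z hz
    have : freePiece 𝓡 𝒱 i m ≤
        LinearMap.range (TensorProduct.map (𝓡 i).subtype (𝒱 m).subtype) :=
      freePiece_le fun r hr v hv => ⟨⟨r, hr⟩ ⊗ₜ ⟨v, hv⟩, by simp⟩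
    exact this hz
  have hr' : ∀ m (z' : 𝓡 i ⊗[k] 𝒱 m),
      TensorProduct.map (𝓡 i).subtype (𝒱 m).subtype z' ∈ freePiece 𝓡 𝒱 i m := by
    intro m z'
    induction z' using TensorProduct.induction_on with
    | zero => simp
    | tmul r v => exact tmul_mem_freePiece r.2 v.2
    | add x y hx hy => rw [map_add]; exact add_mem hx hy
  obtain ⟨z', rfl⟩ := hr n z hz
  have hE : Function.Exact (f.restrict hf) (f ∘ₗ (𝒱 n).subtype) := by
    intro v
    constructor
    · intro hv
      obtain ⟨u, hu, huv⟩ := hex v.1 v.2 hv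
      exact ⟨⟨u, hu⟩, Subtype.ext huv⟩
    · rintro ⟨u, rfl⟩
      exact hff u
  have h1 : LinearMap.lTensor (𝓡 i) (f ∘ₗ (𝒱 n).subtype) z' = 0 := by
    apply Module.Flat.rTensor_preserves_injective_linearMap (M := V) (𝓡 i).subtype
      (𝓡 i).injective_subtype
    rw [map_zero, ← hfz, ← LinearMap.comp_apply, ← LinearMap.comp_apply]
    congr 1
    ext; simp
  obtain ⟨y', rfl⟩ := (Module.Flat.lTensor_exact (𝓡 i) hE z').1 h1
  refine ⟨_, hr' _ y', ?_⟩
  rw [← LinearMap.comp_apply, ← LinearMap.comp_apply]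
  congr 1
  ext; simp

theorem smul_mem_freePiece [SetLike.GradedMul 𝓡] {i j n : ℕ} {r : R} (hr : r ∈ 𝓡 j)
    {z : R ⊗[k] V} (hz : z ∈ freePiece 𝓡 𝒱 i n) : r • z ∈ freePiece 𝓡 𝒱 (j + i) n := by
  have : freePiece 𝓡 𝒱 i n ≤ (freePiece 𝓡 𝒱 (j + i) n).comap
      (Algebra.lsmul k k (R ⊗[k] V) r) := by
    refine freePiece_le fun s hs v hv => ?_
    change r • (s ⊗ₜ[k] v) ∈ freePiece 𝓡 𝒱 (j + i) n
    rw [TensorProduct.smul_tmul']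
    exact tmul_mem_freePiece (SetLike.GradedMul.mul_mem hr hs) hv
  exact this hz

theorem smul_one_tmul (r : R) (v : V) : r • ((1 : R) ⊗ₜ[k] v) = r ⊗ₜ v := by
  rw [TensorProduct.smul_tmul', smul_eq_mul, mul_one]

/-- The reduction `R ⊗ V → k ⊗_R (R ⊗ V) = V`. -/
def epsTensor (ε : R →ₗ[k] k) : R ⊗[k] V →ₗ[k] V :=
  (TensorProduct.lid k V).toLinearMap ∘ₗ LinearMap.rTensor V ε

@[simp] theorem epsTensor_tmul (ε : R →ₗ[k] k) (r : R) (v : V) :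
    epsTensor ε (r ⊗ₜ v) = ε r • v := by
  simp [epsTensor]

theorem epsTensor_of_mem_freePiece {ε : R →ₗ[k] k} (hε : IsAugmentation 𝓡 ε) {i n : ℕ} (hi : i ≠ 0)
    {z : R ⊗[k] V} (hz : z ∈ freePiece 𝓡 𝒱 i n) : epsTensor ε z = 0 := by
  have : freePiece 𝓡 𝒱 i n ≤ LinearMap.ker (epsTensor ε) := freePiece_le fun r hr v _ => by
    rw [LinearMap.mem_ker, epsTensor_tmul, hε.map_of_pos hi hr, zero_smul]
  exact this hz

variable [GradedAlgebra 𝓡]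

omit [GradedAlgebra 𝓡] in
theorem rTensor_comp_of_mem_freePiece (h : DirectSum.IsInternal 𝓡) {i j n : ℕ} {z : R ⊗[k] V}
    (hz : z ∈ freePiece 𝓡 𝒱 i n) :
    LinearMap.rTensor V (h.comp j) z = if i = j then z else 0 := by
  have : freePiece 𝓡 𝒱 i n ≤ LinearMap.ker (LinearMap.rTensor V (h.comp j) -
      if i = j then LinearMap.id else 0) := freePiece_le fun r hr v _ => by
    rw [LinearMap.mem_ker, LinearMap.sub_apply, LinearMap.rTensor_tmul, h.comp_of_mem_ite j hr]
    split_ifs <;> simp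
  have h1 := this hz
  rw [LinearMap.mem_ker, LinearMap.sub_apply, sub_eq_zero] at h1
  rw [h1]
  split_ifs <;> rfl

theorem epsTensor_smul {ε : R →ₗ[k] k} (hε : IsAugmentation 𝓡 ε) (hR : IsStandardGraded 𝓡) (r : R)
    (z : R ⊗[k] V) : epsTensor ε (r • z) = ε r • epsTensor ε z := by
  induction z using TensorProduct.induction_on with
  | zero => simp
  | tmul s v =>
    have h1 := augProj_coe hε hR r
    have h2 : ε (r * s) = ε r * ε s := by
      have h3 : r * s = (r - algebraMap k R (ε r)) * (s - algebraMap k R (ε s)) +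
          ε s • (r - algebraMap k R (ε r)) + ε r • s := by
        rw [sub_mul, mul_sub, mul_sub, Algebra.smul_def, Algebra.smul_def,
          Algebra.commutes (ε s), sub_mul]
        abel
      have h4 : ∀ x y : R, ε (x * (y - algebraMap k R (ε y))) = 0 := fun x y =>
        (hε.mem_augIdeal_iff hR).1 ((augIdeal 𝓡).mul_mem_left x
          ((hε.mem_augIdeal_iff hR).2 (by rw [map_sub, hε.map_algebraMap, sub_self])))
      rw [h3, map_add, map_add, h4, map_smul, map_smul, map_sub, hε.map_algebraMap, sub_self,
        smul_zero, zero_add, zero_add, smul_eq_mul]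
    rw [TensorProduct.smul_tmul', epsTensor_tmul, epsTensor_tmul, smul_eq_mul, h2, mul_smul]
  | add x y hx hy => rw [smul_add, map_add, map_add, hx, hy, smul_add]

variable (𝓡 𝒱) in
/-- `D` is an `R`-linear differential on `R ⊗ V`, homogeneous of degree `-1`, that induces `f` on
`V = k ⊗_R (R ⊗ V)`.  The components of `D (1 ⊗ v)` in `R_i ⊗ V` vanish for `i ≥ 3`. -/
structure IsFreeComplex (D : R ⊗[k] V →ₗ[R] R ⊗[k] V) (f : V →ₗ[k] V) : Prop where
  map_mem : ∀ n, ∀ v ∈ 𝒱 (n + 1), f v ∈ 𝒱 n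
  map_zero : ∀ v ∈ 𝒱 0, f v = 0
  D_zero : ∀ v ∈ 𝒱 0, D (1 ⊗ₜ v) = 0
  D_sub_mem : ∀ n, ∀ v ∈ 𝒱 (n + 1),
    D (1 ⊗ₜ v) - 1 ⊗ₜ f v ∈ freePiece 𝓡 𝒱 1 n ⊔ freePiece 𝓡 𝒱 2 n

namespace IsFreeComplex

variable {D : R ⊗[k] V →ₗ[R] R ⊗[k] V} {f : V →ₗ[k] V}

theorem epsTensor_apply (h : IsFreeComplex 𝓡 𝒱 D f) (h𝒱 : DirectSum.IsInternal 𝒱) {ε : R →ₗ[k] k}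
    (hε : IsAugmentation 𝓡 ε) (hR : IsStandardGraded 𝓡) (z : R ⊗[k] V) :
    epsTensor ε (D z) = f (epsTensor ε z) := by
  induction z using TensorProduct.induction_on with
  | zero => simp
  | tmul r v =>
    rw [← smul_one_tmul, map_smul, epsTensor_smul hε hR, epsTensor_smul hε hR, map_smul]
    congr 1
    rw [epsTensor_tmul, hε.map_one, one_smul]
    refine h𝒱.induction (P := fun v => epsTensor ε (D (1 ⊗ₜ v)) = f v) ?_ (by simp) ?_ v
    · intro n v hv
      match n with
      | 0 => rw [h.D_zero v hv, LinearMap.map_zero, h.map_zero v hv]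
      | n + 1 =>
        obtain ⟨w1, hw1, w2, hw2, hw⟩ := Submodule.mem_sup.1 (h.D_sub_mem n v hv)
        rw [eq_sub_iff_add_eq] at hw
        rw [← hw, map_add, map_add, epsTensor_of_mem_freePiece hε one_ne_zero hw1,
          epsTensor_of_mem_freePiece hε two_ne_zero hw2, epsTensor_tmul, hε.map_one, one_smul,
          zero_add, zero_add]
    · intro v v' hv hv'
      rw [TensorProduct.tmul_add, map_add, map_add, hv, hv', map_add]
  | add x y hx hy => rw [map_add, map_add, hx, hy, map_add, map_add]

omit [GradedAlgebra 𝓡] in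
/-- On `R ⊗ v` the difference `D - 1 ⊗ f` is multiplication by fixed elements of `R_1 ⊗ V_{n-1}` and
`R_2 ⊗ V_{n-1}`. The truncated `n - 1` is harmless: both elements vanish for `n = 0`. -/
theorem tmul_eq (h : IsFreeComplex 𝓡 𝒱 D f) {n : ℕ} {v : V} (hv : v ∈ 𝒱 n) :
    ∃ w1 ∈ freePiece 𝓡 𝒱 1 (n - 1), ∃ w2 ∈ freePiece 𝓡 𝒱 2 (n - 1),
      ∀ r, D (r ⊗ₜ v) - LinearMap.lTensor R f (r ⊗ₜ v) = r • w1 + r • w2 := by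
  have key : ∀ (w : R ⊗[k] V) (r : R), D (1 ⊗ₜ v) - 1 ⊗ₜ f v = w →
      D (r ⊗ₜ v) - LinearMap.lTensor R f (r ⊗ₜ v) = r • w := by
    intro w r hw
    rw [LinearMap.lTensor_tmul, ← hw, smul_sub, smul_one_tmul, ← map_smul, smul_one_tmul]
  match n with
  | 0 =>
    refine ⟨0, zero_mem _, 0, zero_mem _, fun r => ?_⟩
    rw [key 0 r (by rw [h.D_zero v hv, h.map_zero v hv, TensorProduct.tmul_zero, sub_zero]),
      smul_zero, add_zero]
  | n + 1 =>
    obtain ⟨w1, hw1, w2, hw2, hw⟩ := Submodule.mem_sup.1 (h.D_sub_mem n v hv)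
    exact ⟨w1, hw1, w2, hw2, fun r => by rw [key _ r hw.symm, smul_add]⟩

omit [GradedAlgebra 𝓡] in
theorem _root_.freePiece_eq_bot {i : ℕ} (hi : 𝓡 i = ⊥) (n : ℕ) : freePiece 𝓡 𝒱 i n = ⊥ := by
  rw [freePiece, hi, Submodule.map₂_bot_left]

/-- The leading term of `D` on `R_1 ⊗ V_n`. -/
theorem sub_mem_of_mem_one (h : IsFreeComplex 𝓡 𝒱 D f) (hR3 : 𝓡 3 = ⊥) {n : ℕ} {u : R ⊗[k] V}
    (hu : u ∈ freePiece 𝓡 𝒱 1 n) : D u - LinearMap.lTensor R f u ∈ freePiece 𝓡 𝒱 2 (n - 1) := by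
  have : freePiece 𝓡 𝒱 1 n ≤ (freePiece 𝓡 𝒱 2 (n - 1)).comap
      (D.restrictScalars k - LinearMap.lTensor R f) := by
    refine freePiece_le fun r hr v hv => ?_
    change D (r ⊗ₜ[k] v) - LinearMap.lTensor R f (r ⊗ₜ[k] v) ∈ freePiece 𝓡 𝒱 2 (n - 1)
    obtain ⟨w1, hw1, w2, hw2, hw⟩ := h.tmul_eq hv
    have h2 : r • w2 ∈ freePiece 𝓡 𝒱 (1 + 2) (n - 1) := smul_mem_freePiece hr hw2
    rw [freePiece_eq_bot hR3, Submodule.mem_bot] at h2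
    have h1 : r • w1 ∈ freePiece 𝓡 𝒱 (1 + 1) (n - 1) := smul_mem_freePiece hr hw1
    rw [one_add_one_eq_two] at h1
    rwa [hw, h2, add_zero]
  exact this hu

/-- There are no further terms of `D` on `R_2 ⊗ V_n`. -/
theorem apply_of_mem_two (h : IsFreeComplex 𝓡 𝒱 D f) (hR : IsStandardGraded 𝓡) (hR3 : 𝓡 3 = ⊥)
    {n : ℕ} {u : R ⊗[k] V} (hu : u ∈ freePiece 𝓡 𝒱 2 n) : D u = LinearMap.lTensor R f u := by
  have : freePiece 𝓡 𝒱 2 n ≤ LinearMap.ker (D.restrictScalars k - LinearMap.lTensor R f) := by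
    refine freePiece_le fun r hr v hv => ?_
    change D (r ⊗ₜ[k] v) - LinearMap.lTensor R f (r ⊗ₜ[k] v) = 0
    obtain ⟨w1, hw1, w2, hw2, hw⟩ := h.tmul_eq hv
    have h1 : r • w1 ∈ freePiece 𝓡 𝒱 (2 + 1) (n - 1) := smul_mem_freePiece hr hw1
    have h2 : r • w2 ∈ freePiece 𝓡 𝒱 (2 + 2) (n - 1) := smul_mem_freePiece hr hw2
    rw [freePiece_eq_bot (hR.eq_bot hR3 (by omega)), Submodule.mem_bot] at h1 h2
    rw [hw, h1, h2, add_zero]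
  exact sub_eq_zero.1 (this hu)

/-- The component of `D w` in `R_1 ⊗ V`. -/
theorem lTensor_eq_zero_of_add_eq_zero (h : IsFreeComplex 𝓡 𝒱 D f) (hR : IsStandardGraded 𝓡)
    (hR3 : 𝓡 3 = ⊥) {n : ℕ} {w1 w2 : R ⊗[k] V} (hw1 : w1 ∈ freePiece 𝓡 𝒱 1 n)
    (hw2 : w2 ∈ freePiece 𝓡 𝒱 2 n) (hw : D w1 + D w2 = 0) : LinearMap.lTensor R f w1 = 0 := by
  have hint : DirectSum.IsInternal 𝓡 := DirectSum.Decomposition.isInternal 𝓡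
  match n with
  | 0 =>
    have : freePiece 𝓡 𝒱 1 0 ≤ LinearMap.ker (LinearMap.lTensor R f) :=
      freePiece_le fun r hr v hv => by
        rw [LinearMap.mem_ker, LinearMap.lTensor_tmul, h.map_zero v hv, TensorProduct.tmul_zero]
    exact this hw1
  | n + 1 =>
    rw [h.apply_of_mem_two hR hR3 hw2] at hw
    have h1 := h.sub_mem_of_mem_one hR3 hw1
    have h2 := lTensor_mem_freePiece (h.map_mem n) hw1
    have h4 := lTensor_mem_freePiece (h.map_mem n) hw2
    have h5 := congrArg (LinearMap.rTensor V (hint.comp 1)) hw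
    rw [← sub_add_cancel (D w1) (LinearMap.lTensor R f w1), map_add, map_add,
      rTensor_comp_of_mem_freePiece hint h1, rTensor_comp_of_mem_freePiece hint h2,
      rTensor_comp_of_mem_freePiece hint h4, if_neg (by decide), if_pos rfl, if_neg (by decide),
      zero_add, add_zero, _root_.map_zero] at h5
    exact h5

/-- An exact complex of free `R`-modules in non-negative degrees remains exact modulo `R_+`.  If
`f v = 0`, then `1 ⊗ v` can be corrected, first by an element of `R_1 ⊗ V` and then by one of
`R_2 ⊗ V`, to a cycle. -/
theorem exact (h : IsFreeComplex 𝓡 𝒱 D f) (hR : IsStandardGraded 𝓡) (hR3 : 𝓡 3 = ⊥)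
    (h𝒱 : DirectSum.IsInternal 𝒱) (hDD : ∀ z, D (D z) = 0) (hex : ∀ z, D z = 0 → ∃ y, D y = z)
    (n : ℕ) : ∀ v ∈ 𝒱 n, f v = 0 → ∃ u ∈ 𝒱 (n + 1), f u = v := by
  obtain ⟨ε, hε⟩ := hR.exists_isAugmentation
  have hεD := h.epsTensor_apply h𝒱 hε hR
  have hff : ∀ v, f (f v) = 0 := by
    intro v
    have := congrArg (epsTensor ε) (hDD (1 ⊗ₜ v))
    rwa [hεD, hεD, epsTensor_tmul, hε.map_one, one_smul, LinearMap.map_zero] at this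
  have hcomp : ∀ n v x, v ∈ 𝒱 n → f x = v → ∃ u ∈ 𝒱 (n + 1), f u = v := fun n v x hv hx =>
    ⟨h𝒱.comp (n + 1) x, h𝒱.comp_mem _ _, by
      rw [← h𝒱.comp_lowering h.map_mem h.map_zero, hx, h𝒱.comp_of_mem hv]⟩
  induction n with
  | zero =>
    intro v hv _
    obtain ⟨y, hy⟩ := hex _ (h.D_zero v hv)
    refine hcomp 0 v (epsTensor ε y) hv ?_
    rw [← hεD, hy, epsTensor_tmul, hε.map_one, one_smul]
  | succ m ih =>
    intro v hv hfv
    obtain ⟨w1, hw1, w2, hw2, hw⟩ := Submodule.mem_sup.1 (h.D_sub_mem m v hv)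
    rw [hfv, TensorProduct.tmul_zero, sub_zero] at hw
    have hw1' := h.lTensor_eq_zero_of_add_eq_zero hR hR3 hw1 hw2 (by rw [← map_add, hw, hDD])
    obtain ⟨u1, hu1, hfu1⟩ := exists_lTensor_eq_of_mem_freePiece (h.map_mem m) hff ih hw1 hw1'
    have hw3 := h.sub_mem_of_mem_one hR3 hu1
    rw [hfu1, Nat.add_sub_cancel] at hw3
    have hw4 : D (1 ⊗ₜ v - u1) ∈ freePiece 𝓡 𝒱 2 m := by
      have : D (1 ⊗ₜ v - u1) = w2 - (D u1 - w1) := by rw [map_sub, ← hw]; abel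
      rw [this]
      exact sub_mem hw2 hw3
    obtain ⟨u2, hu2, hfu2⟩ := exists_lTensor_eq_of_mem_freePiece (h.map_mem m) hff ih hw4
      (by rw [← h.apply_of_mem_two hR hR3 hw4, hDD])
    rw [← h.apply_of_mem_two hR hR3 hu2] at hfu2
    obtain ⟨y, hy⟩ := hex (1 ⊗ₜ v - u1 - u2) (by rw [map_sub, hfu2, sub_self])
    refine hcomp (m + 1) v (epsTensor ε y) hv ?_
    rw [← hεD, hy, map_sub, map_sub, epsTensor_of_mem_freePiece hε one_ne_zero hu1,
      epsTensor_of_mem_freePiece hε two_ne_zero hu2, epsTensor_tmul, hε.map_one, one_smul,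
      sub_zero, sub_zero]

end IsFreeComplex

end FreeComplex

/-! ### Comparison of two resolutions modulo `R_+` -/

section Cone

variable {k R : Type*} [Field k] [Ring R] [Algebra k R] {𝓡 : ℕ → Submodule k R} [GradedAlgebra 𝓡]
  {V W : Type*} [AddCommGroup V] [Module k V] [AddCommGroup W] [Module k W]
  {𝒱 : ℕ → Submodule k V} {𝒲 : ℕ → Submodule k W}

/-- The grading of the cone of a map `W → V`: degree `n` consists of `V_n` and `W_{n-1}`. -/
def coneGrading (𝒱 : ℕ → Submodule k V) (𝒲 : ℕ → Submodule k W) (n : ℕ) : Submodule k (V × W) :=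
  (𝒱 n).prod (⨆ (m : ℕ) (_ : m + 1 = n), 𝒲 m)

theorem mem_coneGrading_zero {x : V × W} : x ∈ coneGrading 𝒱 𝒲 0 ↔ x.1 ∈ 𝒱 0 ∧ x.2 = 0 := by
  simp [coneGrading, Submodule.mem_prod]

theorem mem_coneGrading_succ {n : ℕ} {x : V × W} :
    x ∈ coneGrading 𝒱 𝒲 (n + 1) ↔ x.1 ∈ 𝒱 (n + 1) ∧ x.2 ∈ 𝒲 n := by
  simp [coneGrading, Submodule.mem_prod]

omit [GradedAlgebra 𝓡] in
theorem coneGrading_isInternal (h𝒱 : DirectSum.IsInternal 𝒱) (h𝒲 : DirectSum.IsInternal 𝒲) :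
    DirectSum.IsInternal (coneGrading 𝒱 𝒲) := by
  obtain ⟨ι, b, deg, hb⟩ := h𝒱.exists_isHomogeneousBasis
  obtain ⟨κ, c, deg', hc⟩ := h𝒲.exists_isHomogeneousBasis
  exact (hb.prod (hc.coarsen fun n => n + 1)).isInternal

/-- The inclusion of `R ⊗ V` into `R ⊗ (V × W)`. -/
abbrev coneInl (R V W : Type*) [Ring R] [Algebra k R] [AddCommGroup V] [Module k V]
    [AddCommGroup W] [Module k W] : R ⊗[k] V →ₗ[R] R ⊗[k] (V × W) :=
  TensorProduct.AlgebraTensorModule.lTensor R R (LinearMap.inl k V W)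

/-- The inclusion of `R ⊗ W` into `R ⊗ (V × W)`. -/
abbrev coneInr (R V W : Type*) [Ring R] [Algebra k R] [AddCommGroup V] [Module k V]
    [AddCommGroup W] [Module k W] : R ⊗[k] W →ₗ[R] R ⊗[k] (V × W) :=
  TensorProduct.AlgebraTensorModule.lTensor R R (LinearMap.inr k V W)

/-- The differential `(x, y) ↦ (δ x + g y, - d y)` of the cone of `1 ⊗ g`. -/
def coneD (δ : R ⊗[k] V →ₗ[R] R ⊗[k] V) (d : R ⊗[k] W →ₗ[R] R ⊗[k] W) (g : W →ₗ[k] V) :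
    R ⊗[k] (V × W) →ₗ[R] R ⊗[k] (V × W) :=
  coneInl R V W ∘ₗ δ ∘ₗ TensorProduct.AlgebraTensorModule.lTensor R R (LinearMap.fst k V W) +
    coneInl R V W ∘ₗ TensorProduct.AlgebraTensorModule.lTensor R R (g ∘ₗ LinearMap.snd k V W) -
    coneInr R V W ∘ₗ d ∘ₗ TensorProduct.AlgebraTensorModule.lTensor R R (LinearMap.snd k V W)

variable {δ : R ⊗[k] V →ₗ[R] R ⊗[k] V} {d : R ⊗[k] W →ₗ[R] R ⊗[k] W} {g : W →ₗ[k] V}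

omit [GradedAlgebra 𝓡] in
theorem exists_coneInl_add_coneInr (z : R ⊗[k] (V × W)) :
    ∃ x y, z = coneInl R V W x + coneInr R V W y := by
  induction z using TensorProduct.induction_on with
  | zero => exact ⟨0, 0, by simp⟩
  | tmul r v =>
    refine ⟨r ⊗ₜ v.1, r ⊗ₜ v.2, ?_⟩
    simp [← TensorProduct.tmul_add]
  | add a b ha hb =>
    obtain ⟨x, y, rfl⟩ := ha
    obtain ⟨x', y', rfl⟩ := hb
    exact ⟨x + x', y + y', by rw [map_add, map_add]; abel⟩

theorem lTensor_lTensor {A B C : Type*} [AddCommGroup A] [Module k A] [AddCommGroup B] [Module k B]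
    [AddCommGroup C] [Module k C] {f : A →ₗ[k] B} {f' : B →ₗ[k] C} {f'' : A →ₗ[k] C}
    (h : ∀ x, f' (f x) = f'' x) (z : R ⊗[k] A) :
    TensorProduct.AlgebraTensorModule.lTensor R R f'
      (TensorProduct.AlgebraTensorModule.lTensor R R f z) =
    TensorProduct.AlgebraTensorModule.lTensor R R f'' z := by
  induction z using TensorProduct.induction_on with
  | zero => simp
  | tmul r v => simp [h]
  | add a b ha hb => rw [map_add, map_add, map_add, ha, hb]

theorem coneD_coneInl (x : R ⊗[k] V) : coneD δ d g (coneInl R V W x) = coneInl R V W (δ x) := by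
  have h1 := lTensor_lTensor (R := R) (f := LinearMap.inl k V W) (f' := LinearMap.fst k V W)
    (f'' := LinearMap.id) (fun _ => rfl) x
  have h2 := lTensor_lTensor (R := R) (f := LinearMap.inl k V W) (f' := LinearMap.snd k V W)
    (f'' := 0) (fun _ => rfl) x
  have h3 := lTensor_lTensor (R := R) (f := LinearMap.inl k V W) (f' := g ∘ₗ LinearMap.snd k V W)
    (f'' := 0) (fun _ => by simp) x
  simp only [coneD, LinearMap.sub_apply, LinearMap.add_apply, LinearMap.comp_apply, h1, h2, h3]
  simp

theorem coneD_coneInr (y : R ⊗[k] W) : coneD δ d g (coneInr R V W y) =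
    coneInl R V W (TensorProduct.AlgebraTensorModule.lTensor R R g y) - coneInr R V W (d y) := by
  have h1 := lTensor_lTensor (R := R) (f := LinearMap.inr k V W) (f' := LinearMap.fst k V W)
    (f'' := 0) (fun _ => rfl) y
  have h2 := lTensor_lTensor (R := R) (f := LinearMap.inr k V W) (f' := LinearMap.snd k V W)
    (f'' := LinearMap.id) (fun _ => rfl) y
  have h3 := lTensor_lTensor (R := R) (f := LinearMap.inr k V W) (f' := g ∘ₗ LinearMap.snd k V W)
    (f'' := g) (fun _ => by simp) y
  simp only [coneD, LinearMap.sub_apply, LinearMap.add_apply, LinearMap.comp_apply, h1, h2, h3]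
  simp

theorem coneInl_add_coneInr_eq_zero {x : R ⊗[k] V} {y : R ⊗[k] W}
    (h : coneInl R V W x + coneInr R V W y = 0) : x = 0 ∧ y = 0 := by
  constructor
  · have h1 := lTensor_lTensor (R := R) (f := LinearMap.inl k V W) (f' := LinearMap.fst k V W)
      (f'' := LinearMap.id) (fun _ => rfl) x
    have h2 := lTensor_lTensor (R := R) (f := LinearMap.inr k V W) (f' := LinearMap.fst k V W)
      (f'' := 0) (fun _ => rfl) y
    have h3 := congrArg (TensorProduct.AlgebraTensorModule.lTensor R R (LinearMap.fst k V W)) h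
    rw [map_add, h1, h2] at h3
    simpa using h3
  · have h1 := lTensor_lTensor (R := R) (f := LinearMap.inl k V W) (f' := LinearMap.snd k V W)
      (f'' := 0) (fun _ => rfl) x
    have h2 := lTensor_lTensor (R := R) (f := LinearMap.inr k V W) (f' := LinearMap.snd k V W)
      (f'' := LinearMap.id) (fun _ => rfl) y
    have h3 := congrArg (TensorProduct.AlgebraTensorModule.lTensor R R (LinearMap.snd k V W)) h
    rw [map_add, h1, h2] at h3
    simpa using h3

theorem coneD_coneD (hδ : ∀ x, δ (δ x) = 0) (hd : ∀ y, d (d y) = 0)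
    (hg : ∀ y, δ (TensorProduct.AlgebraTensorModule.lTensor R R g y) =
      TensorProduct.AlgebraTensorModule.lTensor R R g (d y)) (z : R ⊗[k] (V × W)) :
    coneD δ d g (coneD δ d g z) = 0 := by
  obtain ⟨x, y, rfl⟩ := exists_coneInl_add_coneInr z
  rw [map_add, coneD_coneInl, coneD_coneInr, map_add, map_sub, coneD_coneInl, coneD_coneInl,
    coneD_coneInr, hδ, hd, hg, map_zero, map_zero, sub_zero, sub_self, add_zero]

/-- The cone of a map of complexes is exact if the homology of both complexes is spanned by the
classes of `e` and `e'`, the map takes `e'` to `e`, and the class of `e` does not vanish. -/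
theorem coneD_exact {e : R ⊗[k] V} {e' : R ⊗[k] W} {η : R ⊗[k] V →ₗ[k] k}
    (hexδ : ∀ x, δ x = 0 → ∃ z, ∃ a : k, x = δ z + a • e)
    (hexd : ∀ y, d y = 0 → ∃ z, ∃ a : k, y = d z + a • e')
    (hg : ∀ y, δ (TensorProduct.AlgebraTensorModule.lTensor R R g y) =
      TensorProduct.AlgebraTensorModule.lTensor R R g (d y))
    (hge : TensorProduct.AlgebraTensorModule.lTensor R R g e' = e) (hde : d e' = 0)
    (hη : ∀ x, η (δ x) = 0) (hηe : η e = 1)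
    (z : R ⊗[k] (V × W)) (hz : coneD δ d g z = 0) : ∃ y, coneD δ d g y = z := by
  obtain ⟨x, y, rfl⟩ := exists_coneInl_add_coneInr z
  rw [map_add, coneD_coneInl, coneD_coneInr, add_sub, ← map_add, sub_eq_add_neg, ← map_neg] at hz
  obtain ⟨h1, h2⟩ := coneInl_add_coneInr_eq_zero hz
  obtain ⟨z, a, rfl⟩ := hexd y (neg_eq_zero.1 h2)
  have h3 : TensorProduct.AlgebraTensorModule.lTensor R R g (d z + a • e') =
      δ (TensorProduct.AlgebraTensorModule.lTensor R R g z) + a • e := by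
    rw [map_add, ← hg, LinearMap.map_smul_of_tower, hge]
  rw [h3, ← add_assoc, ← map_add] at h1
  have ha : a = 0 := by
    have := congrArg η h1
    rwa [map_add, hη, map_smul, hηe, zero_add, smul_eq_mul, mul_one, map_zero] at this
  rw [ha, zero_smul, add_zero] at h1
  obtain ⟨c, b, hb⟩ := hexδ _ h1
  refine ⟨coneInl R V W c + coneInr R V W (b • e' - z), ?_⟩
  have h4 : d (b • e' - z) = -d z := by
    rw [map_sub, LinearMap.map_smul_of_tower, hde, smul_zero, zero_sub]
  have h5 : TensorProduct.AlgebraTensorModule.lTensor R R g (b • e' - z) =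
      b • e - TensorProduct.AlgebraTensorModule.lTensor R R g z := by
    rw [map_sub, LinearMap.map_smul_of_tower, hge]
  rw [map_add, coneD_coneInl, coneD_coneInr, h4, h5, ha, zero_smul, add_zero, map_neg,
    sub_neg_eq_add, ← add_assoc, ← map_add, eq_sub_of_add_eq hb]
  congr 2
  abel

omit [GradedAlgebra 𝓡] in
theorem coneD_isFreeComplex {f : V →ₗ[k] V} (hδ : IsFreeComplex 𝓡 𝒱 δ f)
    (hd : IsFreeComplex 𝓡 𝒲 d 0) (hg : ∀ n, ∀ w ∈ 𝒲 n, g w ∈ 𝒱 n) :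
    IsFreeComplex 𝓡 (coneGrading 𝒱 𝒲) (coneD δ d g)
      (LinearMap.inl k V W ∘ₗ (f ∘ₗ LinearMap.fst k V W + g ∘ₗ LinearMap.snd k V W)) := by
  have hsplit : ∀ x : V × W, (1 : R) ⊗ₜ[k] x =
      coneInl R V W (1 ⊗ₜ x.1) + coneInr R V W (1 ⊗ₜ x.2) := fun x => by
    simp [← TensorProduct.tmul_add]
  have hl : ∀ i n, ∀ z ∈ freePiece 𝓡 𝒱 i n,
      coneInl R V W z ∈ freePiece 𝓡 (coneGrading 𝒱 𝒲) i n := fun i n z hz =>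
    lTensor_mem_freePiece (𝒱' := coneGrading 𝒱 𝒲) (f := LinearMap.inl k V W)
      (fun v hv => ⟨hv, zero_mem _⟩) hz
  have hr : ∀ i n, ∀ z ∈ freePiece 𝓡 𝒲 i n,
      coneInr R V W z ∈ freePiece 𝓡 (coneGrading 𝒱 𝒲) i (n + 1) := fun i n z hz =>
    lTensor_mem_freePiece (𝒱' := coneGrading 𝒱 𝒲) (f := LinearMap.inr k V W)
      (fun v hv => mem_coneGrading_succ.2 ⟨zero_mem _, hv⟩) hz
  refine ⟨fun n x hx => ?_, fun x hx => ?_, fun x hx => ?_, fun n x hx => ?_⟩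
  · rw [mem_coneGrading_succ] at hx
    exact ⟨add_mem (hδ.map_mem n _ hx.1) (hg n _ hx.2), zero_mem _⟩
  · rw [mem_coneGrading_zero] at hx
    simp [hδ.map_zero _ hx.1, hx.2]
  · rw [mem_coneGrading_zero] at hx
    rw [hsplit, map_add, coneD_coneInl, hδ.D_zero _ hx.1, hx.2, TensorProduct.tmul_zero, map_zero,
      map_zero, map_zero, add_zero]
  · rw [mem_coneGrading_succ] at hx
    have h1 : coneD δ d g (1 ⊗ₜ x) - 1 ⊗ₜ (LinearMap.inl k V W ∘ₗ
        (f ∘ₗ LinearMap.fst k V W + g ∘ₗ LinearMap.snd k V W)) x =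
        coneInl R V W (δ (1 ⊗ₜ x.1) - 1 ⊗ₜ f x.1) - coneInr R V W (d (1 ⊗ₜ x.2)) := by
      rw [hsplit, map_add, coneD_coneInl, coneD_coneInr, map_sub]
      have : (1 : R) ⊗ₜ[k] (LinearMap.inl k V W ∘ₗ
        (f ∘ₗ LinearMap.fst k V W + g ∘ₗ LinearMap.snd k V W)) x =
        coneInl R V W (1 ⊗ₜ f x.1) +
          coneInl R V W (TensorProduct.AlgebraTensorModule.lTensor R R g (1 ⊗ₜ x.2)) := by
        simp [← TensorProduct.tmul_add]
      rw [this]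
      abel
    rw [h1]
    refine sub_mem ?_ ?_
    · obtain ⟨w1, hw1, w2, hw2, hw⟩ := Submodule.mem_sup.1 (hδ.D_sub_mem n _ hx.1)
      rw [← hw, map_add]
      exact Submodule.add_mem_sup (hl 1 n w1 hw1) (hl 2 n w2 hw2)
    · match n with
      | 0 =>
        rw [hd.D_zero _ hx.2, map_zero]
        exact zero_mem _
      | n + 1 =>
        obtain ⟨w1, hw1, w2, hw2, hw⟩ := Submodule.mem_sup.1 (hd.D_sub_mem n _ hx.2)
        rw [LinearMap.zero_apply, TensorProduct.tmul_zero, sub_zero] at hw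
        rw [← hw, map_add]
        exact Submodule.add_mem_sup (hr 1 n w1 hw1) (hr 2 n w2 hw2)

/-- If `R ⊗ W` is a minimal resolution of `k` and `R ⊗ V` any other one, then a comparison map
`1 ⊗ g` identifies `W` with the homology of `V = k ⊗_R (R ⊗ V)`. -/
theorem exists_of_comparison (hR : IsStandardGraded 𝓡) (hR3 : 𝓡 3 = ⊥)
    (h𝒱 : DirectSum.IsInternal 𝒱) (h𝒲 : DirectSum.IsInternal 𝒲) {f : V →ₗ[k] V}
    (hδ : IsFreeComplex 𝓡 𝒱 δ f) (hd : IsFreeComplex 𝓡 𝒲 d 0) (hgm : ∀ n, ∀ w ∈ 𝒲 n, g w ∈ 𝒱 n)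
    (hδδ : ∀ x, δ (δ x) = 0) (hdd : ∀ y, d (d y) = 0)
    {e : R ⊗[k] V} {e' : R ⊗[k] W} {η : R ⊗[k] V →ₗ[k] k}
    (hexδ : ∀ x, δ x = 0 → ∃ z, ∃ a : k, x = δ z + a • e)
    (hexd : ∀ y, d y = 0 → ∃ z, ∃ a : k, y = d z + a • e')
    (hg : ∀ y, δ (TensorProduct.AlgebraTensorModule.lTensor R R g y) =
      TensorProduct.AlgebraTensorModule.lTensor R R g (d y))
    (hge : TensorProduct.AlgebraTensorModule.lTensor R R g e' = e) (hde : d e' = 0)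
    (hη : ∀ x, η (δ x) = 0) (hηe : η e = 1) {v : V} {w : W} (hvw : f v = g w) :
    w = 0 ∧ ∃ v' w', v = f v' + g w' := by
  have hint := coneGrading_isInternal h𝒱 h𝒲
  have hc := coneD_isFreeComplex hδ hd hgm
  have hex := hc.exact hR hR3 hint (coneD_coneD hδδ hdd hg)
    (coneD_exact hexδ hexd hg hge hde hη hηe)
  set F := LinearMap.inl k V W ∘ₗ (f ∘ₗ LinearMap.fst k V W + g ∘ₗ LinearMap.snd k V W) with hF
  have hex' : ∀ x, F x = 0 → ∃ y, F y = x := by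
    intro x hx
    have : x ∈ LinearMap.range F := hint.mem_of_comp_mem fun n => by
      have hn : F (hint.comp n x) = 0 := by
        match n with
        | 0 => exact hc.map_zero _ (hint.comp_mem 0 x)
        | n + 1 => rw [← hint.comp_lowering hc.map_mem hc.map_zero, hx, map_zero]
      obtain ⟨y, -, hy⟩ := hex n _ (hint.comp_mem n x) hn
      exact ⟨y, hy⟩
    exact this
  obtain ⟨⟨v', w'⟩, h⟩ := hex' (v, -w) (by simp [hF, hvw])
  have h1 : f v' + g w' = v := by simpa [hF] using congrArg Prod.fst h
  have h2 : 0 = -w := by simpa [hF] using congrArg Prod.snd h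
  exact ⟨by rw [← neg_neg w, ← h2, neg_zero], v', w', h1.symm⟩

end Cone

section Extensionality

variable {k R : Type*} [Field k] [Ring R] [Algebra k R]

theorem eq_of_forall_one_tmul {K T M : Type*} [AddCommGroup K] [Module k K] [AddCommGroup T]
    [Module k T] [AddCommGroup M] [Module R M] {𝒦 : ℕ → Submodule k K}
    (h : DirectSum.IsInternal 𝒦) {f g : R ⊗[k] (K ⊗[k] T) →ₗ[R] M}
    (hfg : ∀ n, ∀ x ∈ 𝒦 n, ∀ t, f (1 ⊗ₜ (x ⊗ₜ t)) = g (1 ⊗ₜ (x ⊗ₜ t))) (y : R ⊗[k] (K ⊗[k] T)) :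
    f y = g y := by
  have key : ∀ x t, f (1 ⊗ₜ (x ⊗ₜ t)) = g (1 ⊗ₜ (x ⊗ₜ t)) := fun x t => by
    refine h.induction (P := fun x => f (1 ⊗ₜ (x ⊗ₜ t)) = g (1 ⊗ₜ (x ⊗ₜ t)))
      (fun n x hx => hfg n x hx t) (by simp) (fun a b ha hb => ?_) x
    rw [TensorProduct.add_tmul, TensorProduct.tmul_add, map_add, map_add, ha, hb]
  induction y using TensorProduct.induction_on with
  | zero => rw [map_zero, map_zero]
  | tmul r w =>
    induction w using TensorProduct.induction_on with
    | zero => rw [TensorProduct.tmul_zero, map_zero, map_zero]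
    | tmul κ t => rw [← smul_one_tmul, map_smul, map_smul, key]
    | add x y hx hy => rw [TensorProduct.tmul_add, map_add, map_add, hx, hy]
  | add x y hx hy => rw [map_add, map_add, hx, hy]

theorem TensorAlgebra.eq_of_forall_ι_mul {C M : Type*} [AddCommGroup C] [Module k C]
    [AddCommGroup M] [Module k M] {𝒞 : ℕ × ℕ → Submodule k C} (h : DirectSum.IsInternal 𝒞)
    {f g : TensorAlgebra k C →ₗ[k] M} (h1 : f 1 = g 1)
    (hfg : ∀ p, ∀ c ∈ 𝒞 p, ∀ t, f (TensorAlgebra.ι k c * t) = g (TensorAlgebra.ι k c * t))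
    (t : TensorAlgebra k C) : f t = g t := by
  induction t using TensorAlgebra.left_induction with
  | one => exact h1
  | mul c t _ =>
    refine h.induction
      (P := fun c => f (TensorAlgebra.ι k c * t) = g (TensorAlgebra.ι k c * t))
      (fun p c hc => hfg p c hc t) (by simp) (fun a b ha hb => ?_) c
    rw [map_add, add_mul, map_add, map_add, ha, hb]
  | add s t hs ht => rw [map_add, map_add, hs, ht]
  | smul a t ht => rw [map_smul, map_smul, ht]

end Extensionality

/-! ### The bigradings of the bar construction and of `K ⊗ T(C)` -/

section BarGrading

variable {k R : Type*} [Field k] [Ring R] [Algebra k R] {𝓡 : ℕ → Submodule k R} [GradedAlgebra 𝓡]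

theorem augPart_isInternal (hR : IsStandardGraded 𝓡) :
    DirectSum.IsInternal fun i => (𝓡 i).comap (augPart 𝓡).subtype := by
  obtain ⟨ε, hε⟩ := hR.exists_isAugmentation
  have h : DirectSum.IsInternal 𝓡 := DirectSum.Decomposition.isInternal 𝓡
  have h0 : ∀ r, ε (h.comp 0 r) = ε r := by
    intro r
    refine h.induction (P := fun r => ε (h.comp 0 r) = ε r) ?_ (by simp) ?_ r
    · intro i r hr
      rw [h.comp_of_mem_ite 0 hr]
      split_ifs with hi
      · rfl
      · rw [map_zero, hε.map_of_pos hi hr]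
    · intro r s hr hs
      rw [map_add, map_add, map_add, hr, hs]
  refine h.comap_subtype _ fun i r hr => ?_
  rcases Nat.eq_zero_or_pos i with rfl | hi
  · exact (hε.mem_augIdeal_iff hR).2 ((h0 r).trans ((hε.mem_augIdeal_iff hR).1 hr))
  · exact mem_augIdeal_of_mem hi.ne' (h.comp_mem i r)

theorem augBideg_isInternal (hR : IsStandardGraded 𝓡) : DirectSum.IsInternal (augBideg 𝓡) := by
  obtain ⟨ι, b, deg, hb⟩ := (augPart_isInternal hR).exists_isHomogeneousBasis
  refine ((hb.coarsen fun j => (1, j)).congr fun p => ?_).isInternal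
  obtain ⟨n, j⟩ := p
  unfold augBideg
  split_ifs with hn
  · obtain rfl : n = 1 := hn
    refine le_antisymm (le_iSup₂_of_le j rfl le_rfl) (iSup₂_le fun j' hj' => ?_)
    obtain rfl : j' = j := (Prod.ext_iff.1 hj').2
    exact le_rfl
  · refine le_antisymm bot_le (iSup₂_le fun j' hj' => ?_)
    exact absurd (Prod.ext_iff.1 hj').1.symm hn

theorem barPiece_isInternal (hR : IsStandardGraded 𝓡) :
    DirectSum.IsInternal fun p : ℕ × ℕ => barPiece 𝓡 p.1 p.2 :=
  isInternal_tensorPiece (augBideg_isInternal hR)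

theorem augMul_mem_augBideg {p q : ℕ × ℕ} {a b : augPart 𝓡} (ha : a ∈ augBideg 𝓡 p)
    (hb : b ∈ augBideg 𝓡 q) : augMul 𝓡 a b ∈ augBideg 𝓡 (1, p.2 + q.2) := by
  unfold augBideg at ha hb ⊢
  rw [if_pos rfl]
  split_ifs at ha with hp
  · split_ifs at hb with hq
    · exact SetLike.GradedMul.mul_mem (A := 𝓡) ha hb
    · rw [(Submodule.mem_bot k).1 hb, map_zero]
      exact zero_mem _
  · rw [(Submodule.mem_bot k).1 ha, map_zero, LinearMap.zero_apply]
    exact zero_mem _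

theorem mem_augBideg {p : ℕ × ℕ} {a : augPart 𝓡} (ha : a ∈ augBideg 𝓡 p) :
    a = 0 ∨ p.1 = 1 ∧ a.1 ∈ 𝓡 p.2 := by
  unfold augBideg at ha
  split_ifs at ha with hp
  · exact Or.inr ⟨hp, ha⟩
  · exact Or.inl ((Submodule.mem_bot k).1 ha)

theorem mem_augBideg_one {j : ℕ} {a : augPart 𝓡} (ha : a.1 ∈ 𝓡 j) : a ∈ augBideg 𝓡 (1, j) := by
  unfold augBideg
  rw [if_pos rfl]
  exact ha

/-- The bar differential has bidegree `(-1, 0)`. -/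
theorem barD_mem_aux {q : ℕ × ℕ} {t : BarSpace 𝓡} (ht : t ∈ tensorPiece (augBideg 𝓡) q) :
    ((∀ n j, q = (n + 1, j) → barD 𝓡 t ∈ barPiece 𝓡 n j) ∧
      (q.1 = 0 → barD 𝓡 t = 0 ∧ headSplit t = 0)) ∧
    ∀ p, ∀ a ∈ augBideg 𝓡 p, ∀ n j, p + q = (n + 1, j) →
      barMulHead 𝓡 a (headSplit t) ∈ barPiece 𝓡 n j := by
  refine tensorPiece_induction (P := fun q t =>
    ((∀ n j, q = (n + 1, j) → barD 𝓡 t ∈ barPiece 𝓡 n j) ∧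
      (q.1 = 0 → barD 𝓡 t = 0 ∧ headSplit t = 0)) ∧
    ∀ p, ∀ a ∈ augBideg 𝓡 p, ∀ n j, p + q = (n + 1, j) →
      barMulHead 𝓡 a (headSplit t) ∈ barPiece 𝓡 n j) ?_ ?_ ?_ ?_ ?_ ht
  · simp
  · intro p q a t ha ht ih
    rcases mem_augBideg ha with rfl | ⟨hp, -⟩
    · simp
    obtain ⟨p1, i⟩ := p
    obtain rfl : p1 = 1 := hp
    refine ⟨⟨fun n j hq => ?_, fun h0 => ?_⟩, fun p b hb n j hq => ?_⟩
    · rw [barD_ι_mul]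
      refine sub_mem (ih.2 _ a ha n j hq) ?_
      obtain ⟨q1, q2⟩ := q
      match q1 with
      | 0 =>
        rw [(ih.1.2 rfl).1, mul_zero]
        exact zero_mem _
      | m + 1 =>
        have h := ι_mul_mem_tensorPiece ha (ih.1.1 m q2 rfl)
        have h' : ((1, i) : ℕ × ℕ) + (m, q2) = (n, j) := by
          simp only [Prod.ext_iff, Prod.fst_add, Prod.snd_add] at hq ⊢
          omega
        rw [h'] at h
        exact h
    · simp at h0
    · rcases mem_augBideg hb with rfl | ⟨hp, -⟩
      · simp
      rw [headSplit_ι_mul, barMulHead_tmul]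
      have h := ι_mul_mem_tensorPiece (augMul_mem_augBideg hb ha) ht
      have h' : ((1, p.2 + i) : ℕ × ℕ) + q = (n, j) := by
        simp only [Prod.ext_iff, Prod.fst_add, Prod.snd_add] at hq ⊢
        omega
      rw [h'] at h
      exact h
  · simp
  · rintro p t t' ⟨⟨h1, h2⟩, h3⟩ ⟨⟨h4, h5⟩, h6⟩
    refine ⟨⟨fun n j hq => ?_, fun h0 => ?_⟩, fun p b hb n j hq => ?_⟩
    · rw [map_add]; exact add_mem (h1 n j hq) (h4 n j hq)
    · rw [map_add, map_add, (h2 h0).1, (h2 h0).2, (h5 h0).1, (h5 h0).2, add_zero, add_zero]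
      exact ⟨rfl, rfl⟩
    · rw [map_add, map_add]; exact add_mem (h3 p b hb n j hq) (h6 p b hb n j hq)
  · rintro p a t ⟨⟨h1, h2⟩, h3⟩
    refine ⟨⟨fun n j hq => ?_, fun h0 => ?_⟩, fun p b hb n j hq => ?_⟩
    · rw [map_smul]; exact Submodule.smul_mem _ _ (h1 n j hq)
    · rw [map_smul, map_smul, (h2 h0).1, (h2 h0).2, smul_zero, smul_zero]
      exact ⟨rfl, rfl⟩
    · rw [map_smul, map_smul]; exact Submodule.smul_mem _ _ (h3 p b hb n j hq)

theorem barD_mem {n j : ℕ} {t : BarSpace 𝓡} (ht : t ∈ barPiece 𝓡 (n + 1) j) :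
    barD 𝓡 t ∈ barPiece 𝓡 n j :=
  (barD_mem_aux ht).1.1 n j rfl

theorem barD_eq_zero {j : ℕ} {t : BarSpace 𝓡} (ht : t ∈ barPiece 𝓡 0 j) : barD 𝓡 t = 0 :=
  ((barD_mem_aux ht).1.2 rfl).1

theorem headSplit_eq_zero {j : ℕ} {t : BarSpace 𝓡} (ht : t ∈ barPiece 𝓡 0 j) :
    headSplit t = 0 :=
  ((barD_mem_aux ht).1.2 rfl).2

variable (𝓡) in
/-- The tensors of length `n` in `T(R_+)`. -/
def barHom (n : ℕ) : Submodule k (BarSpace 𝓡) := ⨆ j, barPiece 𝓡 n j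

theorem barPiece_le_barHom (n j : ℕ) : barPiece 𝓡 n j ≤ barHom 𝓡 n := le_iSup (barPiece 𝓡 n) j

theorem barHom_isInternal (hR : IsStandardGraded 𝓡) : DirectSum.IsInternal (barHom 𝓡) :=
  (barPiece_isInternal hR).iSup_snd

theorem rTensor_headSplit_mem_freePiece (hR : IsStandardGraded 𝓡) (hR3 : 𝓡 3 = ⊥) {q : ℕ × ℕ}
    {t : BarSpace 𝓡} (ht : t ∈ tensorPiece (augBideg 𝓡) q) {n : ℕ} (hq : q.1 = n + 1) :
    LinearMap.rTensor (BarSpace 𝓡) (augPart 𝓡).subtype (headSplit t) ∈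
      freePiece 𝓡 (barHom 𝓡) 1 n ⊔ freePiece 𝓡 (barHom 𝓡) 2 n := by
  obtain ⟨ε, hε⟩ := hR.exists_isAugmentation
  refine tensorPiece_induction (P := fun q t => ∀ n, q.1 = n + 1 →
    LinearMap.rTensor (BarSpace 𝓡) (augPart 𝓡).subtype (headSplit t) ∈
      freePiece 𝓡 (barHom 𝓡) 1 n ⊔ freePiece 𝓡 (barHom 𝓡) 2 n) ?_ ?_ ?_ ?_ ?_ ht n hq
  · intro n hn
    simp at hn
  · intro p q a t ha ht _ n hn
    rcases mem_augBideg ha with rfl | ⟨hp, ha'⟩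
    · simp
    rw [Prod.fst_add, hp, add_comm, Nat.add_right_cancel_iff] at hn
    have ht' : t ∈ barHom 𝓡 n := barPiece_le_barHom n q.2 (by rw [← hn]; exact ht)
    rw [headSplit_ι_mul, LinearMap.rTensor_tmul, Submodule.subtype_apply]
    generalize p.2 = i at ha'
    match i with
    | 0 =>
      have h1 : ε a.1 = 0 := (hε.mem_augIdeal_iff hR).1 a.2
      rw [hR.connected] at ha'
      obtain ⟨c, hc⟩ := Submodule.mem_one.1 ha'
      rw [← hc, hε.map_algebraMap] at h1
      rw [← hc, h1, map_zero, TensorProduct.zero_tmul]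
      exact zero_mem _
    | 1 => exact Submodule.mem_sup_left (tmul_mem_freePiece ha' ht')
    | 2 => exact Submodule.mem_sup_right (tmul_mem_freePiece ha' ht')
    | i + 3 =>
      rw [hR.eq_bot hR3 (by omega), Submodule.mem_bot] at ha'
      rw [ha', TensorProduct.zero_tmul]
      exact zero_mem _
  · intro p n _
    simp
  · intro p t t' h h' n hn
    rw [map_add, map_add]
    exact add_mem (h n hn) (h' n hn)
  · intro p a t h n hn
    rw [map_smul, map_smul]
    exact Submodule.smul_mem _ _ (h n hn)

theorem barResD_isFreeComplex (hR : IsStandardGraded 𝓡) (hR3 : 𝓡 3 = ⊥) :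
    IsFreeComplex 𝓡 (barHom 𝓡) (barResD 𝓡) (-barD 𝓡) where
  map_mem n := by
    have : barHom 𝓡 (n + 1) ≤ (barHom 𝓡 n).comap (barD 𝓡) :=
      iSup_le fun j t ht => barPiece_le_barHom n j (barD_mem ht)
    exact fun t ht => neg_mem (this ht)
  map_zero := by
    have : barHom 𝓡 0 ≤ LinearMap.ker (barD 𝓡) := iSup_le fun j t ht => barD_eq_zero ht
    exact fun t ht => neg_eq_zero.2 (this ht)
  D_zero := by
    have : barHom 𝓡 0 ≤ LinearMap.ker ((barResD 𝓡).restrictScalars k ∘ₗ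
        TensorProduct.mk k R (BarSpace 𝓡) 1) := iSup_le fun j t ht => by
      change barResD 𝓡 (1 ⊗ₜ[k] t) = 0
      rw [barResD_tmul, headSplit_eq_zero ht, barD_eq_zero ht, map_zero, smul_zero,
        TensorProduct.tmul_zero, sub_zero]
    exact fun t ht => this ht
  D_sub_mem n := by
    have : barHom 𝓡 (n + 1) ≤ (freePiece 𝓡 (barHom 𝓡) 1 n ⊔ freePiece 𝓡 (barHom 𝓡) 2 n).comap
        (LinearMap.rTensor (BarSpace 𝓡) (augPart 𝓡).subtype ∘ₗ headSplit) :=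
      iSup_le fun j t ht => rTensor_headSplit_mem_freePiece hR hR3 ht rfl
    intro t ht
    rw [barResD_tmul, one_smul, LinearMap.neg_apply, TensorProduct.tmul_neg, sub_neg_eq_add,
      sub_add_cancel]
    exact this ht

end BarGrading

section KoszulSpace

variable {k R : Type*} [Field k] [Ring R] [Algebra k R] {𝓡 : ℕ → Submodule k R}
  {C : Type*} [AddCommGroup C] [Module k C] {𝒞 : ℕ × ℕ → Submodule k C} {β : C →ₗ[k] GKoszul 𝓡}

variable (𝓡) in
/-- The bigrading of `K`, where `K_n` has bidegree `(n, n)`. -/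
def koszulBideg (p : ℕ × ℕ) : Submodule k (koszulTotal 𝓡) :=
  ⨆ (n : ℕ) (_ : (n, n) = p), koszulPart 𝓡 n

variable (𝓡 𝒞) in
/-- The bigrading of `K ⊗ T(C) = k ⊗_R Y`. -/
def koszulSpacePiece (n j : ℕ) : Submodule k (koszulTotal 𝓡 ⊗[k] TensorAlgebra k C) :=
  ⨆ (p : ℕ × ℕ) (q : ℕ × ℕ) (_ : p + q = (n, j)),
    Submodule.map₂ (TensorProduct.mk k (koszulTotal 𝓡) (TensorAlgebra k C))
      (koszulBideg 𝓡 p) (tensorPiece 𝒞 q)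

theorem koszulPart_le_koszulBideg (n : ℕ) : koszulPart 𝓡 n ≤ koszulBideg 𝓡 (n, n) :=
  le_iSup₂_of_le n rfl le_rfl

theorem tmul_mem_koszulSpacePiece {m n j : ℕ} {q : ℕ × ℕ} (hq : (m, m) + q = (n, j))
    {κ : koszulTotal 𝓡} (hκ : κ ∈ koszulPart 𝓡 m) {t : TensorAlgebra k C}
    (ht : t ∈ tensorPiece 𝒞 q) : κ ⊗ₜ t ∈ koszulSpacePiece 𝓡 𝒞 n j := by
  have h : κ ⊗ₜ t ∈ Submodule.map₂ (TensorProduct.mk k (koszulTotal 𝓡) (TensorAlgebra k C))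
      (koszulBideg 𝓡 (m, m)) (tensorPiece 𝒞 q) :=
    Submodule.apply_mem_map₂ (TensorProduct.mk k (koszulTotal 𝓡) (TensorAlgebra k C))
      (koszulPart_le_koszulBideg m hκ) ht
  exact (le_iSup_of_le (m, m) (le_iSup_of_le q (le_iSup_of_le hq le_rfl)) :
    _ ≤ koszulSpacePiece 𝓡 𝒞 n j) h

theorem koszulSpacePiece_le {n j : ℕ} {S : Submodule k (koszulTotal 𝓡 ⊗[k] TensorAlgebra k C)}
    (h : ∀ m q, (m, m) + q = (n, j) → ∀ κ ∈ koszulPart 𝓡 m, ∀ t ∈ tensorPiece 𝒞 q, κ ⊗ₜ t ∈ S) :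
    koszulSpacePiece 𝓡 𝒞 n j ≤ S := by
  refine iSup_le fun p => iSup_le fun q => iSup_le fun hpq => Submodule.map₂_le.2 ?_
  intro κ hκ t ht
  have : koszulBideg 𝓡 p ≤ S.comap
      ((TensorProduct.mk k (koszulTotal 𝓡) (TensorAlgebra k C)).flip t) := by
    refine iSup₂_le fun m hm κ' hκ' => ?_
    subst hm
    exact h m q hpq κ' hκ' t ht
  exact this hκ

variable (𝓡 𝒞) in
/-- The part of homological degree `n` of `K ⊗ T(C)`. -/
def koszulSpaceHom (n : ℕ) : Submodule k (koszulTotal 𝓡 ⊗[k] TensorAlgebra k C) :=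
  ⨆ j, koszulSpacePiece 𝓡 𝒞 n j

theorem tmul_mem_koszulSpaceHom {m n : ℕ} {q : ℕ × ℕ} (hq : m + q.1 = n)
    {κ : koszulTotal 𝓡} (hκ : κ ∈ koszulPart 𝓡 m) {t : TensorAlgebra k C}
    (ht : t ∈ tensorPiece 𝒞 q) : κ ⊗ₜ t ∈ koszulSpaceHom 𝓡 𝒞 n :=
  (le_iSup (koszulSpacePiece 𝓡 𝒞 n) (m + q.2))
    (tmul_mem_koszulSpacePiece (Prod.ext hq rfl) hκ ht)

theorem koszulSpacePiece_isInternal (h𝒞 : DirectSum.IsInternal 𝒞) :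
    DirectSum.IsInternal fun p : ℕ × ℕ => koszulSpacePiece 𝓡 𝒞 p.1 p.2 := by
  obtain ⟨ι, b, deg, hb⟩ := (koszulPart_isInternal 𝓡).exists_isHomogeneousBasis
  exact (hb.coarsen fun n => (n, n)).isInternal.tensorProduct (isInternal_tensorPiece h𝒞)

theorem koszulSpaceHom_isInternal (h𝒞 : DirectSum.IsInternal 𝒞) :
    DirectSum.IsInternal (koszulSpaceHom 𝓡 𝒞) := by
  obtain ⟨ι, b, deg, hb⟩ := (koszulPart_isInternal 𝓡).exists_isHomogeneousBasis
  exact (hb.coarsen fun n => (n, n)).isInternal.tensorProduct_iSup_snd (isInternal_tensorPiece h𝒞)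

variable (𝓡 C) in
/-- The associativity isomorphism `(R ⊗ K) ⊗ T(C) = R ⊗ (K ⊗ T(C))`. -/
def koszulAssoc : GKoszul 𝓡 ⊗[k] TensorAlgebra k C ≃ₗ[R]
    R ⊗[k] (koszulTotal 𝓡 ⊗[k] TensorAlgebra k C) :=
  TensorProduct.AlgebraTensorModule.assoc k k R R (koszulTotal 𝓡) (TensorAlgebra k C)

@[simp] theorem koszulAssoc_tmul (r : R) (κ : koszulTotal 𝓡) (t : TensorAlgebra k C) :
    koszulAssoc 𝓡 C ((r ⊗ₜ κ) ⊗ₜ t) = r ⊗ₜ (κ ⊗ₜ t) := by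
  simp [koszulAssoc]

theorem koszulAssoc_smul (a : k) (y : GKoszul 𝓡 ⊗[k] TensorAlgebra k C) :
    koszulAssoc 𝓡 C (a • y) = a • koszulAssoc 𝓡 C y := by
  rw [← algebraMap_smul R, map_smul, algebraMap_smul]

theorem koszulAssoc_mem {i m n : ℕ} {q : ℕ × ℕ} (hq : m + q.1 = n) {x : GKoszul 𝓡}
    (hx : x ∈ gkPiece 𝓡 i m) {t : TensorAlgebra k C} (ht : t ∈ tensorPiece 𝒞 q) :
    koszulAssoc 𝓡 C (x ⊗ₜ t) ∈
      freePiece (V := koszulTotal 𝓡 ⊗[k] TensorAlgebra k C) 𝓡 (koszulSpaceHom 𝓡 𝒞) i n := by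
  have : gkPiece 𝓡 i m ≤
      (freePiece (V := koszulTotal 𝓡 ⊗[k] TensorAlgebra k C) 𝓡 (koszulSpaceHom 𝓡 𝒞) i n).comap
      ((koszulAssoc 𝓡 C).toLinearMap.restrictScalars k ∘ₗ
        (TensorProduct.mk k (GKoszul 𝓡) (TensorAlgebra k C)).flip t) := by
    refine gkPiece_le 𝓡 fun r hr κ hκ => ?_
    change koszulAssoc 𝓡 C ((r ⊗ₜ[k] κ) ⊗ₜ[k] t) ∈
      freePiece (V := koszulTotal 𝓡 ⊗[k] TensorAlgebra k C) 𝓡 (koszulSpaceHom 𝓡 𝒞) i n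
    rw [koszulAssoc_tmul]
    exact tmul_mem_freePiece hr (tmul_mem_koszulSpaceHom hq hκ ht)
  exact this hx

end KoszulSpace

/-! ### `Tor` is the reduction of the minimal resolution -/

section KoszulSpaceComplex

variable {k R : Type*} [Field k] [Ring R] [Algebra k R] {𝓡 : ℕ → Submodule k R} [GradedAlgebra 𝓡]
  {C : Type*} [AddCommGroup C] [Module k C] {𝒞 : ℕ × ℕ → Submodule k C} {β : C →ₗ[k] GKoszul 𝓡}

/-- The differential of `GK_R ⊗ T(C)`, seen as a free module `R ⊗ (K ⊗ T(C))`. -/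
def koszulSpaceD (β : C →ₗ[k] GKoszul 𝓡) : R ⊗[k] (koszulTotal 𝓡 ⊗[k] TensorAlgebra k C) →ₗ[R]
    R ⊗[k] (koszulTotal 𝓡 ⊗[k] TensorAlgebra k C) :=
  (koszulAssoc 𝓡 C).toLinearMap ∘ₗ koszulLiftD β ∘ₗ (koszulAssoc 𝓡 C).symm.toLinearMap

omit [GradedAlgebra 𝓡] in
theorem koszulSpaceD_koszulAssoc (y : GKoszul 𝓡 ⊗[k] TensorAlgebra k C) :
    koszulSpaceD β (koszulAssoc 𝓡 C y) = koszulAssoc 𝓡 C (koszulLiftD β y) := by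
  simp [koszulSpaceD]

omit [GradedAlgebra 𝓡] in
theorem koszulLiftD_tmul_of_eq_zero {x : GKoszul 𝓡} (hx : gkAug 𝓡 x = 0) (t : TensorAlgebra k C) :
    koszulLiftD β (x ⊗ₜ t) = gkD 𝓡 x ⊗ₜ t := by
  rw [koszulLiftD_tmul, hx, zero_smul, add_zero]

omit [GradedAlgebra 𝓡] in
theorem koszulSpaceD_tmul_of_mem {n : ℕ} {r : R} {κ : koszulTotal 𝓡} (hκ : κ ∈ koszulPart 𝓡 (n + 1))
    (t : TensorAlgebra k C) :
    koszulSpaceD β (r ⊗ₜ (κ ⊗ₜ t)) = koszulAssoc 𝓡 C (gkD 𝓡 (r ⊗ₜ κ) ⊗ₜ t) := by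
  have h : gkAug 𝓡 (r ⊗ₜ κ) = 0 := by
    rw [gkAug_tmul, algebraMapInv_of_mem_koszulPart_succ hκ, zero_smul]
  rw [← koszulAssoc_tmul, koszulSpaceD_koszulAssoc, koszulLiftD_tmul_of_eq_zero h]

omit [GradedAlgebra 𝓡] in
theorem koszulSpaceD_koszulOne (t : TensorAlgebra k C) :
    koszulSpaceD β (1 ⊗ₜ (koszulOne 𝓡 ⊗ₜ t)) =
      koszulAssoc 𝓡 C (LinearMap.rTensor (TensorAlgebra k C) β (headSplit t)) := by
  have h1 : gkAug 𝓡 ((1 : R) ⊗ₜ koszulOne 𝓡) = 1 := by simp [koszulOne]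
  have h2 : gkD 𝓡 ((1 : R) ⊗ₜ koszulOne 𝓡) = 0 := by simp [gkD_tmul]
  rw [← koszulAssoc_tmul, koszulSpaceD_koszulAssoc, koszulLiftD_tmul, h1, h2,
    TensorProduct.zero_tmul, zero_add, one_smul]

omit [GradedAlgebra 𝓡] in
theorem koszulAssoc_rTensor_headSplit_mem (h : IsKoszulLift 𝒞 β) {q : ℕ × ℕ}
    {t : TensorAlgebra k C} (ht : t ∈ tensorPiece 𝒞 q) :
    (∀ n, q.1 = n + 1 →
      koszulAssoc 𝓡 C (LinearMap.rTensor (TensorAlgebra k C) β (headSplit t)) ∈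
        freePiece (V := koszulTotal 𝓡 ⊗[k] TensorAlgebra k C) 𝓡 (koszulSpaceHom 𝓡 𝒞) 2 n) ∧
    (q.1 = 0 → LinearMap.rTensor (TensorAlgebra k C) β (headSplit t) = 0) := by
  refine ⟨fun n hn => ?_, (rTensor_headSplit_mem h ht).2⟩
  refine tensorPiece_induction (P := fun q t => ∀ n, q.1 = n + 1 →
      koszulAssoc 𝓡 C (LinearMap.rTensor (TensorAlgebra k C) β (headSplit t)) ∈
        freePiece (V := koszulTotal 𝓡 ⊗[k] TensorAlgebra k C) 𝓡 (koszulSpaceHom 𝓡 𝒞) 2 n)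
    ?_ ?_ ?_ ?_ ?_ ht n hn
  · intro n hn
    simp at hn
  · intro p q c t hc ht _ n hn
    rw [headSplit_ι_mul, LinearMap.rTensor_tmul]
    by_cases hp : ∀ n, p ≠ (n + 2, n + 3)
    · rw [h.eq_bot p hp, Submodule.mem_bot] at hc
      rw [hc, map_zero, TensorProduct.zero_tmul, map_zero]
      exact zero_mem _
    · push Not at hp
      obtain ⟨m, rfl⟩ := hp
      refine koszulAssoc_mem (m := m + 1) ?_ (h.mem m c hc) ht
      simp only [Prod.fst_add] at hn
      omega
  · intro p n _
    rw [map_zero, map_zero, map_zero]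
    exact zero_mem _
  · intro p t t' h h' n hn
    rw [map_add, map_add, map_add]
    exact add_mem (h n hn) (h' n hn)
  · intro p a t h n hn
    rw [map_smul, map_smul, koszulAssoc_smul]
    exact Submodule.smul_mem _ _ (h n hn)

theorem koszulSpaceD_one_tmul_mem (h : IsKoszulLift 𝒞 β) {m : ℕ} {q : ℕ × ℕ}
    {κ : koszulTotal 𝓡} (hκ : κ ∈ koszulPart 𝓡 m) {t : TensorAlgebra k C}
    (ht : t ∈ tensorPiece 𝒞 q) :
    (∀ n, m + q.1 = n + 1 → koszulSpaceD β (1 ⊗ₜ (κ ⊗ₜ t)) ∈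
      freePiece (V := koszulTotal 𝓡 ⊗[k] TensorAlgebra k C) 𝓡 (koszulSpaceHom 𝓡 𝒞) 1 n ⊔
      freePiece (V := koszulTotal 𝓡 ⊗[k] TensorAlgebra k C) 𝓡 (koszulSpaceHom 𝓡 𝒞) 2 n) ∧
    (m + q.1 = 0 → koszulSpaceD β (1 ⊗ₜ (κ ⊗ₜ t)) = 0) := by
  match m with
  | 0 =>
    obtain ⟨a, rfl⟩ := exists_smul_koszulOne 𝓡 hκ
    have h1 : koszulSpaceD β ((1 : R) ⊗ₜ ((a • koszulOne 𝓡) ⊗ₜ t)) =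
        a • koszulAssoc 𝓡 C (LinearMap.rTensor (TensorAlgebra k C) β (headSplit t)) := by
      rw [← TensorProduct.smul_tmul', TensorProduct.tmul_smul, LinearMap.map_smul_of_tower,
        koszulSpaceD_koszulOne]
    rw [h1, zero_add]
    constructor
    · intro n hn
      exact Submodule.smul_mem _ _
        (Submodule.mem_sup_right ((koszulAssoc_rTensor_headSplit_mem h ht).1 n hn))
    · intro hn
      rw [(koszulAssoc_rTensor_headSplit_mem h ht).2 hn, map_zero, smul_zero]
  | m + 1 =>
    rw [koszulSpaceD_tmul_of_mem hκ]
    refine ⟨fun n hn => Submodule.mem_sup_left ?_, fun hn => by omega⟩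
    exact koszulAssoc_mem (m := m) (by omega)
      (gkD_mem 𝓡 (tmul_mem_gkPiece 𝓡 SetLike.GradedOne.one_mem hκ)) ht

theorem koszulSpaceD_isFreeComplex (h : IsKoszulLift 𝒞 β) :
    IsFreeComplex (V := koszulTotal 𝓡 ⊗[k] TensorAlgebra k C) 𝓡 (koszulSpaceHom 𝓡 𝒞)
      (koszulSpaceD β) 0 := by
  constructor
  · exact fun n v _ => zero_mem _
  · exact fun v _ => rfl
  · have : koszulSpaceHom 𝓡 𝒞 0 ≤ LinearMap.ker ((koszulSpaceD β).restrictScalars k ∘ₗ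
        TensorProduct.mk k R (koszulTotal 𝓡 ⊗[k] TensorAlgebra k C) 1) :=
      iSup_le fun j => koszulSpacePiece_le fun m q hq κ hκ t ht =>
        (koszulSpaceD_one_tmul_mem h hκ ht).2 (congrArg Prod.fst hq)
    exact fun v hv => this hv
  · intro n
    have : koszulSpaceHom 𝓡 𝒞 (n + 1) ≤ (freePiece (V := koszulTotal 𝓡 ⊗[k] TensorAlgebra k C) 𝓡
        (koszulSpaceHom 𝓡 𝒞) 1 n ⊔ freePiece (V := koszulTotal 𝓡 ⊗[k] TensorAlgebra k C) 𝓡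
        (koszulSpaceHom 𝓡 𝒞) 2 n).comap ((koszulSpaceD β).restrictScalars k ∘ₗ
        TensorProduct.mk k R (koszulTotal 𝓡 ⊗[k] TensorAlgebra k C) 1) :=
      iSup_le fun j => koszulSpacePiece_le fun m q hq κ hκ t ht =>
        (koszulSpaceD_one_tmul_mem h hκ ht).1 n (congrArg Prod.fst hq)
    intro v hv
    rw [LinearMap.zero_apply, TensorProduct.tmul_zero, sub_zero]
    exact this hv

theorem koszulSpaceD_koszulSpaceD (h : IsKoszulLift 𝒞 β) (hR : IsStandardGraded 𝓡) (hR3 : 𝓡 3 = ⊥)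
    (y : R ⊗[k] (koszulTotal 𝓡 ⊗[k] TensorAlgebra k C)) :
    koszulSpaceD β (koszulSpaceD β y) = 0 := by
  obtain ⟨y, rfl⟩ := (koszulAssoc 𝓡 C).surjective y
  rw [koszulSpaceD_koszulAssoc, koszulSpaceD_koszulAssoc, koszulLiftD_koszulLiftD h hR hR3,
    map_zero]

theorem exists_of_koszulSpaceD_eq_zero (h : IsKoszulLift 𝒞 β) (hR : IsStandardGraded 𝓡)
    (hR3 : 𝓡 3 = ⊥) (y : R ⊗[k] (koszulTotal 𝓡 ⊗[k] TensorAlgebra k C))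
    (hy : koszulSpaceD β y = 0) :
    ∃ z, ∃ a : k, y = koszulSpaceD β z + a • (1 ⊗ₜ (koszulOne 𝓡 ⊗ₜ 1)) := by
  obtain ⟨y, rfl⟩ := (koszulAssoc 𝓡 C).surjective y
  rw [koszulSpaceD_koszulAssoc, LinearEquiv.map_eq_zero_iff] at hy
  obtain ⟨z, a, rfl⟩ := exists_of_koszulLiftD_eq_zero h hR hR3 hy
  refine ⟨koszulAssoc 𝓡 C z, a, ?_⟩
  rw [koszulSpaceD_koszulAssoc, map_add, koszulAssoc_smul, gkOne, koszulAssoc_tmul]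

/-! ### The comparison map commutes with the differentials -/

theorem barIncl_mem {n : ℕ} {x : TensorAlgebra k (𝓡 1)} (hx : x ∈ tensorGen 𝓡 ^ n) :
    barIncl 𝓡 x ∈ barPiece 𝓡 n n := by
  induction n generalizing x with
  | zero =>
    rw [pow_zero] at hx
    obtain ⟨a, rfl⟩ := Submodule.mem_one.1 hx
    rw [AlgHom.commutes, Algebra.algebraMap_eq_smul_one]
    exact Submodule.smul_mem _ _ one_mem_tensorPiece
  | succ n ih =>
    rw [pow_succ'] at hx
    induction hx using Submodule.mul_induction_on' with
    | mem_mul_mem m hm y hy =>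
      obtain ⟨v, rfl⟩ := hm
      have hv : augIncl 𝓡 v ∈ augBideg 𝓡 (1, 1) := mem_augBideg_one v.2
      have h : TensorAlgebra.ι k (augIncl 𝓡 v) * barIncl 𝓡 y ∈
          tensorPiece (augBideg 𝓡) ((1, 1) + (n, n)) := ι_mul_mem_tensorPiece hv (ih hy)
      rw [Prod.mk_add_mk, add_comm] at h
      rw [map_mul, barIncl_ι]
      exact h
    | add a _ b _ ha hb => rw [map_add]; exact add_mem ha hb

theorem gkToBar_mem {ε : R →ₗ[k] k} (hε : IsAugmentation 𝓡 ε) (hR : IsStandardGraded 𝓡) {n : ℕ}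
    {x : GKoszul 𝓡} (hx : x ∈ gkPiece 𝓡 2 n) : gkToBar hε hR x ∈ barPiece 𝓡 (n + 1) (n + 2) := by
  have : gkPiece 𝓡 2 n ≤ (barPiece 𝓡 (n + 1) (n + 2)).comap (gkToBar hε hR) := by
    refine gkPiece_le 𝓡 fun r hr κ hκ => ?_
    have hr' : augProj hε hR r ∈ augBideg 𝓡 (1, 2) := mem_augBideg_one (by
      rwa [augProj_of_eq_zero hε hR (hε.map_succ 1 r hr)])
    have h : TensorAlgebra.ι k (augProj hε hR r) * barIncl 𝓡 κ ∈
        tensorPiece (augBideg 𝓡) ((1, 2) + (n, n)) :=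
      ι_mul_mem_tensorPiece hr' (barIncl_mem (koszulK_le_pow 𝓡 n hκ))
    rw [Prod.mk_add_mk, add_comm, add_comm 2] at h
    rw [Submodule.mem_comap, gkToBar_tmul]
    exact h
  exact this hx

theorem barGamma_mem (h : IsKoszulLift 𝒞 β) {ε : R →ₗ[k] k} (hε : IsAugmentation 𝓡 ε)
    (hR : IsStandardGraded 𝓡) {q : ℕ × ℕ} {t : TensorAlgebra k C} (ht : t ∈ tensorPiece 𝒞 q) :
    barGamma β hε hR t ∈ tensorPiece (augBideg 𝓡) q := by
  refine tensorPiece_induction (P := fun q t => barGamma β hε hR t ∈ tensorPiece (augBideg 𝓡) q)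
    ?_ ?_ ?_ ?_ ?_ ht
  · rw [map_one]; exact one_mem_tensorPiece
  · intro p q c t hc _ ih
    rw [barGamma_ι_mul]
    by_cases hp : ∀ n, p ≠ (n + 2, n + 3)
    · rw [h.eq_bot p hp, Submodule.mem_bot] at hc
      rw [hc, map_zero, map_zero, zero_mul]
      exact zero_mem _
    · push Not at hp
      obtain ⟨m, rfl⟩ := hp
      exact mul_mem_tensorPiece (gkToBar_mem hε hR (h.mem m c hc)) ih
  · intro p; rw [map_zero]; exact zero_mem _
  · intro p t t' ht ht'; rw [map_add]; exact add_mem ht ht'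
  · intro p a t ht; rw [map_smul]; exact Submodule.smul_mem _ _ ht

theorem koszulToBar_mem (h : IsKoszulLift 𝒞 β) {ε : R →ₗ[k] k} (hε : IsAugmentation 𝓡 ε)
    (hR : IsStandardGraded 𝓡) {n j : ℕ} {w : koszulTotal 𝓡 ⊗[k] TensorAlgebra k C}
    (hw : w ∈ koszulSpacePiece 𝓡 𝒞 n j) : koszulToBar β hε hR w ∈ barPiece 𝓡 n j := by
  have : koszulSpacePiece 𝓡 𝒞 n j ≤ (barPiece 𝓡 n j).comap (koszulToBar β hε hR) := by
    refine koszulSpacePiece_le fun m q hq κ hκ t ht => ?_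
    rw [Submodule.mem_comap, koszulToBar_tmul, barPiece, ← hq]
    exact mul_mem_tensorPiece (barIncl_mem (koszulK_le_pow 𝓡 m hκ)) (barGamma_mem h hε hR ht)
  exact this hw

theorem koszulToBar_mem_barHom (h : IsKoszulLift 𝒞 β) {ε : R →ₗ[k] k} (hε : IsAugmentation 𝓡 ε)
    (hR : IsStandardGraded 𝓡) (n : ℕ) (w : koszulTotal 𝓡 ⊗[k] TensorAlgebra k C)
    (hw : w ∈ koszulSpaceHom 𝓡 𝒞 n) : koszulToBar β hε hR w ∈ barHom 𝓡 n := by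
  have : koszulSpaceHom 𝓡 𝒞 n ≤ (barHom 𝓡 n).comap (koszulToBar β hε hR) :=
    iSup_le fun j w hw => barPiece_le_barHom n j (koszulToBar_mem h hε hR hw)
  exact this hw

/-- The map `1 ⊗ (κ ⊗ t ↦ κ γ(t))` from `R ⊗ (K ⊗ T(C))` to the bar resolution. -/
abbrev koszulToBarRes (β : C →ₗ[k] GKoszul 𝓡) {ε : R →ₗ[k] k} (hε : IsAugmentation 𝓡 ε)
    (hR : IsStandardGraded 𝓡) :
    R ⊗[k] (koszulTotal 𝓡 ⊗[k] TensorAlgebra k C) →ₗ[R] R ⊗[k] BarSpace 𝓡 :=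
  TensorProduct.AlgebraTensorModule.lTensor R R (koszulToBar β hε hR)

theorem koszulToBarRes_tmul {ε : R →ₗ[k] k} (hε : IsAugmentation 𝓡 ε) (hR : IsStandardGraded 𝓡)
    (r : R) (κ : koszulTotal 𝓡) (t : TensorAlgebra k C) :
    koszulToBarRes β hε hR (r ⊗ₜ (κ ⊗ₜ t)) = r ⊗ₜ (barIncl 𝓡 κ * barGamma β hε hR t) := by
  simp [koszulToBarRes]

/-- Splitting off the first letter of `κ γ(t)` for `κ ∈ K_n`, `n > 0`. -/
theorem rTensor_headSplit_barIncl_mul {ε : R →ₗ[k] k} (hε : IsAugmentation 𝓡 ε)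
    (hR : IsStandardGraded 𝓡) (z : 𝓡 1 ⊗[k] koszulTotal 𝓡) (t : TensorAlgebra k C) :
    LinearMap.rTensor (BarSpace 𝓡) (augPart 𝓡).subtype (headSplit
      (barIncl 𝓡 (headJoin (LinearMap.lTensor (𝓡 1) (koszulTotal 𝓡).subtype z)) *
        barGamma β hε hR t)) =
    koszulToBarRes β hε hR (koszulAssoc 𝓡 C
      (LinearMap.rTensor (koszulTotal 𝓡) (𝓡 1).subtype z ⊗ₜ t)) := by
  induction z using TensorProduct.induction_on with
  | zero => simp only [map_zero, zero_mul, TensorProduct.zero_tmul]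
  | tmul v κ =>
    rw [LinearMap.lTensor_tmul, headJoin_tmul, map_mul (barIncl 𝓡), barIncl_ι, mul_assoc,
      headSplit_ι_mul, LinearMap.rTensor_tmul, LinearMap.rTensor_tmul, koszulAssoc_tmul,
      koszulToBarRes_tmul]
    rfl
  | add x y hx hy => simp only [map_add, add_mul, TensorProduct.add_tmul, hx, hy]

/-- Splitting off the first letter of `γ(c) γ(t)`. -/
theorem rTensor_headSplit_gkToBar_mul {ε : R →ₗ[k] k} (hε : IsAugmentation 𝓡 ε)
    (hR : IsStandardGraded 𝓡) {n : ℕ} {x : GKoszul 𝓡} (hx : x ∈ gkPiece 𝓡 2 n)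
    (t : TensorAlgebra k C) :
    LinearMap.rTensor (BarSpace 𝓡) (augPart 𝓡).subtype
      (headSplit (gkToBar hε hR x * barGamma β hε hR t)) =
    koszulToBarRes β hε hR (koszulAssoc 𝓡 C (x ⊗ₜ t)) := by
  have : gkPiece 𝓡 2 n ≤ LinearMap.ker
      (LinearMap.rTensor (BarSpace 𝓡) (augPart 𝓡).subtype ∘ₗ headSplit ∘ₗ
        LinearMap.mulRight k (barGamma β hε hR t) ∘ₗ gkToBar hε hR -
      (koszulToBarRes β hε hR ∘ₗ (koszulAssoc 𝓡 C).toLinearMap).restrictScalars k ∘ₗ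
        (TensorProduct.mk k (GKoszul 𝓡) (TensorAlgebra k C)).flip t) := by
    refine gkPiece_le 𝓡 fun r hr κ hκ => ?_
    refine sub_eq_zero.2 ?_
    change LinearMap.rTensor (BarSpace 𝓡) (augPart 𝓡).subtype
      (headSplit (gkToBar hε hR (r ⊗ₜ[k] κ) * barGamma β hε hR t)) =
      koszulToBarRes β hε hR (koszulAssoc 𝓡 C ((r ⊗ₜ[k] κ) ⊗ₜ[k] t))
    rw [gkToBar_tmul, mul_assoc, headSplit_ι_mul, LinearMap.rTensor_tmul, koszulAssoc_tmul,
      koszulToBarRes_tmul, Submodule.subtype_apply,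
      augProj_of_eq_zero hε hR (hε.map_succ 1 r hr)]
  exact sub_eq_zero.1 (this hx)

theorem rTensor_headSplit_barGamma (h : IsKoszulLift 𝒞 β) {ε : R →ₗ[k] k}
    (hε : IsAugmentation 𝓡 ε) (hR : IsStandardGraded 𝓡) (t : TensorAlgebra k C) :
    LinearMap.rTensor (BarSpace 𝓡) (augPart 𝓡).subtype (headSplit (barGamma β hε hR t)) =
      koszulToBarRes β hε hR (koszulAssoc 𝓡 C
        (LinearMap.rTensor (TensorAlgebra k C) β (headSplit t))) := by
  refine TensorAlgebra.eq_of_forall_ι_mul h.isInternal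
    (f := LinearMap.rTensor (BarSpace 𝓡) (augPart 𝓡).subtype ∘ₗ headSplit ∘ₗ
      (barGamma β hε hR).toLinearMap)
    (g := (koszulToBarRes β hε hR ∘ₗ (koszulAssoc 𝓡 C).toLinearMap).restrictScalars k ∘ₗ
      LinearMap.rTensor (TensorAlgebra k C) β ∘ₗ headSplit) ?_ ?_ t
  · rw [LinearMap.comp_apply, LinearMap.comp_apply, LinearMap.comp_apply, LinearMap.comp_apply,
      AlgHom.toLinearMap_apply, map_one, headSplit_one, headSplit_one, map_zero, map_zero, map_zero]
  · intro p c hc t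
    by_cases hp : ∀ n, p ≠ (n + 2, n + 3)
    · rw [h.eq_bot p hp, Submodule.mem_bot] at hc
      rw [hc, map_zero, zero_mul, map_zero, map_zero]
    · push Not at hp
      obtain ⟨m, rfl⟩ := hp
      change LinearMap.rTensor (BarSpace 𝓡) (augPart 𝓡).subtype
        (headSplit (barGamma β hε hR (TensorAlgebra.ι k c * t))) =
        koszulToBarRes β hε hR (koszulAssoc 𝓡 C (LinearMap.rTensor (TensorAlgebra k C) β
          (headSplit (TensorAlgebra.ι k c * t))))
      rw [barGamma_ι_mul, headSplit_ι_mul, LinearMap.rTensor_tmul,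
        rTensor_headSplit_gkToBar_mul hε hR (h.mem m c hc) t]

theorem barResD_koszulToBarRes (h : IsKoszulLift 𝒞 β) (hR3 : 𝓡 3 = ⊥) {ε : R →ₗ[k] k}
    (hε : IsAugmentation 𝓡 ε) (hR : IsStandardGraded 𝓡)
    (y : R ⊗[k] (koszulTotal 𝓡 ⊗[k] TensorAlgebra k C)) :
    barResD 𝓡 (koszulToBarRes β hε hR y) = koszulToBarRes β hε hR (koszulSpaceD β y) := by
  refine eq_of_forall_one_tmul (koszulPart_isInternal 𝓡)
    (f := barResD 𝓡 ∘ₗ koszulToBarRes β hε hR) (g := koszulToBarRes β hε hR ∘ₗ koszulSpaceD β) ?_ y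
  intro n κ hκ t
  change barResD 𝓡 (koszulToBarRes β hε hR (1 ⊗ₜ[k] (κ ⊗ₜ[k] t))) =
    koszulToBarRes β hε hR (koszulSpaceD β (1 ⊗ₜ[k] (κ ⊗ₜ[k] t)))
  have hc := h.barD_koszulToBar hR3 hε hR (κ ⊗ₜ t)
  rw [koszulToBar_tmul] at hc
  rw [koszulToBarRes_tmul, barResD_tmul, hc, TensorProduct.tmul_zero, sub_zero, one_smul]
  match n with
  | 0 =>
    obtain ⟨a, rfl⟩ := exists_smul_koszulOne 𝓡 hκ
    have h1 : barIncl 𝓡 ((a • koszulOne 𝓡 : koszulTotal 𝓡) : TensorAlgebra k (𝓡 1)) = a • 1 := by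
      rw [Submodule.coe_smul, map_smul]
      exact congrArg (a • ·) (map_one (barIncl 𝓡))
    rw [← TensorProduct.smul_tmul', TensorProduct.tmul_smul, LinearMap.map_smul_of_tower,
      LinearMap.map_smul_of_tower, koszulSpaceD_koszulOne, h1, smul_mul_assoc, one_mul, map_smul,
      map_smul, rTensor_headSplit_barGamma h hε hR]
  | n + 1 =>
    have h1 := headJoin_headSplit (κ : TensorAlgebra k (𝓡 1))
    rw [algebraMapInv_of_mem_koszulPart_succ hκ, map_zero, add_zero, ← koszulSplit_spec] at h1
    rw [koszulSpaceD_tmul_of_mem hκ, gkD_tmul, one_smul, ← rTensor_headSplit_barIncl_mul, h1]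

/-- The elements `κ γ(t)` of the bar construction represent every homology class exactly once: a
combination of them that is a boundary vanishes, and every cycle differs from such a combination by
a boundary. -/
theorem eq_zero_and_exists_of_barD_eq (h : IsKoszulLift 𝒞 β) (hR3 : 𝓡 3 = ⊥) {ε : R →ₗ[k] k}
    (hε : IsAugmentation 𝓡 ε) (hR : IsStandardGraded 𝓡) {t : BarSpace 𝓡}
    {w : koszulTotal 𝓡 ⊗[k] TensorAlgebra k C} (ht : barD 𝓡 t = koszulToBar β hε hR w) :
    w = 0 ∧ ∃ t' w', t = barD 𝓡 t' - koszulToBar β hε hR w' := by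
  have key : w = 0 ∧ ∃ t' w', -t = (-barD 𝓡) t' + koszulToBar β hε hR w' := by
    apply exists_of_comparison (k := k) (V := BarSpace 𝓡)
      (W := koszulTotal 𝓡 ⊗[k] TensorAlgebra k C) hR hR3
      (𝒱 := barHom 𝓡) (𝒲 := koszulSpaceHom 𝓡 𝒞) (δ := barResD 𝓡) (d := koszulSpaceD β)
      (g := koszulToBar β hε hR)
      (f := -barD 𝓡) (e := 1 ⊗ₜ 1) (e' := 1 ⊗ₜ (koszulOne 𝓡 ⊗ₜ 1)) (η := barEps ε)
    · exact barHom_isInternal hR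
    · exact koszulSpaceHom_isInternal h.isInternal
    · exact barResD_isFreeComplex hR hR3
    · exact koszulSpaceD_isFreeComplex h
    · exact koszulToBar_mem_barHom h hε hR
    · exact barResD_barResD 𝓡
    · exact koszulSpaceD_koszulSpaceD h hR hR3
    · intro x hx
      have := barContr_homotopy hε hR x
      rw [hx, map_zero, add_zero] at this
      exact ⟨_, _, this.symm⟩
    · exact exists_of_koszulSpaceD_eq_zero h hR hR3
    · exact barResD_koszulToBarRes h hR3 hε hR
    · refine (koszulToBarRes_tmul hε hR 1 (koszulOne 𝓡) 1).trans ?_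
      rw [map_one, mul_one]
      exact congrArg (fun x => (1 : R) ⊗ₜ[k] x) (map_one (barIncl 𝓡))
    · exact (koszulSpaceD_one_tmul_mem h (koszulOne_mem 𝓡) one_mem_tensorPiece).2 rfl
    · exact barEps_barResD hε hR
    · rw [barEps_tmul, hε.map_one, map_one, mul_one]
    · rw [LinearMap.neg_apply, map_neg, neg_neg, ht]
  obtain ⟨h1, t', w', h2⟩ := key
  exact ⟨h1, t', w', by rw [← neg_neg t, h2, LinearMap.neg_apply, neg_add, neg_neg, sub_eq_add_neg]⟩

end KoszulSpaceComplex

/-! ### The dimensions of `Tor` and `Ext` -/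

section Homology

variable {k : Type*} [Field k] {M W : Type*} [AddCommGroup M] [Module k M] [AddCommGroup W]
  [Module k W]

theorem DirectSum.IsInternal.comp_lowering_fst {𝒜 : ℕ → ℕ → Submodule k M}
    (h : DirectSum.IsInternal fun p : ℕ × ℕ => 𝒜 p.1 p.2) {d : M →ₗ[k] M}
    (hd : ∀ n j, ∀ x ∈ 𝒜 (n + 1) j, d x ∈ 𝒜 n j) (hd0 : ∀ j, ∀ x ∈ 𝒜 0 j, d x = 0) (n j : ℕ)
    (x : M) : h.comp (n, j) (d x) = d (h.comp (n + 1, j) x) := by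
  refine h.comp_map h d (hd n j) ?_ x
  rintro ⟨m, i⟩ hm y hy
  match m with
  | 0 => rw [hd0 i y hy, map_zero]
  | m + 1 =>
    refine h.comp_of_mem_ne (g := (m, i)) (hd m i y hy) ?_
    simpa using hm

theorem DirectSum.IsInternal.d_comp_eq_zero {𝒜 : ℕ → ℕ → Submodule k M}
    (h : DirectSum.IsInternal fun p : ℕ × ℕ => 𝒜 p.1 p.2) {d : M →ₗ[k] M}
    (hd : ∀ n j, ∀ x ∈ 𝒜 (n + 1) j, d x ∈ 𝒜 n j) (hd0 : ∀ j, ∀ x ∈ 𝒜 0 j, d x = 0) (n j : ℕ)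
    {x : M} (hx : d x = 0) : d (h.comp (n, j) x) = 0 := by
  match n with
  | 0 => exact hd0 j _ (h.comp_mem (0, j) x)
  | n + 1 => rw [← h.comp_lowering_fst hd hd0, hx, map_zero]

/-- If the cycles `g(w)` represent every homology class of `(M, d)` exactly once, then `g` computes
the dimensions of the homogeneous parts of the homology. -/
theorem finrank_homologyAt_eq {𝒜 : ℕ → ℕ → Submodule k M} {ℬ : ℕ → ℕ → Submodule k W}
    (h : DirectSum.IsInternal fun p : ℕ × ℕ => 𝒜 p.1 p.2)
    (h' : DirectSum.IsInternal fun p : ℕ × ℕ => ℬ p.1 p.2) {d : M →ₗ[k] M}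
    (hd : ∀ n j, ∀ x ∈ 𝒜 (n + 1) j, d x ∈ 𝒜 n j) (hd0 : ∀ j, ∀ x ∈ 𝒜 0 j, d x = 0)
    {g : W →ₗ[k] M} (hg : ∀ n j, ∀ w ∈ ℬ n j, g w ∈ 𝒜 n j) (hdg : ∀ w, d (g w) = 0)
    (hex : ∀ t w, d t = g w → w = 0 ∧ ∃ t' w', t = d t' - g w') (n j : ℕ) :
    Module.finrank k (HomologyAt d (𝒜 n j)) = Module.finrank k (ℬ n j) := by
  have hcg : ∀ w, h.comp (n, j) (g w) = g (h'.comp (n, j) w) :=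
    h'.comp_map h g (hg n j) fun i hi w hw => h.comp_of_mem_ne (hg i.1 i.2 w hw) hi
  let φ : ℬ n j →ₗ[k] ↥(LinearMap.ker d ⊓ 𝒜 n j) :=
    LinearMap.codRestrict _ (g ∘ₗ (ℬ n j).subtype) fun w => ⟨hdg w, hg n j w w.2⟩
  let Φ : ℬ n j →ₗ[k] HomologyAt d (𝒜 n j) := Submodule.mkQ _ ∘ₗ φ
  refine (LinearEquiv.ofBijective Φ ⟨?_, ?_⟩).finrank_eq.symm
  · rw [← LinearMap.ker_eq_bot, eq_bot_iff]
    intro w hw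
    have hw' : φ w ∈ (LinearMap.range d).comap (LinearMap.ker d ⊓ 𝒜 n j).subtype :=
      (Submodule.Quotient.mk_eq_zero _).1 hw
    obtain ⟨t, ht⟩ := hw'
    exact Subtype.ext (hex t w ht).1
  · intro y
    obtain ⟨z, rfl⟩ := Submodule.mkQ_surjective _ y
    have hz : d z.1 = g 0 := by rw [map_zero]; exact z.2.1
    obtain ⟨-, t, w, htw⟩ := hex z.1 0 hz
    refine ⟨-⟨h'.comp (n, j) w, h'.comp_mem (n, j) w⟩, ?_⟩
    refine (Submodule.Quotient.eq _).2 ⟨-h.comp (n + 1, j) t, ?_⟩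
    have h1 := congrArg (h.comp (n, j)) htw
    rw [h.comp_of_mem (g := (n, j)) z.2.2, map_sub, h.comp_lowering_fst hd hd0, hcg] at h1
    change d (-h.comp (n + 1, j) t) = g (-h'.comp (n, j) w) - z.1
    rw [h1, map_neg, map_neg]
    abel

theorem finrank_quotient_eq_of_range_eq_dualAnnihilator {A Z : Type*} [AddCommGroup A]
    [Module k A] [AddCommGroup Z] [Module k Z] (ρ : A →ₗ[k] Module.Dual k Z) {N : Submodule k A}
    {B : Submodule k Z} (hN : N = LinearMap.ker ρ) (hB : LinearMap.range ρ = B.dualAnnihilator) :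
    Module.finrank k (A ⧸ N) = Module.finrank k (Z ⧸ B) := by
  subst hN
  rw [ρ.quotKerEquivRange.finrank_eq, hB, ← B.dualQuotEquivDualAnnihilator.finrank_eq,
    Subspace.dual_finrank_eq]

/-- Over a field, the cohomology of the graded dual is the dual of the homology. -/
theorem finrank_homologyAt_dualMap {𝒜 : ℕ → ℕ → Submodule k M}
    (h : DirectSum.IsInternal fun p : ℕ × ℕ => 𝒜 p.1 p.2) {d : M →ₗ[k] M}
    (hd : ∀ n j, ∀ x ∈ 𝒜 (n + 1) j, d x ∈ 𝒜 n j) (hd0 : ∀ j, ∀ x ∈ 𝒜 0 j, d x = 0) (n j : ℕ) :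
    Module.finrank k (HomologyAt d.dualMap
        (⨅ p : {p : ℕ × ℕ // p ≠ (n, j)}, (𝒜 p.1.1 p.1.2).dualAnnihilator)) =
      Module.finrank k (HomologyAt d (𝒜 n j)) := by
  set S := ⨅ p : {p : ℕ × ℕ // p ≠ (n, j)}, (𝒜 p.1.1 p.1.2).dualAnnihilator
  set Z := LinearMap.ker d ⊓ 𝒜 n j with hZ
  have hS : ∀ f ∈ S, ∀ x, f x = f (h.comp (n, j) x) := by
    intro f hf x
    refine h.induction (P := fun x => f x = f (h.comp (n, j) x)) ?_ (by simp) ?_ x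
    · intro p x hx
      by_cases hp : p = (n, j)
      · rw [h.comp_of_mem (hp ▸ hx)]
      · rw [h.comp_of_mem_ne hx hp, map_zero]
        exact (Submodule.mem_dualAnnihilator f).1 ((Submodule.mem_iInf _).1 hf ⟨p, hp⟩) x hx
    · intro x y hx hy
      rw [map_add, map_add, map_add, ← hx, ← hy]
  refine finrank_quotient_eq_of_range_eq_dualAnnihilator
    (Z.dualRestrict ∘ₗ (LinearMap.ker d.dualMap ⊓ S).subtype) ?_ (le_antisymm ?_ ?_)
  · ext f
    rw [Submodule.mem_comap, LinearMap.range_dualMap_eq_dualAnnihilator_ker,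
      Submodule.mem_dualAnnihilator, LinearMap.mem_ker]
    refine ⟨fun hf => LinearMap.ext fun z => hf z.1 z.2.1, fun hf x hx => ?_⟩
    rw [Submodule.subtype_apply, hS f.1 f.2.2]
    exact LinearMap.congr_fun hf ⟨h.comp (n, j) x, h.d_comp_eq_zero hd hd0 n j hx,
      h.comp_mem (n, j) x⟩
  · rintro _ ⟨f, rfl⟩
    rw [Submodule.mem_dualAnnihilator]
    rintro z ⟨x, hx⟩
    change f.1 z.1 = 0
    rw [show z.1 = d x from hx.symm]
    exact LinearMap.congr_fun (LinearMap.mem_ker.1 f.2.1) x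
  · -- a functional on the cycles in `Z` that kills the boundaries extends to `M / d M`
    intro φ hφ
    have hq : (LinearMap.range d).comap Z.subtype =
        LinearMap.ker ((LinearMap.range d).mkQ ∘ₗ Z.subtype) := by
      rw [LinearMap.ker_comp, Submodule.ker_mkQ]
    rw [hq, ← LinearMap.range_dualMap_eq_dualAnnihilator_ker] at hφ
    obtain ⟨ψ, rfl⟩ := hφ
    refine ⟨⟨ψ ∘ₗ (LinearMap.range d).mkQ ∘ₗ h.comp (n, j), ?_, ?_⟩, ?_⟩
    · refine LinearMap.ext fun x => ?_
      change ψ ((LinearMap.range d).mkQ (h.comp (n, j) (d x))) = 0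
      rw [h.comp_lowering_fst hd hd0, (LinearMap.range d).mkQ_apply,
        (Submodule.Quotient.mk_eq_zero (LinearMap.range d)).2 ⟨_, rfl⟩, map_zero]
    · refine (Submodule.mem_iInf _).2 fun p => (Submodule.mem_dualAnnihilator _).2 fun x hx => ?_
      change ψ ((LinearMap.range d).mkQ (h.comp (n, j) x)) = 0
      rw [h.comp_of_mem_ne hx p.2, map_zero, map_zero]
    · refine LinearMap.ext fun z => ?_
      change ψ ((LinearMap.range d).mkQ (h.comp (n, j) z)) = ψ ((LinearMap.range d).mkQ z)
      rw [h.comp_of_mem (g := (n, j)) z.2.2]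

end Homology

section TorExt

variable {k R : Type*} [Field k] [Ring R] [Algebra k R] {𝓡 : ℕ → Submodule k R} [GradedAlgebra 𝓡]
  {C : Type*} [AddCommGroup C] [Module k C] {𝒞 : ℕ × ℕ → Submodule k C} {β : C →ₗ[k] GKoszul 𝓡}

/-- `Tor^R(k, k)` is the reduction `k ⊗_R Y = K ⊗ T(C)` of the minimal resolution. -/
theorem IsKoszulLift.finrank_torBideg (h : IsKoszulLift 𝒞 β) (hR : IsStandardGraded 𝓡)
    (hR3 : 𝓡 3 = ⊥) (n j : ℕ) :
    Module.finrank k (TorBideg 𝓡 n j) = Module.finrank k (koszulSpacePiece 𝓡 𝒞 n j) := by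
  obtain ⟨ε, hε⟩ := hR.exists_isAugmentation
  apply finrank_homologyAt_eq (k := k) (M := BarSpace 𝓡)
    (W := koszulTotal 𝓡 ⊗[k] TensorAlgebra k C) (𝒜 := barPiece 𝓡) (ℬ := koszulSpacePiece 𝓡 𝒞)
    (d := barD 𝓡) (g := koszulToBar β hε hR)
  · exact barPiece_isInternal hR
  · exact koszulSpacePiece_isInternal h.isInternal
  · exact fun _ _ _ => barD_mem
  · exact fun _ _ => barD_eq_zero
  · exact fun _ _ _ => koszulToBar_mem h hε hR
  · exact h.barD_koszulToBar hR3 hε hR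
  · exact fun _ _ => eq_zero_and_exists_of_barD_eq h hR3 hε hR

theorem finrank_extBideg (hR : IsStandardGraded 𝓡) (n j : ℕ) :
    Module.finrank k (ExtBideg 𝓡 n j) = Module.finrank k (TorBideg 𝓡 n j) :=
  finrank_homologyAt_dualMap (𝒜 := barPiece 𝓡) (barPiece_isInternal hR) (fun _ _ _ => barD_mem)
    (fun _ _ => barD_eq_zero) n j

omit [GradedAlgebra 𝓡] in
/-- In `T(C)`, only the scalars lie on or above the diagonal. -/
theorem eq_zero_or_of_mem_tensorPiece (h : ∀ p, (∀ n, p ≠ (n + 2, n + 3)) → 𝒞 p = ⊥) {q : ℕ × ℕ}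
    {t : TensorAlgebra k C} (ht : t ∈ tensorPiece 𝒞 q) :
    t = 0 ∨ q.1 < q.2 ∨ q = 0 ∧ ∃ a : k, t = a • 1 := by
  refine tensorPiece_induction (P := fun q t => t = 0 ∨ q.1 < q.2 ∨ q = 0 ∧ ∃ a : k, t = a • 1)
    ?_ ?_ ?_ ?_ ?_ ht
  · exact Or.inr (Or.inr ⟨rfl, 1, (one_smul k _).symm⟩)
  · intro p q c t hc _ ih
    by_cases hp : ∀ n, p ≠ (n + 2, n + 3)
    · rw [h p hp, Submodule.mem_bot] at hc
      exact Or.inl (by rw [hc, map_zero, zero_mul])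
    · push Not at hp
      obtain ⟨n, rfl⟩ := hp
      rcases ih with rfl | hq | ⟨rfl, -⟩
      · exact Or.inl (mul_zero _)
      · exact Or.inr (Or.inl (by simp only [Prod.fst_add, Prod.snd_add]; omega))
      · exact Or.inr (Or.inl (by simp))
  · exact fun p => Or.inl rfl
  · rintro p t t' (rfl | hq | ⟨rfl, a, rfl⟩) ht'
    · simpa using ht'
    · exact Or.inr (Or.inl hq)
    · rcases ht' with rfl | hq | ⟨-, a', rfl⟩
      · exact Or.inr (Or.inr ⟨rfl, a, add_zero _⟩)
      · exact Or.inr (Or.inl hq)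
      · exact Or.inr (Or.inr ⟨rfl, a + a', (add_smul _ _ _).symm⟩)
  · rintro p a t (rfl | hq | ⟨rfl, b, rfl⟩)
    · exact Or.inl (smul_zero _)
    · exact Or.inr (Or.inl hq)
    · exact Or.inr (Or.inr ⟨rfl, a * b, (mul_smul _ _ _).symm⟩)

omit [GradedAlgebra 𝓡] in
theorem IsKoszulLift.finrank_koszulSpacePiece_diag (h : IsKoszulLift 𝒞 β) (n : ℕ) :
    Module.finrank k (koszulSpacePiece 𝓡 𝒞 n n) = Module.finrank k (koszulPart 𝓡 n) := by
  let f := (TensorProduct.mk k (koszulTotal 𝓡) (TensorAlgebra k C)).flip 1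
  have hf : Function.Injective f := by
    refine Function.LeftInverse.injective (g := TensorProduct.rid k (koszulTotal 𝓡) ∘ₗ
      LinearMap.lTensor _ TensorAlgebra.algebraMapInv.toLinearMap) fun x => ?_
    simp [f]
  have he : koszulSpacePiece 𝓡 𝒞 n n = (koszulPart 𝓡 n).map f := by
    refine le_antisymm (koszulSpacePiece_le fun m q hq κ hκ t ht => ?_) ?_
    · simp only [Prod.ext_iff, Prod.fst_add, Prod.snd_add] at hq
      rcases eq_zero_or_of_mem_tensorPiece h.eq_bot ht with rfl | hlt | ⟨rfl, a, rfl⟩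
      · rw [TensorProduct.tmul_zero]; exact zero_mem _
      · omega
      · obtain rfl : m = n := by simpa using hq.1
        rw [TensorProduct.tmul_smul]
        exact Submodule.smul_mem _ _ ⟨κ, hκ, rfl⟩
    · rintro _ ⟨κ, hκ, rfl⟩
      exact tmul_mem_koszulSpacePiece (add_zero _) hκ one_mem_tensorPiece
  rw [he]
  exact (Submodule.equivMapOfInjective f hf _).finrank_eq.symm

/-- `K_n` is dual to `R^!_n`, so it has the same dimension. -/
theorem IsKoszulLift.finrank_koszulDual (h : IsKoszulLift 𝒞 β) (hR : IsStandardGraded 𝓡)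
    (hR3 : 𝓡 3 = ⊥) (n : ℕ) :
    Module.finrank k (KoszulDual 𝓡 n) = Module.finrank k (koszulPart 𝓡 n) := by
  rw [finrank_extBideg hR, h.finrank_torBideg hR hR3, h.finrank_koszulSpacePiece_diag]

end TorExt

/-! ### Dimension counts in the generalized Koszul complex -/

section Dimension

variable {k : Type*} [Field k]

theorem finrank_map₂_mk {M N : Type*} [AddCommGroup M] [Module k M] [AddCommGroup N] [Module k N]
    (p : Submodule k M) (q : Submodule k N) :
    Module.finrank k (Submodule.map₂ (TensorProduct.mk k M N) p q) =
      Module.finrank k p * Module.finrank k q := by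
  have hinj : Function.Injective (TensorProduct.mapIncl p q) := by
    have h : TensorProduct.mapIncl p q =
        LinearMap.rTensor N p.subtype ∘ₗ LinearMap.lTensor p q.subtype := by
      ext; rfl
    rw [h]
    exact (Module.Flat.rTensor_preserves_injective_linearMap _ p.injective_subtype).comp
      (Module.Flat.lTensor_preserves_injective_linearMap _ q.injective_subtype)
  rw [← TensorProduct.range_mapIncl, ← (LinearEquiv.ofInjective _ hinj).finrank_eq,
    Module.finrank_tensorProduct]

theorem finrank_map_add_finrank_inf_ker {M N : Type*} [AddCommGroup M] [Module k M]
    [AddCommGroup N] [Module k N] (f : M →ₗ[k] N) (p : Submodule k M) [Module.Finite k p] :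
    Module.finrank k (p.map f) + Module.finrank k ↥(p ⊓ LinearMap.ker f) =
      Module.finrank k p := by
  have h := (f.domRestrict p).finrank_range_add_finrank_ker
  rw [LinearMap.range_domRestrict, LinearMap.ker_domRestrict] at h
  rw [← h, (Submodule.equivMapOfInjective p.subtype p.injective_subtype
    ((LinearMap.ker f).comap p.subtype)).finrank_eq, Submodule.map_comap_subtype]

end Dimension

section KoszulDimension

variable {k R : Type*} [Field k] [Ring R] [Algebra k R] {𝓡 : ℕ → Submodule k R} [GradedAlgebra 𝓡]
  {C : Type*} [AddCommGroup C] [Module k C] {𝒞 : ℕ × ℕ → Submodule k C} {β : C →ₗ[k] GKoszul 𝓡}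

theorem IsStandardGraded.finite_koszulPart (hR : IsStandardGraded 𝓡) (n : ℕ) :
    Module.Finite k (koszulPart 𝓡 n) := by
  have := hR.finite 1
  have h1 : (tensorGen 𝓡).FG := Module.Finite.iff_fg.1 (Module.Finite.range _)
  have h2 := Module.Finite.iff_fg.2 (h1.pow n)
  have h3 : Module.Finite k (koszulK 𝓡 n) :=
    Module.Finite.of_injective (Submodule.inclusion (koszulK_le_pow 𝓡 n))
      (Submodule.inclusion_injective _)
  let f : koszulPart 𝓡 n →ₗ[k] koszulK 𝓡 n := (koszulTotal 𝓡).subtype.restrict fun x hx => hx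
  exact Module.Finite.of_injective f fun x y hxy =>
    Subtype.ext (Subtype.ext (congrArg (fun z : koszulK 𝓡 n => z.1) hxy))

theorem IsStandardGraded.finite_gkPiece (hR : IsStandardGraded 𝓡) (i n : ℕ) :
    Module.Finite k (gkPiece 𝓡 i n) := by
  have h1 := hR.finite i
  have h2 := hR.finite_koszulPart n
  exact Module.Finite.iff_fg.2 ((Module.Finite.iff_fg.1 h1).map₂ _ (Module.Finite.iff_fg.1 h2))

omit [GradedAlgebra 𝓡] in
theorem finrank_gkPiece (i n : ℕ) : Module.finrank k (gkPiece 𝓡 i n) =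
    Module.finrank k (𝓡 i) * Module.finrank k (koszulPart 𝓡 n) :=
  finrank_map₂_mk _ _

/-- Exactness of `0 → K_{n+1} → R_1 ⊗ K_n → R_2 ⊗ K_{n-1}`. -/
theorem finrank_map_gkD_gkPiece_one (hR : IsStandardGraded 𝓡) (n : ℕ) :
    Module.finrank k ((gkPiece 𝓡 1 n).map ((gkD 𝓡).restrictScalars k)) +
        Module.finrank k (koszulPart 𝓡 (n + 1)) =
      Module.finrank k (𝓡 1) * Module.finrank k (koszulPart 𝓡 n) := by
  have := hR.finite_gkPiece 1 n
  rw [← finrank_gkPiece, ← finrank_map_add_finrank_inf_ker ((gkD 𝓡).restrictScalars k)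
    (gkPiece 𝓡 1 n)]
  congr 1
  let f : koszulPart 𝓡 (n + 1) →ₗ[k] GKoszul 𝓡 :=
    (gkD 𝓡).restrictScalars k ∘ₗ TensorProduct.mk k R (koszulTotal 𝓡) 1 ∘ₗ
      (koszulPart 𝓡 (n + 1)).subtype
  have h1 : (1 : R) ∈ 𝓡 0 := SetLike.GradedOne.one_mem
  have hf : Function.Injective f := by
    intro y y' hy
    have hy' : gkD 𝓡 ((1 : R) ⊗ₜ (y.1 - y'.1)) = 0 := by
      rw [TensorProduct.tmul_sub, map_sub]
      exact sub_eq_zero.2 hy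
    have h2 := eq_zero_of_mem_gkPiece_zero hR (tmul_mem_gkPiece 𝓡 h1 (sub_mem y.2 y'.2)) hy'
    obtain ⟨ε, hε⟩ := hR.exists_isAugmentation
    have h3 := congrArg (TensorProduct.lid k _ ∘ LinearMap.rTensor (koszulTotal 𝓡) ε) h2
    refine Subtype.ext (sub_eq_zero.1 ?_)
    simpa [hε.map_one] using h3
  have hr : LinearMap.range f = gkPiece 𝓡 1 n ⊓ LinearMap.ker ((gkD 𝓡).restrictScalars k) := by
    refine le_antisymm ?_ fun x hx => ?_
    · rintro _ ⟨y, rfl⟩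
      have h2 := gkD_mem 𝓡 (tmul_mem_gkPiece 𝓡 h1 y.2)
      exact ⟨h2, LinearMap.mem_ker.2 (gkD_gkD 𝓡 ((1 : R) ⊗ₜ y.1))⟩
    · obtain ⟨y, hy, hyx⟩ := exists_gkD_eq_of_mem_gkPiece_one 𝓡 hx.1 hx.2
      exact ⟨⟨y, hy⟩, hyx⟩
  rw [← hr]
  exact (LinearEquiv.ofInjective f hf).finrank_eq

omit [GradedAlgebra 𝓡] in
theorem finrank_koszulPart_zero [Nontrivial R] : Module.finrank k (koszulPart 𝓡 0) = 1 := by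
  refine (finrank_eq_one_iff_of_nonzero' (⟨koszulOne 𝓡, koszulOne_mem 𝓡⟩ : koszulPart 𝓡 0)
    fun h => ?_).2 fun w => ?_
  · exact one_ne_zero (α := TensorAlgebra k (𝓡 1)) (congrArg (fun x => (x.1.1)) h)
  · obtain ⟨a, ha⟩ := exists_smul_koszulOne 𝓡 w.2
    exact ⟨a, Subtype.ext ha.symm⟩

theorem finrank_koszulPart_one (hR : IsStandardGraded 𝓡) :
    Module.finrank k (koszulPart 𝓡 1) = Module.finrank k (𝓡 1) := by
  have := hR.nontrivial
  have h := finrank_map_gkD_gkPiece_one hR 0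
  have h0 : (gkPiece 𝓡 1 0).map ((gkD 𝓡).restrictScalars k) = ⊥ :=
    eq_bot_iff.2 (Submodule.map_le_iff_le_comap.2 fun x hx => gkD_eq_zero_of_mem 𝓡 hx)
  rwa [h0, finrank_bot, zero_add, finrank_koszulPart_zero, mul_one] at h

theorem finrank_koszulPart_two (hR : IsStandardGraded 𝓡) :
    Module.finrank k (𝓡 2) + Module.finrank k (koszulPart 𝓡 2) =
      Module.finrank k (𝓡 1) * Module.finrank k (koszulPart 𝓡 1) := by
  have := hR.nontrivial
  have h := finrank_map_gkD_gkPiece_one hR 1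
  have h0 : (gkPiece 𝓡 1 1).map ((gkD 𝓡).restrictScalars k) = gkPiece 𝓡 2 0 := by
    refine le_antisymm ?_ fun x hx => ?_
    · rintro _ ⟨x, hx, rfl⟩
      exact gkD_mem 𝓡 hx
    · exact exists_gkD_eq_of_mem_gkPiece_succ_zero hR hx
  rwa [h0, finrank_gkPiece, finrank_koszulPart_zero, mul_one] at h

omit [GradedAlgebra 𝓡] in
theorem IsKoszulLift.injective (h : IsKoszulLift 𝒞 β) : Function.Injective β := by
  rw [← LinearMap.ker_eq_bot, eq_bot_iff]
  exact fun c hc => h.eq_zero c 0 ((map_zero _).trans hc.symm)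

theorem IsKoszulLift.comp_apply (h : IsKoszulLift 𝒞 β) (n : ℕ) (c : C) :
    (gkBideg_isInternal 𝓡).comp (n + 1, n + 3) (β c) = β (h.isInternal.comp (n + 2, n + 3) c) := by
  refine h.isInternal.comp_map (gkBideg_isInternal 𝓡) β (fun c hc => ?_) (fun p hp c hc => ?_) c
  · have := h.mem n c hc
    rwa [← gkBideg_add, show 2 + (n + 1) = n + 3 by omega] at this
  · by_cases hp' : ∀ m, p ≠ (m + 2, m + 3)
    · rw [h.eq_bot p hp', Submodule.mem_bot] at hc
      rw [hc, map_zero, map_zero]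
    · push Not at hp'
      obtain ⟨m, rfl⟩ := hp'
      have := h.mem m c hc
      rw [← gkBideg_add] at this
      refine (gkBideg_isInternal 𝓡).comp_of_mem_ne this ?_
      simp only [ne_eq, Prod.ext_iff, not_and] at hp ⊢
      omega

/-- All of `R_2 ⊗ K_{n+1}` consists of cycles, and it is the direct sum of the boundaries and of the
chosen representatives of the homology classes. -/
theorem IsKoszulLift.finrank_add (h : IsKoszulLift 𝒞 β) (hR : IsStandardGraded 𝓡)
    (hR3 : 𝓡 3 = ⊥) (n : ℕ) :
    Module.finrank k (𝒞 (n + 2, n + 3)) +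
        Module.finrank k (𝓡 1) * Module.finrank k (koszulPart 𝓡 (n + 2)) =
      Module.finrank k (𝓡 2) * Module.finrank k (koszulPart 𝓡 (n + 1)) +
        Module.finrank k (koszulPart 𝓡 (n + 3)) := by
  set A := (𝒞 (n + 2, n + 3)).map β with hA
  set B := (gkPiece 𝓡 1 (n + 2)).map ((gkD 𝓡).restrictScalars k) with hB
  have hAle : A ≤ gkPiece 𝓡 2 (n + 1) := Submodule.map_le_iff_le_comap.2 fun c hc => h.mem n c hc
  have hBle : B ≤ gkPiece 𝓡 2 (n + 1) :=
    Submodule.map_le_iff_le_comap.2 fun x hx => gkD_mem 𝓡 hx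
  have hinf : A ⊓ B = ⊥ := by
    rw [eq_bot_iff]
    rintro _ ⟨⟨c, hc, rfl⟩, ⟨x, hx, hxc⟩⟩
    rw [h.eq_zero c x hxc, map_zero]
    exact zero_mem _
  have hsup : A ⊔ B = gkPiece 𝓡 2 (n + 1) := by
    refine le_antisymm (sup_le hAle hBle) fun z hz => ?_
    obtain ⟨u, -, c, a, hzu⟩ := h.exists_eq z (mem_gkCycles_of_mem_gkPiece_two hR3 hz).1
    have h1 : (gkBideg_isInternal 𝓡).comp (n + 1, n + 3) (gkOne 𝓡) = 0 := by
      have : gkOne 𝓡 ∈ gkBideg 𝓡 (0, 0 + 0) := by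
        rw [gkBideg_add]
        exact tmul_mem_gkPiece 𝓡 SetLike.GradedOne.one_mem (koszulOne_mem 𝓡)
      exact (gkBideg_isInternal 𝓡).comp_of_mem_ne this (by simp)
    rw [← gkBideg_add, show 2 + (n + 1) = n + 3 by omega] at hz
    have h2 := congrArg ((gkBideg_isInternal 𝓡).comp (n + 1, n + 3)) hzu
    rw [(gkBideg_isInternal 𝓡).comp_of_mem hz, map_add, map_add, map_smul, h1, smul_zero, add_zero,
      comp_gkD, h.comp_apply, add_comm] at h2
    rw [h2]
    refine Submodule.add_mem_sup ⟨_, h.isInternal.comp_mem _ _, rfl⟩ ⟨_, ?_, rfl⟩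
    have := (gkBideg_isInternal 𝓡).comp_mem (n + 1 + 1, n + 3) u
    have hle : gkBideg 𝓡 (n + 1 + 1, n + 3) ≤ gkPiece 𝓡 1 (n + 2) := by
      rw [show n + 3 = 1 + (n + 1 + 1) by omega, gkBideg_add]
    exact hle this
  have hfin := hR.finite_gkPiece 2 (n + 1)
  have := Submodule.finiteDimensional_of_le hAle
  have := Submodule.finiteDimensional_of_le hBle
  have h1 := Submodule.finrank_sup_add_finrank_inf_eq A B
  rw [hsup, hinf, finrank_bot, add_zero, finrank_gkPiece] at h1
  have h2 := finrank_map_gkD_gkPiece_one hR (n + 2)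
  have h3 : Module.finrank k A = Module.finrank k (𝒞 (n + 2, n + 3)) :=
    (Submodule.equivMapOfInjective β h.injective _).finrank_eq.symm
  rw [← h2, h1, h3, ← hB]
  ring

theorem IsKoszulLift.finite (h : IsKoszulLift 𝒞 β) (hR : IsStandardGraded 𝓡) (p : ℕ × ℕ) :
    Module.Finite k (𝒞 p) := by
  by_cases hp : ∀ n, p ≠ (n + 2, n + 3)
  · rw [h.eq_bot p hp]
    infer_instance
  · push Not at hp
    obtain ⟨n, rfl⟩ := hp
    have := hR.finite_gkPiece 2 (n + 1)
    have hle : (𝒞 (n + 2, n + 3)).map β ≤ gkPiece 𝓡 2 (n + 1) :=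
      Submodule.map_le_iff_le_comap.2 fun c hc => h.mem n c hc
    have := Submodule.finiteDimensional_of_le hle
    exact Module.Finite.equiv (Submodule.equivMapOfInjective β h.injective _).symm

end KoszulDimension

/-! ### Generating functions of graded sets -/

section FiberSeries

variable {σ ι κ : Type*}

/-- The generating function of a set `ι` with degrees `deg`: the coefficient of a monomial is the
number of elements of that degree. -/
def fiberSeries (deg : ι → σ →₀ ℕ) : MvPowerSeries σ ℤ :=
  fun m => (Nat.card {i // deg i = m} : ℤ)

theorem coeff_fiberSeries (deg : ι → σ →₀ ℕ) (m : σ →₀ ℕ) :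
    MvPowerSeries.coeff m (fiberSeries deg) = (Nat.card {i // deg i = m} : ℤ) := rfl

theorem fiberSeries_mul {deg : ι → σ →₀ ℕ} {deg' : κ → σ →₀ ℕ}
    (h : ∀ m, Finite {i // deg i = m}) (h' : ∀ m, Finite {i // deg' i = m}) :
    fiberSeries deg * fiberSeries deg' = fiberSeries fun p : ι × κ => deg p.1 + deg' p.2 := by
  classical
  ext m
  rw [MvPowerSeries.coeff_mul]
  simp only [coeff_fiberSeries]
  have e : {p : ι × κ // deg p.1 + deg' p.2 = m} ≃
      Σ a : Finset.HasAntidiagonal.antidiagonal m, {i // deg i = a.1.1} × {i // deg' i = a.1.2} :=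
    { toFun := fun p => ⟨⟨(deg p.1.1, deg' p.1.2), Finset.HasAntidiagonal.mem_antidiagonal.2 p.2⟩,
        ⟨p.1.1, rfl⟩, ⟨p.1.2, rfl⟩⟩
      invFun := fun x => ⟨(x.2.1.1, x.2.2.1), by
        rw [x.2.1.2, x.2.2.2]; exact Finset.HasAntidiagonal.mem_antidiagonal.1 x.1.2⟩
      left_inv := fun p => rfl
      right_inv := by
        rintro ⟨⟨⟨a, b⟩, hab⟩, ⟨i, hi⟩, ⟨j, hj⟩⟩
        dsimp only at hi hj
        subst hi hj
        rfl }
  rw [Nat.card_congr e, Nat.card_sigma,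
    Finset.sum_coe_sort (Finset.HasAntidiagonal.antidiagonal m) fun a =>
      Nat.card ({i // deg i = a.1} × {i // deg' i = a.2})]
  push_cast [Nat.card_prod]
  rfl

theorem finite_fiber_wordDeg {deg : ι → σ →₀ ℕ} (h : ∀ m, Finite {i // deg i = m})
    (h0 : ∀ i, deg i ≠ 0) (m : σ →₀ ℕ) : Finite {w // wordDeg deg w = m} := by
  classical
  induction m using WellFoundedLT.induction with
  | ind m ih =>
    -- a non-empty word is a letter followed by a word of smaller degree
    have hfin : (⋃ a ∈ ((Finset.HasAntidiagonal.antidiagonal m : Finset _) :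
        Set ((σ →₀ ℕ) × (σ →₀ ℕ))) ∩ {a | a.2 < m}, Set.image2 (fun i w => FreeMonoid.of i * w)
          {i | deg i = a.1} {w | wordDeg deg w = a.2}).Finite := by
      refine Set.Finite.biUnion ((Finset.finite_toSet _).inter_of_left _) fun a ha => ?_
      exact Set.Finite.image2 _ (Set.finite_coe_iff.1 (h a.1)) (Set.finite_coe_iff.1 (ih a.2 ha.2))
    refine ((Set.finite_singleton (1 : FreeMonoid ι)).union hfin).subset fun w hw => ?_
    induction w using FreeMonoid.casesOn with
    | one => exact Or.inl rfl
    | of_mul i w =>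
      have hw' : deg i + wordDeg deg w = m := hw
      refine Or.inr (Set.mem_biUnion (x := (deg i, wordDeg deg w)) ⟨?_, ?_⟩ ⟨i, rfl, w, rfl, rfl⟩)
      · simpa using hw'
      · change wordDeg deg w < m
        rw [← hw']
        exact lt_add_of_pos_left _ (pos_iff_ne_zero.2 (h0 i))

/-- A word is empty, or it is a letter followed by a word. -/
theorem fiberSeries_wordDeg {deg : ι → σ →₀ ℕ} (h : ∀ m, Finite {i // deg i = m})
    (h0 : ∀ i, deg i ≠ 0) :
    fiberSeries (wordDeg deg) = 1 + fiberSeries deg * fiberSeries (wordDeg deg) := by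
  classical
  have hw := finite_fiber_wordDeg h h0
  rw [fiberSeries_mul h hw]
  ext m
  rw [map_add, MvPowerSeries.coeff_one, coeff_fiberSeries, coeff_fiberSeries]
  have e : {w // wordDeg deg w = m} ≃
      {_u : Unit // (0 : σ →₀ ℕ) = m} ⊕ {p : ι × FreeMonoid ι // deg p.1 + wordDeg deg p.2 = m} :=
    { toFun := fun w => match w with
        | ⟨[], hw⟩ => Sum.inl ⟨(), hw⟩
        | ⟨i :: w, hw⟩ => Sum.inr ⟨(i, w), hw⟩
      invFun := fun x => match x with
        | Sum.inl u => ⟨[], u.2⟩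
        | Sum.inr p => ⟨p.1.1 :: p.1.2, p.2⟩
      left_inv := by
        rintro ⟨_ | ⟨i, w⟩, hw⟩ <;> rfl
      right_inv := by
        rintro (⟨⟨⟩, hu⟩ | ⟨⟨i, w⟩, hp⟩) <;> rfl }
  have : Finite {p : ι × FreeMonoid ι // deg p.1 + wordDeg deg p.2 = m} :=
    Finite.of_injective (fun p => (e.symm (Sum.inr p))) fun p q hpq =>
      Sum.inr_injective (e.symm.injective hpq)
  rw [Nat.card_congr e, Nat.card_sum]
  push_cast
  congr 1
  by_cases hm : m = 0
  · subst hm; simp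
  · rw [if_neg hm]
    have : IsEmpty {_u : Unit // (0 : σ →₀ ℕ) = m} := ⟨fun u => hm u.2.symm⟩
    simp

/-- The exponent of the monomial `x ^ n * y ^ j`. -/
def bidegHom : ℕ × ℕ →+ (Fin 2 →₀ ℕ) :=
  (Finsupp.singleAddHom 0).comp (AddMonoidHom.fst ℕ ℕ) +
    (Finsupp.singleAddHom 1).comp (AddMonoidHom.snd ℕ ℕ)

theorem bidegHom_apply (p : ℕ × ℕ) :
    bidegHom p = Finsupp.single 0 p.1 + Finsupp.single 1 p.2 := rfl

theorem bidegHom_eq_iff {p : ℕ × ℕ} {m : Fin 2 →₀ ℕ} : bidegHom p = m ↔ p = (m 0, m 1) := by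
  rw [bidegHom_apply]
  constructor
  · rintro rfl
    ext <;> simp
  · rintro rfl
    ext i
    fin_cases i <;> simp

theorem wordDeg_bidegHom (deg : ι → ℕ × ℕ) :
    wordDeg (fun i => bidegHom (deg i)) = fun w => bidegHom (wordDeg deg w) := by
  funext w
  simp [wordDeg, map_list_sum, Function.comp_def]

end FiberSeries

section SubstXY

theorem coeff_subst_mul (f : PowerSeries ℤ) (m : Fin 2 →₀ ℕ) :
    MvPowerSeries.coeff m (f.subst
      ((MvPowerSeries.X 0 * MvPowerSeries.X 1 : MvPowerSeries (Fin 2) ℤ))) =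
      if m 0 = m 1 then PowerSeries.coeff (m 0) f else 0 := by
  classical
  have hs :
      PowerSeries.HasSubst (MvPowerSeries.X 0 * MvPowerSeries.X 1 : MvPowerSeries (Fin 2) ℤ) :=
    PowerSeries.HasSubst.of_constantCoeff_zero (by simp)
  have hpow : ∀ d : ℕ, (MvPowerSeries.X 0 * MvPowerSeries.X 1 : MvPowerSeries (Fin 2) ℤ) ^ d =
      MvPowerSeries.monomial (bidegHom (d, d)) 1 := by
    intro d
    rw [mul_pow, MvPowerSeries.X_pow_eq, MvPowerSeries.X_pow_eq,
      MvPowerSeries.monomial_mul_monomial, one_mul, bidegHom_apply]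
  rw [PowerSeries.coeff_subst hs]
  simp only [hpow, MvPowerSeries.coeff_monomial]
  rw [finsum_eq_single _ (m 0)]
  · by_cases hm : m 0 = m 1
    · rw [if_pos hm, if_pos, smul_eq_mul, mul_one]
      refine (bidegHom_eq_iff.2 ?_).symm
      rw [← hm]
    · rw [if_neg hm, if_neg, smul_zero]
      intro h
      exact hm (Prod.ext_iff.1 (bidegHom_eq_iff.1 h.symm)).2
  · intro d hd
    rw [if_neg, smul_zero]
    intro h
    exact hd (Prod.ext_iff.1 (bidegHom_eq_iff.1 h.symm)).1

end SubstXY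

/-! ### The Poincaré series -/

section PoincareSeries

variable {k R : Type*} [Field k] [Ring R] [Algebra k R] {𝓡 : ℕ → Submodule k R} [GradedAlgebra 𝓡]
  {C : Type*} [AddCommGroup C] [Module k C] {𝒞 : ℕ × ℕ → Submodule k C} {β : C →ₗ[k] GKoszul 𝓡}

variable (𝒞) in
/-- The series `∑ |C_{n,n+1}| z^n`. -/
def strandHilbert : PowerSeries ℤ :=
  PowerSeries.mk fun n => (Module.finrank k (𝒞 (n, n + 1)) : ℤ)

/-- The Euler characteristic of the strands
`0 → K_{n+3} → R_1 ⊗ K_{n+2} → R_2 ⊗ K_{n+1} → 0` of `GK_R`, whose homology is `C_{n+2,n+3}` at the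
right end and zero elsewhere. Of the three remaining strands, the one formed by `K_0` contributes
`1`, and those starting with `K_1` and `K_2` are exact. -/
theorem IsKoszulLift.koszulDualHilbert_mul (h : IsKoszulLift 𝒞 β) (hR : IsStandardGraded 𝓡)
    (hR3 : 𝓡 3 = ⊥) :
    koszulDualHilbert 𝓡 * (1 - (Module.finrank k (𝓡 1) : PowerSeries ℤ) * PowerSeries.X +
        (Module.finrank k (𝓡 2) : PowerSeries ℤ) * PowerSeries.X ^ 2) =
      1 + PowerSeries.X * strandHilbert 𝒞 := by
  have := hR.nontrivial
  have hK : ∀ n, PowerSeries.coeff n (koszulDualHilbert 𝓡) =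
      (Module.finrank k (koszulPart 𝓡 n) : ℤ) := fun n => by
    rw [koszulDualHilbert, PowerSeries.coeff_mk, h.finrank_koszulDual hR hR3]
  have hbot : ∀ p, (∀ n, p ≠ (n + 2, n + 3)) → Module.finrank k (𝒞 p) = 0 := fun p hp => by
    rw [h.eq_bot p hp, finrank_bot]
  have h0 : Module.finrank k (koszulPart 𝓡 0) = 1 := finrank_koszulPart_zero
  have h1 := finrank_koszulPart_one hR
  have h2 := finrank_koszulPart_two hR
  have hcast : ∀ r : ℕ, (r : PowerSeries ℤ) = PowerSeries.C (r : ℤ) := fun r =>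
    (map_natCast _ r).symm
  set r₁ := Module.finrank k (𝓡 1)
  set r₂ := Module.finrank k (𝓡 2)
  have hexp : koszulDualHilbert 𝓡 * (1 - (r₁ : PowerSeries ℤ) * PowerSeries.X +
      (r₂ : PowerSeries ℤ) * PowerSeries.X ^ 2) = koszulDualHilbert 𝓡 -
        PowerSeries.X * (PowerSeries.C (r₁ : ℤ) * koszulDualHilbert 𝓡) +
        PowerSeries.X * (PowerSeries.X * (PowerSeries.C (r₂ : ℤ) * koszulDualHilbert 𝓡)) := by
    rw [hcast, hcast]
    ring
  rw [hexp]
  ext n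
  match n with
  | 0 =>
    simp only [map_add, map_sub, PowerSeries.coeff_zero_X_mul, PowerSeries.coeff_zero_one, hK, h0]
    norm_num
  | 1 =>
    simp only [map_add, map_sub, PowerSeries.coeff_succ_X_mul,
      PowerSeries.coeff_C_mul, hK, h0, h1, PowerSeries.coeff_one, strandHilbert,
      PowerSeries.coeff_mk, hbot (0, 0 + 1) (fun n => by simp)]
    simp
  | 2 =>
    simp only [map_add, map_sub, PowerSeries.coeff_succ_X_mul,
      PowerSeries.coeff_C_mul, hK, h0, h1, PowerSeries.coeff_one, strandHilbert,
      PowerSeries.coeff_mk, hbot (1, 1 + 1) (fun n => by simp)]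
    rw [h1] at h2
    push_cast [← Nat.cast_inj (R := ℤ)] at h2 ⊢
    simp
    linarith
  | n + 3 =>
    have h3 := h.finrank_add hR hR3 n
    simp only [map_add, map_sub, PowerSeries.coeff_succ_X_mul,
      PowerSeries.coeff_C_mul, hK, PowerSeries.coeff_one, strandHilbert,
      PowerSeries.coeff_mk]
    rw [if_neg (by omega), zero_add]
    have h4 : (Module.finrank k (𝒞 (n + 2, n + 2 + 1)) : ℤ) + r₁ *
        (Module.finrank k (koszulPart 𝓡 (n + 2)) : ℤ) =
        r₂ * (Module.finrank k (koszulPart 𝓡 (n + 1)) : ℤ) +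
          (Module.finrank k (koszulPart 𝓡 (n + 3)) : ℤ) := by
      exact_mod_cast h3
    linarith

omit [GradedAlgebra 𝓡] in
/-- The generating function of `C`: since `C_{n,j} = 0` unless `j = n + 1`, it is
`y ∑ |C_{n,n+1}| (xy)^n`. -/
theorem IsKoszulLift.fiberSeries_eq (h : IsKoszulLift 𝒞 β) {ι : Type*} {b : Module.Basis ι k C}
    {deg : ι → ℕ × ℕ} (hb : IsHomogeneousBasis b deg 𝒞) :
    fiberSeries (fun i => bidegHom (deg i)) = MvPowerSeries.X 1 *
      (strandHilbert 𝒞).subst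
        (MvPowerSeries.X 0 * MvPowerSeries.X 1 : MvPowerSeries (Fin 2) ℤ) := by
  ext m
  have h1 : MvPowerSeries.coeff m (fiberSeries fun i => bidegHom (deg i)) =
      (Module.finrank k (𝒞 (m 0, m 1)) : ℤ) := by
    rw [coeff_fiberSeries, hb.finrank_eq]
    exact congrArg _ (Nat.card_congr (Equiv.subtypeEquivRight fun i => bidegHom_eq_iff))
  have hX : ∀ φ : MvPowerSeries (Fin 2) ℤ, MvPowerSeries.coeff m (MvPowerSeries.X 1 * φ) =
      if Finsupp.single 1 1 ≤ m then MvPowerSeries.coeff (m - Finsupp.single 1 1) φ else 0 :=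
    fun φ => by rw [MvPowerSeries.X, MvPowerSeries.coeff_monomial_mul, one_mul]
  rw [h1, hX]
  have hle : Finsupp.single 1 1 ≤ m ↔ 1 ≤ m 1 := by
    rw [Finsupp.single_le_iff]
  by_cases hm : 1 ≤ m 1 ∧ m 1 = m 0 + 1
  · rw [if_pos (hle.2 hm.1), coeff_subst_mul, if_pos (by simp [hm.2])]
    rw [hm.2]
    simp [strandHilbert]
  · have h2 : 𝒞 (m 0, m 1) = ⊥ := h.eq_bot _ fun n hn => hm (by
      simp only [Prod.mk.injEq] at hn
      omega)
    rw [h2, finrank_bot]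
    split_ifs with hle'
    · rw [hle] at hle'
      rw [coeff_subst_mul, if_neg (by simp; omega)]
      rfl
    · rfl

/-- `Tor` has the bigraded dimensions of `K ⊗ T(C)`, and a word in a basis of `C` is empty, or it is
a letter followed by a word. -/
theorem IsKoszulLift.poincareSeries_mul (h : IsKoszulLift 𝒞 β) (hR : IsStandardGraded 𝓡)
    (hR3 : 𝓡 3 = ⊥) :
    poincareSeries 𝓡 * (1 - MvPowerSeries.X 1 *
      (strandHilbert 𝒞).subst (MvPowerSeries.X 0 * MvPowerSeries.X 1 : MvPowerSeries (Fin 2) ℤ)) =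
      (koszulDualHilbert 𝓡).subst
        (MvPowerSeries.X 0 * MvPowerSeries.X 1 : MvPowerSeries (Fin 2) ℤ) := by
  obtain ⟨ι, b, deg, hb⟩ := h.isInternal.exists_isHomogeneousBasis
  obtain ⟨κ, c, deg', hc⟩ := (koszulPart_isInternal 𝓡).exists_isHomogeneousBasis
  have hfin : ∀ m, Finite {i // bidegHom (deg i) = m} := fun m => by
    have := h.finite hR (m 0, m 1)
    exact ((hb.finite_fiber (m 0, m 1)).subset fun i hi => bidegHom_eq_iff.1 hi)
  have hfin' : ∀ m, Finite {i // bidegHom (deg' i, deg' i) = m} := fun m => by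
    have := hR.finite_koszulPart (m 0)
    exact ((hc.finite_fiber (m 0)).subset fun i hi =>
      (Prod.ext_iff.1 (bidegHom_eq_iff.1 hi)).1)
  have h0 : ∀ i, bidegHom (deg i) ≠ 0 := fun i hi => by
    have h1 := hb.mem i
    rw [bidegHom_eq_iff.1 hi, h.eq_bot _ (fun n => by simp), Submodule.mem_bot] at h1
    exact b.ne_zero i h1
  have hK : fiberSeries (fun i => bidegHom (deg' i, deg' i)) = (koszulDualHilbert 𝓡).subst
      (MvPowerSeries.X 0 * MvPowerSeries.X 1 : MvPowerSeries (Fin 2) ℤ) := by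
    ext m
    rw [coeff_fiberSeries, coeff_subst_mul, koszulDualHilbert, PowerSeries.coeff_mk,
      h.finrank_koszulDual hR hR3, hc.finrank_eq]
    split_ifs with hm
    · refine congrArg _ (Nat.card_congr (Equiv.subtypeEquivRight fun i => ?_))
      rw [bidegHom_eq_iff, ← hm, Prod.mk.injEq, and_self]
    · have : IsEmpty {i // bidegHom (deg' i, deg' i) = m} := ⟨fun i => hm (by
        have h1 := bidegHom_eq_iff.1 i.2
        rw [Prod.mk.injEq] at h1
        exact h1.1.symm.trans h1.2)⟩
      simp
  have hP : poincareSeries 𝓡 = fiberSeries (fun i => bidegHom (deg' i, deg' i)) *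
      fiberSeries (wordDeg fun i => bidegHom (deg i)) := by
    rw [fiberSeries_mul hfin' (finite_fiber_wordDeg hfin h0)]
    ext m
    have h1 : IsHomogeneousBasis (c.tensorProduct b.tensorAlgebra)
        (fun i => (deg' i.1, deg' i.1) + wordDeg deg i.2)
        fun l : ℕ × ℕ => koszulSpacePiece 𝓡 𝒞 l.1 l.2 :=
      (hc.coarsen fun n => (n, n)).tensorProduct_add hb.tensorAlgebra
    have h2 := h1.finrank_eq (m 0, m 1)
    rw [coeff_fiberSeries]
    change (Module.finrank k (TorBideg 𝓡 (m 0) (m 1)) : ℤ) = _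
    rw [h.finrank_torBideg hR hR3, h2, wordDeg_bidegHom]
    refine congrArg _ (Nat.card_congr (Equiv.subtypeEquivRight fun i => ?_))
    rw [← map_add, bidegHom_eq_iff]
  rw [hP, ← hK, ← h.fiberSeries_eq hb, mul_assoc]
  have hT := fiberSeries_wordDeg hfin h0
  have hT' : fiberSeries (wordDeg fun i => bidegHom (deg i)) *
      (1 - fiberSeries fun i => bidegHom (deg i)) = 1 := by
    linear_combination hT
  rw [hT', mul_one]

theorem IsKoszulLift.subst_koszulDualHilbert_mul (h : IsKoszulLift 𝒞 β) (hR : IsStandardGraded 𝓡)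
    (hR3 : 𝓡 3 = ⊥) {z : MvPowerSeries (Fin 2) ℤ} (hz : PowerSeries.HasSubst z) :
    (koszulDualHilbert 𝓡).subst z * (1 - (Module.finrank k (𝓡 1) : MvPowerSeries (Fin 2) ℤ) * z +
        (Module.finrank k (𝓡 2) : MvPowerSeries (Fin 2) ℤ) * z ^ 2) =
      1 + z * (strandHilbert 𝒞).subst z := by
  have h1 := congrArg (PowerSeries.substAlgHom hz) (h.koszulDualHilbert_mul hR hR3)
  simpa only [map_mul, map_add, map_sub, map_one, map_pow, map_natCast,
    PowerSeries.substAlgHom_X, PowerSeries.coe_substAlgHom] using h1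

theorem IsKoszulLift.subst_koszulDualHilbert_ne_zero (h : IsKoszulLift 𝒞 β)
    (hR : IsStandardGraded 𝓡) (hR3 : 𝓡 3 = ⊥) :
    (koszulDualHilbert 𝓡).subst
      (MvPowerSeries.X 0 * MvPowerSeries.X 1 : MvPowerSeries (Fin 2) ℤ) ≠ 0 := by
  intro h0
  have := hR.nontrivial
  have h1 := congrArg (MvPowerSeries.coeff 0) h0
  rw [coeff_subst_mul, Finsupp.coe_zero, Pi.zero_apply, Pi.zero_apply, if_pos rfl,
    koszulDualHilbert, PowerSeries.coeff_mk, h.finrank_koszulDual hR hR3,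
    finrank_koszulPart_zero] at h1
  simp at h1

theorem denominator_ne_zero_and_mul_eq {A : Type*} [CommRing A] [NoZeroDivisors A]
    {x y H P c r₁ r₂ : A}
    (hx : x ≠ 0) (hH0 : H ≠ 0)
    (hH : H * (1 - r₁ * (x * y) + r₂ * (x * y) ^ 2) = 1 + x * y * c) (hP : P * (1 - y * c) = H) :
    1 + x - H * (1 - r₁ * (x * y) + r₂ * (x ^ 2 * y ^ 2)) ≠ 0 ∧
      P * (1 + x - H * (1 - r₁ * (x * y) + r₂ * (x ^ 2 * y ^ 2))) = x * H := by
  have hPD : P * (1 + x - H * (1 - r₁ * (x * y) + r₂ * (x ^ 2 * y ^ 2))) = x * H := by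
    linear_combination x * hP - P * hH
  refine ⟨fun h0 => ?_, hPD⟩
  rw [h0, mul_zero] at hPD
  exact mul_ne_zero hx hH0 hPD.symm

theorem IsKoszulLift.poincareSeries_eq (h : IsKoszulLift 𝒞 β) (hR : IsStandardGraded 𝓡)
    (hR3 : 𝓡 3 = ⊥) :
    let x : MvPowerSeries (Fin 2) ℤ := MvPowerSeries.X 0
    let y : MvPowerSeries (Fin 2) ℤ := MvPowerSeries.X 1
    let H : MvPowerSeries (Fin 2) ℤ := (koszulDualHilbert 𝓡).subst (x * y)
    let r₁ : MvPowerSeries (Fin 2) ℤ := (Module.finrank k (𝓡 1) : MvPowerSeries (Fin 2) ℤ)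
    let r₂ : MvPowerSeries (Fin 2) ℤ := (Module.finrank k (𝓡 2) : MvPowerSeries (Fin 2) ℤ)
    let D : MvPowerSeries (Fin 2) ℤ := 1 + x - H * (1 - r₁ * (x * y) + r₂ * (x ^ 2 * y ^ 2))
    D ≠ 0 ∧ poincareSeries 𝓡 * D = x * H := by
  have hs :
      PowerSeries.HasSubst (MvPowerSeries.X 0 * MvPowerSeries.X 1 : MvPowerSeries (Fin 2) ℤ) :=
    PowerSeries.HasSubst.of_constantCoeff_zero (by simp)
  have hx : (MvPowerSeries.X 0 : MvPowerSeries (Fin 2) ℤ) ≠ 0 := fun h0 => by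
    have h1 := congrArg (MvPowerSeries.coeff (Finsupp.single 0 1)) h0
    simp [MvPowerSeries.coeff_X] at h1
  exact denominator_ne_zero_and_mul_eq hx (h.subst_koszulDualHilbert_ne_zero hR hR3)
    (h.subst_koszulDualHilbert_mul hR hR3 hs) (h.poincareSeries_mul hR hR3)

end PoincareSeries

theorem mainTheorem2 {k R : Type*} [Field k] [Ring R] [Algebra k R] (𝓡 : ℕ → Submodule k R)
    [GradedAlgebra 𝓡] (hR : IsStandardGraded 𝓡) (hR3 : 𝓡 3 = ⊥) :
    (∃ α : KoszulC 𝓡 →ₗ[k] gkCycles 𝓡, IsKoszulSection 𝓡 α) ∧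
    (∀ α : KoszulC 𝓡 →ₗ[k] gkCycles 𝓡, IsKoszulSection 𝓡 α →
      IsMinimalFreeResolution 𝓡 (koszulYPiece 𝓡) (koszulYD 𝓡 α)) ∧
    (let x : MvPowerSeries (Fin 2) ℤ := MvPowerSeries.X 0
     let y : MvPowerSeries (Fin 2) ℤ := MvPowerSeries.X 1
     let H : MvPowerSeries (Fin 2) ℤ := (koszulDualHilbert 𝓡).subst (x * y)
     let r₁ : MvPowerSeries (Fin 2) ℤ := (Module.finrank k (𝓡 1) : MvPowerSeries (Fin 2) ℤ)
     let r₂ : MvPowerSeries (Fin 2) ℤ := (Module.finrank k (𝓡 2) : MvPowerSeries (Fin 2) ℤ)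
     let D : MvPowerSeries (Fin 2) ℤ := 1 + x - H * (1 - r₁ * (x * y) + r₂ * (x ^ 2 * y ^ 2))
     D ≠ 0 ∧ poincareSeries 𝓡 * D = x * H) := by
  refine ⟨?_, ?_, ?_⟩
  · exact exists_isKoszulSection hR hR3
  · exact fun α hα => hα.isMinimalFreeResolution hR hR3
  · exact (exists_isKoszulSection hR hR3).elim fun _ hα =>
      (hα.isKoszulLift hR hR3).poincareSeries_eq hR hR3
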